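/- **Notation.** All measures are non-negative Borel measures on $\mathbb R$ (the zero measure is allowed). For $n\in\mathbb R$, $\mathcal M_+^{(n)}$ is the set of $\lambda$ with $\int(1+s^2)^{-n/2}\,d\lambda(s)<\infty$; $\mathcal M_{\rm exp}^{(n)}$ is the set of $\lambda\in\mathcal M_+^{(n)}$ whose support is bounded below; $\mathcal M_{\rm frac}$ is the set of $\lambda\in\mathcal M_{\rm exp}^{(2)}$ with $\operatorname{supp}\lambda\subset[0,\infty)$ such that $s^{-1}d\lambda(s)$ is locally finite (in particular $\lambda(\{0\})=0$). Put $$\mathcal L_b[\lambda](t)=\int e^{-ts}d\lambda(s),\quad \sigma_{\mathbb R}(\lambda)=-\int\frac{s\,d\lambda(s)}{\pi(1+s^2)}\ (\lambda\in\mathcal M_{\rm exp}^{(1)}),\quad \xi_{\rm frac}(\lambda)=\frac1\pi\int\frac{d\lambda(s)}{s(1+s^2)}\ (\lambda\in\mathcal M_{\rm frac}),$$ $$Q_{\rm reg}[\lambda](z)=\int\frac i\pi\Big(\frac1{z-s}+\frac s{1+s^2}\Big)d\lambda(s)\qquad(\lambda\in\mathcal M_+^{(2)},\ \Im z>0).$$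 For $\lambda\in\mathcal M_+^{(2)}$, $c_0\in\mathbb R$, $c_1\ge0$, write $\mathcal B_{\rm reg}[\lambda,c_0,c_1]=(\mu,\zeta_0,\zeta_1)$ if $\mu\in\mathcal M_+^{(2)}$, $\zeta_0\in\mathbb R$, $\zeta_1\ge0$ and $$\big(Q_{\rm reg}[\lambda](z)-\tfrac i\pi(c_0+c_1z)\big)\big(Q_{\rm reg}[\mu](z)-\tfrac i\pi(\zeta_0+\zeta_1z)\big)=1\qquad\text{for all }\Im z>0.$$ For $K_1,K_2:(0,\infty)\to\mathbb R$ and locally integrable $x,y$ on $[0,\infty)$, the equation $$y(t)=c_1\dot x(t)-c_0x(t)-\int_0^tK_1(t-\tau)x(\tau)\,d\tau+\frac d{dt}\int_0^tK_2(t-\tau)x(\tau)\,d\tau,\qquad x(0)=x_0\ \text{ if }c_1\ne0,\tag{rCM}$$ is understood for almost every $t\ge0$: the function $\int_0^tK_2(t-\tau)x(\tau)d\tau$ and, if $c_1\neq0$, the function $x$ agree almost everywhere with locally absolutely continuous functions on $[0,\infty)$ with initial values $0$ and $x_0$ respectively, whose derivatives are the ones in the equation. **Proposition (Solution of rCM).**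 Let $K_1=\mathcal L_b[\lambda_1]$ with $\lambda_1\in\mathcal M_{\rm exp}^{(1)}$, let $K_2=\mathcal L_b[s^{-1}d\lambda_2(s)]$ with $\lambda_2\in\mathcal M_{\rm frac}$, and let $c_0\in\mathbb R$, $c_1\ge0$, where $\lambda_1,\lambda_2,c_0,c_1$ are not all zero. Then: 1. There is a unique triple $(\mu,\zeta_0',\zeta_1)=\mathcal B_{\rm reg}[\lambda_1+\lambda_2,\;c_0-\pi\sigma_{\mathbb R}(\lambda_1)-\pi\xi_{\rm frac}(\lambda_2),\;c_1]$, and $\mu\in\mathcal M_{\rm exp}^{(2)}$. 2. $\mu$ can be decomposed as $\mu=\mu_1+\mu_2$ with $\mu_1\in\mathcal M_{\rm exp}^{(1)}$ and $\mu_2\in\mathcal M_{\rm frac}$. 3. For any such decomposition, put $J_1=\mathcal L_b[\mu_1]$, $J_2=\mathcal L_b[s^{-1}d\mu_2(s)]$ and $\zeta_0=\zeta_0'+\pi\sigma_{\mathbb R}(\mu_1)+\pi\xi_{\rm frac}(\mu_2)$. Then, for every $x_0\in\mathbb R$ and all locally integrable $x,y:[0,\infty)\to\mathbb R$, the pair $(x,y)$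 satisfies (rCM) if and only if $$-\pi^2x(t)=\zeta_1\dot y(t)-\zeta_0y(t)-\int_0^tJ_1(t-\tau)y(\tau)\,d\tau+\frac d{dt}\int_0^tJ_2(t-\tau)y(\tau)\,d\tau-c_1x_0\big(J_1(t)-\dot J_2(t)\big)$$ in the same sense (with $y(0)=0$ if $\zeta_1\ne0$), which is again an equation of the form (rCM), now for $y$. In particular (take $\lambda_2=0$, $c_0=c_1=0$) this inverts the first-kind equation $y(t)=-\int_0^tK_1(t-\tau)x(\tau)\,d\tau$. 4. (Abel's equation.) For $0<\alpha<1$ and locally integrable $x,y:[0,\infty)\to\mathbb R$, $$y(t)=\frac1{\Gamma(\alpha)}\int_0^t\frac{x(\tau)}{(t-\tau)^\alpha}\,d\tau\ \text{ for a.e. }t\ge0\quad\Longleftrightarrow\quad x(t)=\frac1{\Gamma(1-\alpha)}\frac d{dt}\int_0^t\frac{y(\tau)}{(t-\tau)^{1-\alpha}}\,d\tau,$$ where the right-hand side means that the last integral agrees a.e. with a locally absolutely continuous function on $[0,\infty)$ that vanishes at $0$ and has derivative $x$ a.e. -/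

import Mathlib

open MeasureTheory Set

noncomputable section

/-- A non-negative Borel measure on the line belongs to the class of order `n` when it integrates
`(1 + s ^ 2) ^ (-n / 2)`. (Such a measure is automatically locally finite. The zero measure is
allowed.) -/
def MemMPlus (n : ℝ) (lam : Measure ℝ) : Prop :=
  ∫⁻ s : ℝ, ENNReal.ofReal ((1 + s ^ 2) ^ (-n / 2)) ∂lam < ⊤

/-- Measures of order `n` whose support is bounded below. -/
def MemMExp (n : ℝ) (lam : Measure ℝ) : Prop :=
  MemMPlus n lam ∧ BddBelow lam.support

/-- The measure `s⁻¹ dlam(s)`, for `lam` supported on `[0, ∞)`. The inverse is taken in `[0, ∞]`,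
so that an atom of `lam` at `0` gives an infinite atom. -/
def invMeasure (lam : Measure ℝ) : Measure ℝ :=
  lam.withDensity (fun s => (ENNReal.ofReal s)⁻¹)

/-- Fractional spectral measures: order `2`, supported on `[0, ∞)`, with `s⁻¹ dlam(s)` locally
finite. -/
def MemMFrac (lam : Measure ℝ) : Prop :=
  MemMExp 2 lam ∧ lam.support ⊆ Ici 0 ∧ IsLocallyFiniteMeasure (invMeasure lam)

/-- The (bilateral) Laplace transform of a measure, `t ↦ ∫ e^{-ts} dlam(s)`. -/
def laplaceB (lam : Measure ℝ) (t : ℝ) : ℝ :=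
  ∫ s : ℝ, Real.exp (-(t * s)) ∂lam

/-- `σ_ℝ(lam) = - ∫ s / (π (1 + s ^ 2)) dlam(s)`. -/
def sigmaR (lam : Measure ℝ) : ℝ :=
  -∫ s : ℝ, s / (Real.pi * (1 + s ^ 2)) ∂lam

/-- `ξ_frac(lam) = π⁻¹ ∫ 1 / (s (1 + s ^ 2)) dlam(s)`. -/
def xiFrac (lam : Measure ℝ) : ℝ :=
  (1 / Real.pi) * ∫ s : ℝ, 1 / (s * (1 + s ^ 2)) ∂lam

/-- The regularized Cauchy transform on the upper half-plane. -/
def Qreg (lam : Measure ℝ) (z : ℂ) : ℂ :=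
  ∫ s : ℝ, (Complex.I / Real.pi) * (1 / (z - s) + s / (1 + s ^ 2)) ∂lam

/-- `IsBreg lam c₀ c₁ mu ζ₀ ζ₁` says that `B_reg[lam, c₀, c₁] = (mu, ζ₀, ζ₁)`. -/
def IsBreg (lam : Measure ℝ) (c₀ c₁ : ℝ) (mu : Measure ℝ) (ζ₀ ζ₁ : ℝ) : Prop :=
  MemMPlus 2 mu ∧ 0 ≤ ζ₁ ∧
    ∀ z : ℂ, 0 < z.im →
      (Qreg lam z - (Complex.I / Real.pi) * (c₀ + c₁ * z)) *
        (Qreg mu z - (Complex.I / Real.pi) * (ζ₀ + ζ₁ * z)) = 1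

/-- The Volterra convolution `t ↦ ∫_0^t K (t - τ) x(τ) dτ`. -/
def vconv (K x : ℝ → ℝ) (t : ℝ) : ℝ :=
  ∫ τ in (0 : ℝ)..t, K (t - τ) * x τ

/-- On `[0, ∞)`, the function `f` has (up to a null set) a locally absolutely continuous
representative with value `f₀` at time `0` and with derivative `f'` almost everywhere. -/
def HasACDeriv (f : ℝ → ℝ) (f₀ : ℝ) (f' : ℝ → ℝ) : Prop :=
  LocallyIntegrableOn f' (Ici 0) ∧
    ∀ᵐ t ∂(volume.restrict (Ici (0 : ℝ))), f t = f₀ + ∫ τ in (0 : ℝ)..t, f' τ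

/-- `x` solves, on `[0, ∞)`, the equation
`y = c₁ x' - c₀ x - ∫_0^t K₁ (t - τ) x(τ) dτ + d/dt ∫_0^t K₂ (t - τ) x(τ) dτ`,
with `x(0) = x₀` if `c₁ ≠ 0`. The equation holds almost everywhere; both derivatives are derivatives
of locally absolutely continuous functions, and `∫_0^t K₂ (t - τ) x(τ) dτ` starts from `0`. -/
def SolvesRCM (c₀ c₁ : ℝ) (K₁ K₂ : ℝ → ℝ) (x₀ : ℝ) (x y : ℝ → ℝ) : Prop :=
  ∃ x' v : ℝ → ℝ,
    (c₁ ≠ 0 → HasACDeriv x x₀ x') ∧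
    HasACDeriv (vconv K₂ x) 0 v ∧
    ∀ᵐ t ∂(volume.restrict (Ici (0 : ℝ))),
      y t = c₁ * x' t - c₀ * x t - vconv K₁ x t + v t

end

/-! Up to the factor `-(I / π)`, the function `Qreg lam z - (I / π) (c₀ + c₁ z)` is the Pick
function `pick lam c₀ c₁`, which maps the upper half-plane to its closure. The relation defining
`IsBreg` becomes N · N' = -π² for two Pick functions. Since w ↦ -π²/w preserves the upper
half-plane, the reciprocal is again a Pick function. Its data exist by the Nevanlinna representation
(`exists_eq_pick`) and are unique by Stieltjes inversion (`pick_injective`). To the left of the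
support, N is real and, unless constant, strictly monotone, so it has at most one zero there. Hence
-π²/N is continuous with real values near a left half-line, and the dual measure has no mass on that
half-line (`exists_pick_mul_eq`). Cutting at 1 decomposes the dual measure.

The equation is solved in the algebra ℝδ ⊕ L¹_loc[0, ∞) under convolution (`VolterraAlg`).
Integrated once, it reads `step * y = (c₁ + A) * x - c₁ x₀ step` with A = `volterraKer`, and the
Laplace transform of c₁δ + A at p is -N(-p)/p (`pick_neg_eq`). So N · N' = -π² says that the
transforms of the two symbols multiply to -π²/p². By Lerch's theorem the symbols themselves multiply
to -π² `step`² (`DualPair.vol_mul`). Multiplying the integrated equation by the dual symbol and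
cancelling `step` gives the dual equation, and conversely.

Returning from the integrated to the differentiated equation is a regularity question. For c₁ = 0
the derivative of K₂ * x is read off from the equation. For c₁ ≠ 0, x itself must be shown
absolutely continuous. Then ζ₁ = 0 and the dual measure is finite (`finite_of_pick_mul_eq`). Its
Laplace transform M is absolutely continuous, starts at π²/c₁ and satisfies (c₁ + A) M = π² `step`
(`DualPair.exists_resolvent`). Therefore π² x = M * y + c₁ x₀ M. The same M is the forcing term J₁ -
J₂' of the dual equation.

Abel's equation uses the same algebra: two power kernels convolve to `step`. -/

section PickFunctions

open Filter Topology

/-! ### Pick functions -/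

/-- The kernel of the regularized Cauchy transform. -/
noncomputable def cauchyKer (z : ℂ) (s : ℝ) : ℂ := 1 / ((s : ℂ) - z) - (s : ℂ) / (1 + (s : ℂ) ^ 2)

/-- The Pick function with measure `lam` and affine part `c₀ + c₁ z`. -/
noncomputable def pick (lam : Measure ℝ) (c₀ c₁ : ℝ) (z : ℂ) : ℂ :=
  c₀ + c₁ * z + ∫ s, cauchyKer z s ∂lam

lemma memMPlus_two_iff {lam : Measure ℝ} :
    MemMPlus 2 lam ↔ Integrable (fun s : ℝ => (1 + s ^ 2)⁻¹) lam := by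
  have h : ∀ s : ℝ, (1 + s ^ 2) ^ (-(2 : ℝ) / 2) = (1 + s ^ 2)⁻¹ := fun s => by
    rw [show (-(2 : ℝ) / 2) = -1 by norm_num, Real.rpow_neg_one]
  unfold MemMPlus
  simp only [h]
  rw [← lintegral_ofReal_ne_top_iff_integrable, lt_top_iff_ne_top]
  · exact (by fun_prop : Measurable fun s : ℝ => (1 + s ^ 2)⁻¹).aestronglyMeasurable
  · exact Eventually.of_forall fun s => by positivity

lemma one_add_sq_ne_zero (s : ℝ) : (1 : ℂ) + (s : ℂ) ^ 2 ≠ 0 := by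
  have : (1 : ℝ) + s ^ 2 ≠ 0 := by positivity
  exact_mod_cast this

lemma measurable_cauchyKer (z : ℂ) : Measurable (cauchyKer z) := by
  unfold cauchyKer; fun_prop

/-- From |s| ≤ |s - z| + R one gets s² ≤ 2|s - z|² + 2R², and |s - z| ≥ δ absorbs the constants.
This dominates squared Cauchy kernels and Poisson kernels by the order-two weight, uniformly for
bounded z. -/
lemma one_add_sq_le_normSq {z : ℂ} {s δ R : ℝ} (hδ : 0 < δ) (hs : δ ≤ ‖(s : ℂ) - z‖)
    (hz : ‖z‖ ≤ R) : 1 + s ^ 2 ≤ ((1 + 2 * R ^ 2) / δ ^ 2 + 2) * ‖(s : ℂ) - z‖ ^ 2 := by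
  have h1 : |s| ≤ ‖(s : ℂ) - z‖ + R := by
    calc |s| = ‖(s : ℂ)‖ := by simp
      _ = ‖((s : ℂ) - z) + z‖ := by ring_nf
      _ ≤ _ := (norm_add_le _ _).trans (by gcongr)
  have hR : 0 ≤ R := (norm_nonneg z).trans hz
  set d := ‖(s : ℂ) - z‖
  have hd : 0 ≤ d := norm_nonneg _
  have h2 : s ^ 2 ≤ (d + R) ^ 2 := by
    rw [← sq_abs]; gcongr
  have h3 : (1 + 2 * R ^ 2) ≤ (1 + 2 * R ^ 2) / δ ^ 2 * d ^ 2 := by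
    rw [div_mul_eq_mul_div, le_div_iff₀ (by positivity)]
    gcongr
  nlinarith [sq_nonneg (d - R)]

/-- Over the denominator 1 + s² the kernel has numerator (1 + z²)/(s - z) + z, which is bounded when
s stays away from z. -/
lemma norm_cauchyKer_le {z : ℂ} {s δ R : ℝ} (hδ : 0 < δ) (hs : δ ≤ ‖(s : ℂ) - z‖)
    (hz : ‖z‖ ≤ R) : ‖cauchyKer z s‖ ≤ ((1 + R ^ 2) / δ + R) * (1 + s ^ 2)⁻¹ := by
  have hd : 0 < ‖(s : ℂ) - z‖ := hδ.trans_le hs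
  have hne : (s : ℂ) - z ≠ 0 := norm_pos_iff.1 hd
  have hR : 0 ≤ R := (norm_nonneg z).trans hz
  have e : cauchyKer z s = ((1 + z ^ 2) / ((s : ℂ) - z) + z) * ((1 + s ^ 2 : ℝ) : ℂ)⁻¹ := by
    have := one_add_sq_ne_zero s
    unfold cauchyKer
    push_cast
    field_simp
    ring
  rw [e, norm_mul, norm_inv, Complex.norm_real, Real.norm_of_nonneg (by positivity)]
  gcongr
  refine (norm_add_le _ _).trans (add_le_add ?_ hz)
  rw [norm_div]
  gcongr
  refine (norm_add_le _ _).trans ?_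
  rw [norm_one, norm_pow]
  gcongr

lemma hasDerivAt_cauchyKer {z : ℂ} {s : ℝ} (h : (s : ℂ) - z ≠ 0) :
    HasDerivAt (fun z => cauchyKer z s) (1 / ((s : ℂ) - z) ^ 2) z := by
  have := ((hasDerivAt_id z).const_sub (s : ℂ)).inv h
  simpa [cauchyKer, one_div] using this.sub_const ((s : ℂ) / (1 + (s : ℂ) ^ 2))

lemma integrable_cauchyKer {lam : Measure ℝ} (hlam : MemMPlus 2 lam) {z : ℂ} {δ : ℝ} (hδ : 0 < δ)
    (hz : ∀ᵐ s : ℝ ∂lam, δ ≤ ‖(s : ℂ) - z‖) : Integrable (cauchyKer z) lam := by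
  refine ((memMPlus_two_iff.1 hlam).const_mul ((1 + ‖z‖ ^ 2) / δ + ‖z‖)).mono'
    (measurable_cauchyKer z).aestronglyMeasurable ?_
  filter_upwards [hz] with s hs using norm_cauchyKer_le hδ hs le_rfl

/-- Only a positive distance from z to almost every s is needed, so this serves both the upper
half-plane and the points to the left of the support. -/
lemma differentiableAt_pick {lam : Measure ℝ} (hlam : MemMPlus 2 lam) (c₀ c₁ : ℝ) {z : ℂ} {δ : ℝ}
    (hδ : 0 < δ) (hz : ∀ᵐ s : ℝ ∂lam, δ ≤ ‖(s : ℂ) - z‖) :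
    DifferentiableAt ℂ (pick lam c₀ c₁) z := by
  refine DifferentiableAt.add (by fun_prop) ?_
  have key : ∀ᵐ s : ℝ ∂lam, ∀ w ∈ Metric.ball z (δ / 2), δ / 2 ≤ ‖(s : ℂ) - w‖ := by
    filter_upwards [hz] with s hs w hw
    have h1 : ‖w - z‖ < δ / 2 := by simpa [dist_eq_norm] using hw
    have h2 : ‖(s : ℂ) - z‖ ≤ ‖(s : ℂ) - w‖ + ‖w - z‖ := by
      simpa using norm_add_le ((s : ℂ) - w) (w - z)
    linarith
  have hnorm : ∀ w ∈ Metric.ball z (δ / 2), ‖w‖ ≤ ‖z‖ + δ := fun w hw => by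
    have h1 : ‖w - z‖ < δ / 2 := by simpa [dist_eq_norm] using hw
    have h2 : ‖w‖ ≤ ‖w - z‖ + ‖z‖ := by simpa using norm_add_le (w - z) z
    linarith
  set C := (1 + 2 * (‖z‖ + δ) ^ 2) / (δ / 2) ^ 2 + 2
  refine (hasDerivAt_integral_of_dominated_loc_of_deriv_le (F := fun w s => cauchyKer w s)
    (F' := fun w s => 1 / ((s : ℂ) - w) ^ 2) (bound := fun s => C * (1 + s ^ 2)⁻¹)
    (Metric.ball_mem_nhds z (half_pos hδ)) ?_ (integrable_cauchyKer hlam hδ hz) ?_ ?_ ?_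
    ?_).2.differentiableAt
  · exact Eventually.of_forall fun w => (measurable_cauchyKer w).aestronglyMeasurable
  · exact (by fun_prop : Measurable fun s : ℝ => 1 / ((s : ℂ) - z) ^ 2).aestronglyMeasurable
  · filter_upwards [key] with s hs w hw
    have h0 : 0 < ‖(s : ℂ) - w‖ := (half_pos hδ).trans_le (hs w hw)
    have := one_add_sq_le_normSq (half_pos hδ) (hs w hw) (hnorm w hw)
    rw [norm_div, norm_one, norm_pow, ← div_eq_mul_inv, div_le_div_iff₀ (by positivity)
      (by positivity), one_mul]
    exact this
  · exact (memMPlus_two_iff.1 hlam).const_mul C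
  · filter_upwards [key] with s hs w hw
    exact hasDerivAt_cauchyKer (norm_pos_iff.1 ((half_pos hδ).trans_le (hs w hw)))

lemma im_le_norm_ofReal_sub (z : ℂ) (s : ℝ) : z.im ≤ ‖(s : ℂ) - z‖ := by
  have := Complex.abs_im_le_norm ((s : ℂ) - z)
  simp only [Complex.sub_im, Complex.ofReal_im, zero_sub, abs_neg] at this
  exact (le_abs_self _).trans this

lemma sub_re_le_norm_ofReal_sub (z : ℂ) (s : ℝ) : s - z.re ≤ ‖(s : ℂ) - z‖ := by
  have := Complex.abs_re_le_norm ((s : ℂ) - z)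
  simp only [Complex.sub_re, Complex.ofReal_re] at this
  exact (le_abs_self _).trans this

lemma differentiableOn_pick {lam : Measure ℝ} (hlam : MemMPlus 2 lam) (c₀ c₁ : ℝ) :
    DifferentiableOn ℂ (pick lam c₀ c₁) {z | 0 < z.im} := fun _ hz =>
  (differentiableAt_pick hlam c₀ c₁ hz
    (Eventually.of_forall fun s => im_le_norm_ofReal_sub _ s)).differentiableWithinAt

lemma ae_sub_re_le {lam : Measure ℝ} {a : ℝ} (ha : ∀ᵐ s ∂lam, a ≤ s) (z : ℂ) :
    ∀ᵐ s : ℝ ∂lam, a - z.re ≤ ‖(s : ℂ) - z‖ := by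
  filter_upwards [ha] with s hs
  linarith [sub_re_le_norm_ofReal_sub z s]

lemma continuousAt_pick {lam : Measure ℝ} (hlam : MemMPlus 2 lam) (c₀ c₁ : ℝ) {a : ℝ}
    (ha : ∀ᵐ s ∂lam, a ≤ s) {z : ℂ} (hz : z.re < a) : ContinuousAt (pick lam c₀ c₁) z :=
  (differentiableAt_pick hlam c₀ c₁ (sub_pos.2 hz) (ae_sub_re_le ha z)).continuousAt

lemma cauchyKer_im (z : ℂ) (s : ℝ) : (cauchyKer z s).im = z.im / ((s - z.re) ^ 2 + z.im ^ 2) := by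
  have h2 : ((s : ℂ) / (1 + (s : ℂ) ^ 2)).im = 0 := by
    have : (s : ℂ) / (1 + (s : ℂ) ^ 2) = ((s / (1 + s ^ 2) : ℝ) : ℂ) := by push_cast; rfl
    rw [this, Complex.ofReal_im]
  rw [cauchyKer, Complex.sub_im, h2, one_div, Complex.inv_im, Complex.normSq_apply]
  simp [sq]

lemma pick_im {lam : Measure ℝ} (hlam : MemMPlus 2 lam) (c₀ c₁ : ℝ) {z : ℂ} (hz : 0 < z.im) :
    (pick lam c₀ c₁ z).im
      = c₁ * z.im + ∫ s, z.im / ((s - z.re) ^ 2 + z.im ^ 2) ∂lam := by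
  have hi := integrable_cauchyKer hlam hz (Eventually.of_forall fun s => im_le_norm_ofReal_sub z s)
  have := Complex.imCLM.integral_comp_comm hi
  simp only [Complex.imCLM_apply, cauchyKer_im] at this
  rw [pick, Complex.add_im, ← this]
  simp

lemma integrable_poisson {lam : Measure ℝ} (hlam : MemMPlus 2 lam) {z : ℂ} (hz : 0 < z.im) :
    Integrable (fun s => z.im / ((s - z.re) ^ 2 + z.im ^ 2)) lam := by
  have hi := integrable_cauchyKer hlam hz (Eventually.of_forall fun s => im_le_norm_ofReal_sub z s)
  simpa only [Complex.imCLM_apply, cauchyKer_im] using Complex.imCLM.integrable_comp hi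

lemma mul_im_le_pick_im {lam : Measure ℝ} (hlam : MemMPlus 2 lam) (c₀ c₁ : ℝ)
    {z : ℂ} (hz : 0 < z.im) : c₁ * z.im ≤ (pick lam c₀ c₁ z).im := by
  rw [pick_im hlam c₀ c₁ hz]
  have : 0 ≤ ∫ s, z.im / ((s - z.re) ^ 2 + z.im ^ 2) ∂lam :=
    integral_nonneg fun s => by positivity
  linarith

/-- The imaginary part is a sum of two non-negative terms. If it vanishes, then c₁ = 0, and strict
positivity of the Poisson kernel forces `lam = 0`; what remains is the constant c₀. -/
lemma pick_ne_zero {lam : Measure ℝ} (hlam : MemMPlus 2 lam) {c₀ c₁ : ℝ} (hc₁ : 0 ≤ c₁)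
    (hne : ¬ (lam = 0 ∧ c₀ = 0 ∧ c₁ = 0)) {z : ℂ} (hz : 0 < z.im) : pick lam c₀ c₁ z ≠ 0 := by
  intro h0
  have him := pick_im hlam c₀ c₁ hz
  rw [h0, Complex.zero_im] at him
  have h1 : 0 ≤ ∫ s, z.im / ((s - z.re) ^ 2 + z.im ^ 2) ∂lam :=
    integral_nonneg fun s => by positivity
  have h2 : 0 ≤ c₁ * z.im := by positivity
  have h3 : c₁ = 0 := by
    have : c₁ * z.im = 0 := by linarith
    exact (mul_eq_zero.1 this).resolve_right hz.ne'
  have h4 : ∫ s, z.im / ((s - z.re) ^ 2 + z.im ^ 2) ∂lam = 0 := by linarith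
  rw [integral_eq_zero_iff_of_nonneg (fun s => by positivity) (integrable_poisson hlam hz)] at h4
  have h5 : lam = 0 := by
    rw [← ae_eq_bot, ← eventually_false_iff_eq_bot]
    filter_upwards [h4] with s hs
    have : 0 < z.im / ((s - z.re) ^ 2 + z.im ^ 2) := by positivity
    exact this.ne' hs
  subst h5
  simp only [pick, h3, integral_zero_measure] at h0
  simp only [Complex.ofReal_zero, zero_mul, add_zero, Complex.ofReal_eq_zero] at h0
  exact hne ⟨rfl, h0, h3⟩

lemma qreg_sub_eq_pick (lam : Measure ℝ) (c₀ c₁ : ℝ) (z : ℂ) :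
    Qreg lam z - (Complex.I / Real.pi) * (c₀ + c₁ * z)
      = -(Complex.I / Real.pi) * pick lam c₀ c₁ z := by
  have : Qreg lam z = -(Complex.I / Real.pi) * ∫ s, cauchyKer z s ∂lam := by
    rw [Qreg, ← integral_const_mul]
    congr 1 with s
    rw [cauchyKer, ← neg_sub z (s : ℂ), one_div_neg_eq_neg_one_div]
    ring
  rw [this, pick]
  ring

/-- Each factor carries -(I / π), whose square is -1/π²; this turns the product 1 into -π². -/
lemma isBreg_iff {lam mu : Measure ℝ} {c₀ c₁ ζ₀ ζ₁ : ℝ} :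
    IsBreg lam c₀ c₁ mu ζ₀ ζ₁ ↔ MemMPlus 2 mu ∧ 0 ≤ ζ₁ ∧
      ∀ z : ℂ, 0 < z.im → pick lam c₀ c₁ z * pick mu ζ₀ ζ₁ z = -(Real.pi : ℂ) ^ 2 := by
  unfold IsBreg
  refine and_congr_right fun _ => and_congr_right fun _ => forall_congr' fun z =>
    imp_congr_right fun _ => ?_
  have hpi : (Real.pi : ℂ) ≠ 0 := by exact_mod_cast Real.pi_ne_zero
  rw [qreg_sub_eq_pick, qreg_sub_eq_pick]
  have e : -(Complex.I / Real.pi) * pick lam c₀ c₁ z * (-(Complex.I / Real.pi) * pick mu ζ₀ ζ₁ z)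
      = -(pick lam c₀ c₁ z * pick mu ζ₀ ζ₁ z) / (Real.pi : ℂ) ^ 2 := by
    linear_combination (pick lam c₀ c₁ z * pick mu ζ₀ ζ₁ z) / (Real.pi : ℂ) ^ 2 * Complex.I_sq
  rw [e, div_eq_iff (pow_ne_zero 2 hpi), one_mul, neg_eq_iff_eq_neg]

end PickFunctions

section Herglotz

open Filter Topology

/-! ### The Herglotz representation -/

/-- The Cayley transform from the unit disk to the upper half-plane. -/
noncomputable def diskToHalf (w : ℂ) : ℂ := Complex.I * (1 + w) / (1 - w)

/-- The Cayley transform from the upper half-plane to the unit disk. -/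
noncomputable def halfToDisk (z : ℂ) : ℂ := (z - Complex.I) / (z + Complex.I)

lemma one_sub_ne_zero_of_norm_lt_one {w : ℂ} (hw : ‖w‖ < 1) : 1 - w ≠ 0 := by
  intro h
  rw [sub_eq_zero] at h
  rw [← h, norm_one] at hw
  exact lt_irrefl _ hw

lemma add_I_ne_zero {z : ℂ} (hz : 0 < z.im) : z + Complex.I ≠ 0 := by
  intro h
  have := congrArg Complex.im h
  simp at this
  linarith

lemma diskToHalf_im_pos {w : ℂ} (hw : ‖w‖ < 1) : 0 < (diskToHalf w).im := by
  have h1 := one_sub_ne_zero_of_norm_lt_one hw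
  have h2 : 0 < Complex.normSq (1 - w) := Complex.normSq_pos.2 h1
  have h3 : w.re ^ 2 + w.im ^ 2 < 1 := by
    have : Complex.normSq w < 1 := by
      rw [Complex.normSq_eq_norm_sq]; nlinarith [norm_nonneg w]
    rw [Complex.normSq_apply] at this; nlinarith
  have : (diskToHalf w).im = (1 - (w.re ^ 2 + w.im ^ 2)) / Complex.normSq (1 - w) := by
    rw [diskToHalf, Complex.div_im]
    simp
    field_simp
    ring
  rw [this]
  apply div_pos (by linarith) h2

lemma one_sub_norm_halfToDisk_sq {z : ℂ} (hz : 0 < z.im) :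
    1 - ‖halfToDisk z‖ ^ 2 = 4 * z.im / ‖z + Complex.I‖ ^ 2 := by
  have h := norm_pos_iff.2 (add_I_ne_zero hz)
  rw [halfToDisk, norm_div, div_pow, eq_div_iff (by positivity), sub_mul, one_mul,
    div_mul_cancel₀ _ (by positivity), ← Complex.normSq_eq_norm_sq, ← Complex.normSq_eq_norm_sq,
    Complex.normSq_apply, Complex.normSq_apply]
  simp
  ring

lemma norm_halfToDisk_lt_one {z : ℂ} (hz : 0 < z.im) : ‖halfToDisk z‖ < 1 := by
  have h := norm_pos_iff.2 (add_I_ne_zero hz)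
  have h1 := one_sub_norm_halfToDisk_sq hz
  have : 0 < 4 * z.im / ‖z + Complex.I‖ ^ 2 := by positivity
  nlinarith [norm_nonneg (halfToDisk z)]

lemma diskToHalf_halfToDisk {z : ℂ} (hz : 0 < z.im) : diskToHalf (halfToDisk z) = z := by
  have h := add_I_ne_zero hz
  have h1 := one_sub_ne_zero_of_norm_lt_one (norm_halfToDisk_lt_one hz)
  rw [diskToHalf, div_eq_iff h1, halfToDisk]
  field_simp
  ring

/-- The Poisson kernel of the disk in half-plane coordinates. -/
noncomputable def poissonTrig (z : ℂ) (θ : ℝ) : ℝ :=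
  z.im / ((Real.cos (θ / 2) + z.re * Real.sin (θ / 2)) ^ 2 + (z.im * Real.sin (θ / 2)) ^ 2)

/-- The boundary point of the half-plane is -cot(θ/2). Keeping cosine and sine of θ/2 separate makes
the formula regular at the point at infinity, sin(θ/2) = 0, where mass will produce the linear term.
-/
lemma poissonKernel_halfToDisk {z : ℂ} (hz : 0 < z.im) (θ : ℝ) :
    poissonKernel 0 (halfToDisk z) (circleMap 0 1 θ) = poissonTrig z θ := by
  have h := norm_pos_iff.2 (add_I_ne_zero hz)
  have e1 : circleMap 0 1 θ - halfToDisk z =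
      2 * Complex.I * Complex.exp ((θ / 2 : ℝ) * Complex.I)
        * (Real.cos (θ / 2) + z * Real.sin (θ / 2)) / (z + Complex.I) := by
    rw [eq_div_iff (add_I_ne_zero hz), halfToDisk, sub_mul,
      div_mul_cancel₀ _ (add_I_ne_zero hz)]
    have e2 : circleMap 0 1 θ = Complex.exp ((θ / 2 : ℝ) * Complex.I) ^ 2 := by
      rw [← Complex.exp_nat_mul, circleMap]
      simp only [Complex.ofReal_one, one_mul, zero_add]
      congr 1
      push_cast
      ring
    rw [e2, Complex.exp_mul_I]
    push_cast
    have := Complex.sin_sq_add_cos_sq ((θ : ℂ) / 2)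
    set S := Complex.sin ((θ : ℂ) / 2)
    set C := Complex.cos ((θ : ℂ) / 2)
    linear_combination (z - Complex.I) * this + (z * S ^ 2 + Complex.I * S ^ 2) * Complex.I_sq
      - 2 * S ^ 2 * z * Complex.I_sq
  have e3 : ‖circleMap 0 1 θ - halfToDisk z‖ ^ 2 =
      4 * ((Real.cos (θ / 2) + z.re * Real.sin (θ / 2)) ^ 2 + (z.im * Real.sin (θ / 2)) ^ 2)
        / ‖z + Complex.I‖ ^ 2 := by
    rw [e1, norm_div, norm_mul, norm_mul, norm_mul, Complex.norm_exp_ofReal_mul_I, div_pow, mul_pow,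
      ← Complex.normSq_eq_norm_sq (_ + z * _), Complex.normSq_apply]
    simp only [Complex.norm_ofNat, Complex.norm_I, mul_one, Complex.add_re, Complex.mul_re,
      Complex.ofReal_re, Complex.ofReal_im, mul_zero, sub_zero, Complex.add_im, Complex.mul_im,
      zero_add]
    ring
  rw [poissonKernel_def, sub_zero, sub_zero, e3, norm_circleMap_zero, abs_one, one_pow,
    one_sub_norm_halfToDisk_sq hz, poissonTrig]
  rw [div_div_div_cancel_right₀ (by positivity), mul_div_mul_left _ _ (by norm_num)]

lemma poissonTrig_bounds {z : ℂ} (hz : 0 < z.im) (θ : ℝ) :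
    |poissonTrig z θ| ≤ (1 - ‖halfToDisk z‖ ^ 2) / (1 - ‖halfToDisk z‖) ^ 2 := by
  have h1 := norm_halfToDisk_lt_one hz
  have h2 : 0 ≤ 1 - ‖halfToDisk z‖ ^ 2 := by nlinarith [norm_nonneg (halfToDisk z)]
  have h3 : 1 - ‖halfToDisk z‖ ≤ ‖circleMap 0 1 θ - halfToDisk z‖ := by
    have := norm_sub_norm_le (circleMap 0 1 θ) (halfToDisk z)
    simpa using this
  rw [← poissonKernel_halfToDisk hz, poissonKernel_def]
  simp only [sub_zero, norm_circleMap_zero, abs_one, one_pow]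
  rw [abs_of_nonneg (by positivity)]
  have : 0 < 1 - ‖halfToDisk z‖ := by linarith
  gcongr

lemma poissonTrig_den_pos {z : ℂ} (hz : 0 < z.im) (θ : ℝ) :
    0 < (Real.cos (θ / 2) + z.re * Real.sin (θ / 2)) ^ 2 + (z.im * Real.sin (θ / 2)) ^ 2 := by
  rcases eq_or_ne (Real.sin (θ / 2)) 0 with h | h
  · have := Real.sin_sq_add_cos_sq (θ / 2)
    rw [h] at this ⊢
    nlinarith
  · positivity

lemma continuous_poissonTrig {z : ℂ} (hz : 0 < z.im) : Continuous (poissonTrig z) := by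
  unfold poissonTrig
  exact Continuous.div (by fun_prop) (by fun_prop) fun θ => (poissonTrig_den_pos hz θ).ne'

/-- The Poisson kernel as a bounded continuous function of the angle. -/
noncomputable def poissonBCF {z : ℂ} (hz : 0 < z.im) : BoundedContinuousFunction ℝ ℝ :=
  BoundedContinuousFunction.ofNormedAddCommGroup (poissonTrig z) (continuous_poissonTrig hz) _
    (poissonTrig_bounds hz)

lemma differentiableOn_comp_diskToHalf {F : ℂ → ℂ} (hF : DifferentiableOn ℂ F {z | 0 < z.im}) :
    DifferentiableOn ℂ (fun w => F (diskToHalf w)) (Metric.ball 0 1) := by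
  refine hF.comp (t := {z | 0 < z.im}) ?_ fun w hw => diskToHalf_im_pos (by simpa using hw)
  unfold diskToHalf
  refine DifferentiableOn.div (by fun_prop) (by fun_prop) fun w hw => ?_
  exact one_sub_ne_zero_of_norm_lt_one (by simpa using hw)

/-- Poisson's formula on a smaller circle, in half-plane coordinates. -/
lemma im_eq_integral_poissonTrig {F : ℂ → ℂ} (hF : DifferentiableOn ℂ F {z | 0 < z.im}) {r : ℝ}
    (hr0 : 0 < r) (hr : r < 1) {z : ℂ} (hz : 0 < z.im) :
    (F (diskToHalf (r * halfToDisk z))).im = ∫ θ in Ioc 0 (2 * Real.pi),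
      poissonTrig z θ * ((2 * Real.pi)⁻¹ * (F (diskToHalf (r * circleMap 0 1 θ))).im) := by
  set g : ℂ → ℂ := fun w => F (diskToHalf (r * w))
  have hg : DifferentiableOn ℂ g (Metric.closedBall 0 1) := by
    refine (differentiableOn_comp_diskToHalf hF).comp (f := fun w : ℂ => (r : ℂ) * w)
      (t := Metric.ball 0 1) (by fun_prop) ?_
    intro w hw
    have : ‖w‖ ≤ 1 := by simpa using hw
    simp only [Metric.mem_ball, dist_zero_right, norm_mul, Complex.norm_real, Real.norm_eq_abs,
      abs_of_pos hr0]
    nlinarith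
  have hd : DiffContOnCl ℂ g (Metric.ball 0 1) :=
    DifferentiableOn.diffContOnCl (by rwa [closure_ball _ one_ne_zero])
  have hw : halfToDisk z ∈ Metric.ball (0 : ℂ) 1 := by simpa using norm_halfToDisk_lt_one hz
  have hP := hd.circleAverage_poissonKernel_smul hw
  have hcont : Continuous fun θ : ℝ => g (circleMap 0 1 θ) :=
    hg.continuousOn.comp_continuous (continuous_circleMap 0 1) fun θ => by
      simp
  rw [Real.circleAverage_def] at hP
  simp only [Pi.smul_apply', poissonKernel_halfToDisk hz] at hP
  rw [intervalIntegral.integral_of_le Real.two_pi_pos.le] at hP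
  have hint : IntegrableOn (fun θ => poissonTrig z θ • g (circleMap 0 1 θ))
      (Ioc 0 (2 * Real.pi)) :=
    (((continuous_poissonTrig hz).smul hcont).integrableOn_Icc).mono_set Ioc_subset_Icc_self
  have h2 := Complex.imCLM.integral_comp_comm hint
  change (g (halfToDisk z)).im = _
  rw [← hP]
  simp only [Complex.real_smul, Complex.mul_im, Complex.ofReal_re, Complex.ofReal_im, zero_mul,
    add_zero, Complex.imCLM_apply] at h2 ⊢
  rw [← h2, ← integral_const_mul]
  congr 1 with θ
  ring

/-- The measures on small circles whose limit is the Herglotz measure. -/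
noncomputable def circleDensity (F : ℂ → ℂ) (r : ℝ) : Measure ℝ :=
  (volume.restrict (Ioc 0 (2 * Real.pi))).withDensity fun θ =>
    ENNReal.ofReal ((2 * Real.pi)⁻¹ * (F (diskToHalf (r * circleMap 0 1 θ))).im)

lemma continuous_circleDensity {F : ℂ → ℂ} (hF : DifferentiableOn ℂ F {z | 0 < z.im}) {r : ℝ}
    (hr0 : 0 < r) (hr : r < 1) :
    Continuous fun θ : ℝ => (2 * Real.pi)⁻¹ * (F (diskToHalf (r * circleMap 0 1 θ))).im := by
  have h : Continuous fun θ : ℝ => F (diskToHalf (r * circleMap 0 1 θ)) :=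
    (differentiableOn_comp_diskToHalf hF).continuousOn.comp_continuous
      (f := fun θ : ℝ => (r : ℂ) * circleMap 0 1 θ) (by fun_prop) fun θ => by
        simp [abs_of_pos hr0, hr]
  exact continuous_const.mul (Complex.continuous_im.comp h)

lemma integral_circleDensity {F : ℂ → ℂ} (hF : DifferentiableOn ℂ F {z | 0 < z.im})
    (h0 : ∀ z : ℂ, 0 < z.im → 0 ≤ (F z).im) {r : ℝ} (hr0 : 0 < r) (hr : r < 1) (f : ℝ → ℝ) :
    ∫ θ, f θ ∂(circleDensity F r) = ∫ θ in Ioc 0 (2 * Real.pi),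
      f θ * ((2 * Real.pi)⁻¹ * (F (diskToHalf (r * circleMap 0 1 θ))).im) := by
  have hnn : ∀ θ : ℝ, 0 ≤ (2 * Real.pi)⁻¹ * (F (diskToHalf (r * circleMap 0 1 θ))).im :=
    fun θ => mul_nonneg (by positivity) (h0 _ (diskToHalf_im_pos (by simp [abs_of_pos hr0, hr])))
  rw [circleDensity, integral_withDensity_eq_integral_toReal_smul]
  · simp only [ENNReal.toReal_ofReal (hnn _), smul_eq_mul]
    simp only [mul_comm]
  · exact (continuous_circleDensity hF hr0 hr).measurable.ennreal_ofReal
  · exact Eventually.of_forall fun _ => ENNReal.ofReal_lt_top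

lemma isFiniteMeasure_circleDensity {F : ℂ → ℂ} (hF : DifferentiableOn ℂ F {z | 0 < z.im})
    {r : ℝ} (hr0 : 0 < r) (hr : r < 1) : IsFiniteMeasure (circleDensity F r) := by
  refine isFiniteMeasure_withDensity_ofReal ?_
  exact ((continuous_circleDensity hF hr0 hr).integrableOn_Icc.mono_set
    Ioc_subset_Icc_self).hasFiniteIntegral

/-- At z = i, the centre of the disk, the Poisson kernel is 1. The mass is thus independent of r,
which gives compactness as r → 1. -/
lemma circleDensity_real_univ {F : ℂ → ℂ} (hF : DifferentiableOn ℂ F {z | 0 < z.im})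
    (h0 : ∀ z : ℂ, 0 < z.im → 0 ≤ (F z).im) {r : ℝ} (hr0 : 0 < r) (hr : r < 1) :
    (circleDensity F r).real univ = (F Complex.I).im := by
  have hI : 0 < Complex.I.im := by simp
  have h1 := im_eq_integral_poissonTrig hF hr0 hr hI
  rw [← integral_circleDensity hF h0 hr0 hr] at h1
  have h2 : ∀ θ, poissonTrig Complex.I θ = 1 := fun θ => by simp [poissonTrig]
  have h3 : diskToHalf (r * halfToDisk Complex.I) = Complex.I := by simp [halfToDisk, diskToHalf]
  simp only [h2, h3, integral_const, smul_eq_mul, mul_one] at h1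
  exact h1.symm

/-- **Herglotz representation**, on the circle. -/
lemma exists_measure_im_eq_integral_poissonTrig {F : ℂ → ℂ}
    (hF : DifferentiableOn ℂ F {z | 0 < z.im}) (h0 : ∀ z : ℂ, 0 < z.im → 0 ≤ (F z).im) :
    ∃ nu : Measure ℝ, IsFiniteMeasure nu ∧
      ∀ z : ℂ, 0 < z.im → (F z).im = ∫ θ, poissonTrig z θ ∂nu := by
  -- The shift by 2 keeps the radius positive already at n = 0.
  set r : ℕ → ℝ := fun n => 1 - 1 / ((n : ℝ) + 2)
  have hr0 : ∀ n, 0 < r n := fun n => by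
    have : (1 : ℝ) / ((n : ℝ) + 2) < 1 := by
      rw [div_lt_one (by positivity)]; linarith [(Nat.cast_nonneg n : (0 : ℝ) ≤ n)]
    simp only [r]; linarith
  have hr1 : ∀ n, r n < 1 := fun n => by
    have : (0 : ℝ) < 1 / ((n : ℝ) + 2) := by positivity
    simp only [r]; linarith
  have hrt : Tendsto r atTop (𝓝 1) := by
    have : Tendsto (fun n : ℕ => 1 / ((n : ℝ) + 2)) atTop (𝓝 0) := by
      refine Tendsto.div_atTop tendsto_const_nhds ?_
      exact tendsto_atTop_add_const_right _ _ tendsto_natCast_atTop_atTop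
    simpa [r] using this.const_sub 1
  let nu : ℕ → FiniteMeasure ℝ := fun n =>
    ⟨circleDensity F (r n), isFiniteMeasure_circleDensity hF (hr0 n) (hr1 n)⟩
  -- The circle measures lie in a compact set of finite measures (fixed mass, carried by [0, 2π]); a
  -- limit along an ultrafilter replaces the choice of a subsequence.
  let U : Ultrafilter ℕ := Filter.hyperfilter ℕ
  have hU : (U : Filter ℕ) ≤ atTop := by
    rw [← Nat.cofinite_eq_atTop]; exact Filter.hyperfilter_le_cofinite
  have hK := isCompact_setOfPred_finiteMeasure_le_of_isCompact (E := ℝ) (F Complex.I).im.toNNReal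
    (K := Icc 0 (2 * Real.pi)) isCompact_Icc
  rw [isCompact_iff_ultrafilter_le_nhds'] at hK
  obtain ⟨m, -, hm⟩ := hK (U.map nu) (by
    refine Filter.mem_map.2 (Filter.univ_mem' fun n => ⟨?_, ?_⟩)
    · have h1 := circleDensity_real_univ hF h0 (hr0 n) (hr1 n)
      rw [← NNReal.coe_le_coe, Real.coe_toNNReal _ (h0 _ (by simp)), ← h1]
      rfl
    · have h1 : circleDensity F (r n) (Icc 0 (2 * Real.pi))ᶜ = 0 := by
        refine withDensity_absolutelyContinuous _ _ ?_
        rw [Measure.restrict_apply measurableSet_Icc.compl]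
        convert measure_empty (μ := volume)
        ext θ
        simp only [mem_inter_iff, mem_compl_iff, mem_Icc, mem_Ioc, mem_empty_iff_false]
        grind
      rw [← ENNReal.coe_inj, FiniteMeasure.ennreal_coeFn_eq_coeFn_toMeasure]
      exact h1)
  have hm' : Tendsto nu U (𝓝 m) := hm
  rw [FiniteMeasure.tendsto_iff_forall_integral_tendsto] at hm'
  refine ⟨m, inferInstance, fun z hz => ?_⟩
  have h1 := hm' (poissonBCF hz)
  have h2 : ∀ n, ∫ θ, poissonBCF hz θ ∂(nu n : Measure ℝ)
      = (F (diskToHalf (r n * halfToDisk z))).im := fun n => by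
    rw [im_eq_integral_poissonTrig hF (hr0 n) (hr1 n) hz]
    exact integral_circleDensity hF h0 (hr0 n) (hr1 n) _
  simp only [h2] at h1
  have hw : halfToDisk z ∈ Metric.ball (0 : ℂ) 1 := by simpa using norm_halfToDisk_lt_one hz
  have h3 : ContinuousAt (fun w => F (diskToHalf w)) (halfToDisk z) :=
    (differentiableOn_comp_diskToHalf hF).continuousOn.continuousAt (Metric.isOpen_ball.mem_nhds hw)
  have h4 : Tendsto (fun n => (r n : ℂ) * halfToDisk z) atTop (𝓝 (halfToDisk z)) := by
    have : Tendsto (fun n => ((r n : ℝ) : ℂ)) atTop (𝓝 ((1 : ℝ) : ℂ)) :=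
      (Complex.continuous_ofReal.tendsto 1).comp hrt
    simpa using this.mul_const (halfToDisk z)
  have h5 : Tendsto (fun n => (F (diskToHalf (r n * halfToDisk z))).im) atTop
      (𝓝 (F z).im) := by
    have := (Complex.continuous_im.tendsto _).comp (h3.tendsto.comp h4)
    simp only [diskToHalf_halfToDisk hz] at this
    exact this
  exact tendsto_nhds_unique (h5.mono_left hU) h1

lemma poissonTrig_eq_of_sin_ne_zero {z : ℂ} {θ : ℝ} (h : Real.sin (θ / 2) ≠ 0) :
    poissonTrig z θ = (1 + (-(Real.cos (θ / 2) / Real.sin (θ / 2))) ^ 2) *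
      (z.im / ((-(Real.cos (θ / 2) / Real.sin (θ / 2)) - z.re) ^ 2 + z.im ^ 2)) := by
  have e1 : 1 + (-(Real.cos (θ / 2) / Real.sin (θ / 2))) ^ 2 = 1 / Real.sin (θ / 2) ^ 2 := by
    have := Real.sin_sq_add_cos_sq (θ / 2)
    field_simp
    linarith
  have e2 : (-(Real.cos (θ / 2) / Real.sin (θ / 2)) - z.re) ^ 2 + z.im ^ 2
      = ((Real.cos (θ / 2) + z.re * Real.sin (θ / 2)) ^ 2 + (z.im * Real.sin (θ / 2)) ^ 2)
        / Real.sin (θ / 2) ^ 2 := by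
    field_simp
    ring
  rw [e1, e2, poissonTrig]
  have : Real.sin (θ / 2) ^ 2 ≠ 0 := pow_ne_zero 2 h
  field_simp

lemma poissonTrig_eq_of_sin_eq_zero {z : ℂ} {θ : ℝ} (h : Real.sin (θ / 2) = 0) :
    poissonTrig z θ = z.im := by
  have := Real.sin_sq_add_cos_sq (θ / 2)
  rw [h] at this
  rw [poissonTrig, h]
  simp only [mul_zero, add_zero]
  have h2 : Real.cos (θ / 2) ^ 2 = 1 := by linarith
  rw [h2]; simp

/-- **Herglotz representation** of the imaginary part on the half-plane. -/
lemma exists_pick_im_eq {F : ℂ → ℂ} (hF : DifferentiableOn ℂ F {z | 0 < z.im})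
    (h0 : ∀ z : ℂ, 0 < z.im → 0 ≤ (F z).im) :
    ∃ (mu : Measure ℝ) (ζ₁ : ℝ), MemMPlus 2 mu ∧ 0 ≤ ζ₁ ∧
      ∀ z : ℂ, 0 < z.im → (F z).im = (pick mu 0 ζ₁ z).im := by
  obtain ⟨nu, hnu, hz⟩ := exists_measure_im_eq_integral_poissonTrig hF h0
  -- S sits over the point at infinity: there the kernel equals Im z, so the mass of S is the linear
  -- coefficient. Off S, pushing forward by -cot(θ/2) and weighting by 1 + s² turns the circle
  -- kernel into the Poisson kernel of the line.
  set S : Set ℝ := {θ | Real.sin (θ / 2) = 0}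
  have hS : MeasurableSet S := measurableSet_eq_fun (by fun_prop) measurable_const
  set φ : ℝ → ℝ := fun θ => -(Real.cos (θ / 2) / Real.sin (θ / 2))
  have hφ : Measurable φ := by fun_prop
  set mu : Measure ℝ := ((nu.restrict Sᶜ).map φ).withDensity fun s => ENNReal.ofReal (1 + s ^ 2)
  have hd : Measurable fun s : ℝ => ENNReal.ofReal (1 + s ^ 2) := by fun_prop
  have hnn : ∀ s : ℝ, 0 ≤ 1 + s ^ 2 := fun s => by positivity
  have hint : ∀ f : ℝ → ℝ, Measurable f →
      ∫ s, f s ∂mu = ∫ θ in Sᶜ, (1 + φ θ ^ 2) * f (φ θ) ∂nu := fun f hf => by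
    rw [integral_withDensity_eq_integral_toReal_smul hd
      (Eventually.of_forall fun _ => ENNReal.ofReal_lt_top), integral_map hφ.aemeasurable]
    · simp only [ENNReal.toReal_ofReal (hnn _), smul_eq_mul]
    · exact (by fun_prop : Measurable fun s =>
        (ENNReal.ofReal (1 + s ^ 2)).toReal • f s).aestronglyMeasurable
  have hmu : MemMPlus 2 mu := by
    rw [memMPlus_two_iff, integrable_withDensity_iff_integrable_smul' hd
      (Eventually.of_forall fun _ => ENNReal.ofReal_lt_top)]
    have : (fun s : ℝ => (ENNReal.ofReal (1 + s ^ 2)).toReal • (1 + s ^ 2)⁻¹) = fun _ => 1 := by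
      ext s
      rw [ENNReal.toReal_ofReal (hnn _), smul_eq_mul, mul_inv_cancel₀ (by positivity)]
    rw [this]
    have : IsFiniteMeasure ((nu.restrict Sᶜ).map φ) := by infer_instance
    exact integrable_const 1
  refine ⟨mu, nu.real S, hmu, measureReal_nonneg, fun z hz' => ?_⟩
  have hi : Integrable (poissonTrig z) nu := (poissonBCF hz').integrable nu
  rw [hz z hz', pick_im hmu 0 _ hz', hint _ (by fun_prop), ← integral_add_compl hS hi]
  congr 1
  · rw [setIntegral_congr_fun hS fun θ hθ => poissonTrig_eq_of_sin_eq_zero hθ]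
    simp
  · exact setIntegral_congr_fun hS.compl fun θ hθ => poissonTrig_eq_of_sin_ne_zero hθ

lemma isOpen_upperHalf : IsOpen {z : ℂ | 0 < z.im} :=
  isOpen_lt continuous_const Complex.continuous_im

/-- **Nevanlinna representation** of a Pick function. -/
theorem exists_eq_pick {F : ℂ → ℂ} (hF : DifferentiableOn ℂ F {z | 0 < z.im})
    (h0 : ∀ z : ℂ, 0 < z.im → 0 ≤ (F z).im) :
    ∃ (mu : Measure ℝ) (ζ₀ ζ₁ : ℝ), MemMPlus 2 mu ∧ 0 ≤ ζ₁ ∧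
      ∀ z : ℂ, 0 < z.im → F z = pick mu ζ₀ ζ₁ z := by
  obtain ⟨mu, ζ₁, hmu, hζ₁, him⟩ := exists_pick_im_eq hF h0
  set G : ℂ → ℂ := fun z => F z - pick mu 0 ζ₁ z
  have hG : DifferentiableOn ℂ G {z | 0 < z.im} := hF.sub (differentiableOn_pick hmu 0 ζ₁)
  have hGim : ∀ z : ℂ, 0 < z.im → (G z).im = 0 := fun z hz => by
    simp [G, him z hz]
  have hconv : Convex ℝ {z : ℂ | 0 < z.im} := convex_halfSpace_im_gt 0
  have hderiv : ∀ z : ℂ, 0 < z.im → deriv G z = 0 := fun z hz => by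
    have hd : HasDerivAt G (deriv G z) z :=
      (hG.differentiableAt (isOpen_upperHalf.mem_nhds hz)).hasDerivAt
    -- G is real-valued, so each directional derivative is real; the directions 1 and i together
    -- force the complex derivative to vanish.
    have key : ∀ v : ℂ, (deriv G z * v).im = 0 := fun v => by
      have h1 : HasDerivAt (fun t : ℝ => z + t * v) v 0 := by
        have := ((Complex.ofRealCLM.hasDerivAt (x := 0)).mul_const v).const_add z
        simpa using this
      have hd' : HasDerivAt G (deriv G z) (z + ((0 : ℝ) : ℂ) * v) := by simpa using hd
      have h2 : HasDerivAt (fun t : ℝ => G (z + t * v)) (deriv G z * v) 0 := 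
        HasDerivAt.comp (h₂ := G) (0 : ℝ) hd' h1
      have h3 : HasDerivAt (fun t : ℝ => (G (z + t * v)).im) (deriv G z * v).im 0 :=
        Complex.imCLM.hasFDerivAt.comp_hasDerivAt (0 : ℝ) h2
      have h4 : (fun t : ℝ => (G (z + t * v)).im) =ᶠ[𝓝 0] fun _ => 0 := by
        have hc : ContinuousAt (fun t : ℝ => z + t * v) 0 := h1.continuousAt
        have : ∀ᶠ t : ℝ in 𝓝 0, z + t * v ∈ {z : ℂ | 0 < z.im} :=
          hc.eventually_mem (isOpen_upperHalf.mem_nhds (by simpa using hz))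
        filter_upwards [this] with t ht using hGim _ ht
      exact (h3.congr_of_eventuallyEq h4.symm).unique (hasDerivAt_const (0 : ℝ) (0 : ℝ))
    apply Complex.ext
    · simpa using key Complex.I
    · simpa using key 1
  have hI : (0 : ℝ) < Complex.I.im := by simp
  refine ⟨mu, (G Complex.I).re, ζ₁, hmu, hζ₁, fun z hz => ?_⟩
  have hc : G z = G Complex.I :=
    isOpen_upperHalf.is_const_of_deriv_eq_zero hconv.isPreconnected hG
      (fun w hw => hderiv w hw) hz hI
  have hr : ((G Complex.I).re : ℂ) = G Complex.I :=
    Complex.ext (by simp) (by simp [hGim _ hI])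
  have : F z = G z + pick mu 0 ζ₁ z := by simp [G]
  rw [this, hc]
  simp only [pick, Complex.ofReal_zero, hr]
  ring

end Herglotz

section Stieltjes

open Filter Topology

/-! ### Stieltjes inversion -/

lemma MemMPlus.isLocallyFiniteMeasure {lam : Measure ℝ} (h : MemMPlus 2 lam) :
    IsLocallyFiniteMeasure lam := by
  refine ⟨fun x => ⟨Ioo (x - 1) (x + 1), Ioo_mem_nhds (by linarith) (by linarith), ?_⟩⟩
  have h1 := (memMPlus_two_iff.1 h).measure_norm_ge_lt_top
    (ε := (1 + (|x| + 1) ^ 2)⁻¹) (by positivity)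
  refine (measure_mono fun s hs => ?_).trans_lt h1
  have : |s| ≤ |x| + 1 := by
    rw [abs_le]
    constructor <;> cases abs_cases x <;> linarith [hs.1, hs.2]
  have h2 : s ^ 2 ≤ (|x| + 1) ^ 2 := by rw [← sq_abs]; gcongr
  change _ ≤ ‖(1 + s ^ 2)⁻¹‖
  rw [Real.norm_of_nonneg (by positivity)]
  gcongr

/-- The Poisson integral of `f` at height `y`. -/
noncomputable def poissonInt (f : ℝ → ℝ) (y s : ℝ) : ℝ := ∫ x, f x * (y / ((s - x) ^ 2 + y ^ 2))

lemma poissonInt_eq {f : ℝ → ℝ} {y : ℝ} (hy : 0 < y) (s : ℝ) :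
    poissonInt f y s = ∫ u, f (s + y * u) * (1 + u ^ 2)⁻¹ := by
  have h1 := Measure.integral_comp_mul_left
    (fun u => f (s + u) * (y / (u ^ 2 + y ^ 2))) y
  have h2 : ∫ u, f (s + u) * (y / (u ^ 2 + y ^ 2)) = poissonInt f y s := by
    rw [poissonInt,
      ← integral_add_left_eq_self (fun x => f x * (y / ((s - x) ^ 2 + y ^ 2))) s]
    congr 1 with u
    rw [sub_add_cancel_left, neg_sq]
  rw [h2, abs_of_pos (by positivity), smul_eq_mul, inv_mul_eq_div, eq_div_iff hy.ne',
    ← integral_mul_const] at h1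
  rw [← h1]
  congr 1 with u
  field_simp
  ring

lemma tendsto_poissonInt {f : ℝ → ℝ} (hf : Continuous f) {C : ℝ} (hC : ∀ x, |f x| ≤ C) (s : ℝ) :
    Tendsto (fun y => poissonInt f y s) (𝓝[>] 0) (𝓝 (Real.pi * f s)) := by
  have h1 : Tendsto (fun y => ∫ u, f (s + y * u) * (1 + u ^ 2)⁻¹) (𝓝[>] 0)
      (𝓝 (∫ u, f (s + 0 * u) * (1 + u ^ 2)⁻¹)) := by
    refine tendsto_integral_filter_of_dominated_convergence (fun u => C * (1 + u ^ 2)⁻¹) ?_ ?_ ?_ ?_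
    · exact Eventually.of_forall fun y =>
        (by fun_prop : Measurable fun u : ℝ => f (s + y * u) * (1 + u ^ 2)⁻¹).aestronglyMeasurable
    · refine Eventually.of_forall fun y => Eventually.of_forall fun u => ?_
      rw [norm_mul, Real.norm_eq_abs, Real.norm_of_nonneg (by positivity)]
      gcongr
      exact hC _
    · exact integrable_inv_one_add_sq.const_mul C
    · refine Eventually.of_forall fun u => ?_
      have : Continuous fun y => f (s + y * u) * (1 + u ^ 2)⁻¹ := by fun_prop
      exact (this.tendsto 0).mono_left nhdsWithin_le_nhds
  have h2 : ∫ u, f (s + 0 * u) * (1 + u ^ 2)⁻¹ = Real.pi * f s := by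
    simp only [zero_mul, add_zero]
    rw [integral_const_mul, integral_univ_inv_one_add_sq, mul_comm]
  rw [h2] at h1
  refine h1.congr' ?_
  filter_upwards [self_mem_nhdsWithin] with y hy using (poissonInt_eq hy s).symm

/-- This is the dominating function for y → 0. For s near the support of f the Poisson integral is
at most π sup|f|; far from it |s - x| ≥ |s|/2 gives decay like s⁻². -/
lemma exists_poissonInt_le {f : ℝ → ℝ} (hf : Continuous f) (hfc : HasCompactSupport f) :
    ∃ C, ∀ y, 0 < y → y ≤ 1 → ∀ s, |poissonInt f y s| ≤ C * (1 + s ^ 2)⁻¹ := by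
  obtain ⟨B, hB⟩ := hfc.exists_bound_of_continuous hf
  have hB0 : 0 ≤ B := (norm_nonneg _).trans (hB 0)
  obtain ⟨R, hR⟩ := hfc.isCompact.isBounded.subset_closedBall 0
  have hfi : Integrable f := hf.integrable_of_hasCompactSupport hfc
  set R' := max R 1
  have hsupp : ∀ x, R' < |x| → f x = 0 := fun x hx => by
    by_contra h
    have := hR (subset_tsupport f h)
    simp only [Metric.mem_closedBall, dist_zero_right, Real.norm_eq_abs] at this
    exact absurd (this.trans (le_max_left _ _)) (not_le.2 hx)
  have hR' : 1 ≤ R' := le_max_right _ _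
  set I := ∫ x, |f x|
  have hI : 0 ≤ I := integral_nonneg fun x => abs_nonneg _
  refine ⟨B * Real.pi * (1 + 4 * R' ^ 2) + 8 * I, fun y hy hy1 s => ?_⟩
  rcases le_or_gt |s| (2 * R') with hs | hs
  · have h1 : |poissonInt f y s| ≤ B * Real.pi := by
      rw [poissonInt_eq hy, ← integral_univ_inv_one_add_sq, ← integral_const_mul]
      refine norm_integral_le_of_norm_le (f := fun u => f (s + y * u) * (1 + u ^ 2)⁻¹)
        (integrable_inv_one_add_sq.const_mul B) (Eventually.of_forall fun u => ?_)
      rw [norm_mul, Real.norm_of_nonneg (by positivity : 0 ≤ (1 + u ^ 2)⁻¹)]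
      gcongr
      exact hB _
    refine h1.trans ?_
    rw [← div_eq_mul_inv, le_div_iff₀ (by positivity)]
    have h2 : s ^ 2 ≤ 4 * R' ^ 2 := by rw [← sq_abs]; nlinarith [abs_nonneg s]
    have : 0 ≤ B * Real.pi := by positivity
    nlinarith
  · have hs1 : 1 ≤ s ^ 2 := by rw [← sq_abs]; nlinarith
    have h1 : |poissonInt f y s| ≤ I * (4 / s ^ 2) := by
      rw [poissonInt, ← integral_mul_const]
      refine norm_integral_le_of_norm_le (f := fun x => f x * (y / ((s - x) ^ 2 + y ^ 2)))
        (hfi.abs.mul_const _) (Eventually.of_forall fun x => ?_)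
      rw [norm_mul, Real.norm_eq_abs, Real.norm_of_nonneg (by positivity)]
      rcases lt_or_ge R' |x| with hx | hx
      · simp [hsupp x hx]
      · refine mul_le_mul_of_nonneg_left ?_ (abs_nonneg _)
        have h3 : |s| / 2 ≤ |s - x| := by
          have := abs_sub_abs_le_abs_sub s x
          linarith
        have h4 : s ^ 2 / 4 ≤ (s - x) ^ 2 := by
          rw [← sq_abs s, ← sq_abs (s - x)]; nlinarith [abs_nonneg s]
        rw [div_le_div_iff₀ (by positivity) (by positivity)]
        nlinarith [sq_nonneg y]
    refine h1.trans ?_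
    rw [← div_eq_mul_inv, mul_div_assoc', div_le_div_iff₀ (by positivity) (by positivity)]
    have : 0 ≤ B * Real.pi * (1 + 4 * R' ^ 2) := by positivity
    nlinarith [mul_nonneg hI (sub_nonneg.2 hs1), mul_nonneg this (sq_nonneg s)]

/-- Fubini moves the Poisson kernel from `lam` onto the test function. Compact support bounds x, so
the kernel is dominated by the order-two weight in s. -/
lemma integral_mul_pick_im {lam : Measure ℝ} (hlam : MemMPlus 2 lam) (c₀ c₁ : ℝ) {f : ℝ → ℝ}
    (hf : Continuous f) (hfc : HasCompactSupport f) {y : ℝ} (hy : 0 < y) :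
    ∫ x, f x * (pick lam c₀ c₁ ⟨x, y⟩).im
      = c₁ * y * (∫ x, f x) + ∫ s, poissonInt f y s ∂lam := by
  have := hlam.isLocallyFiniteMeasure
  obtain ⟨R, hR⟩ := hfc.isCompact.isBounded.subset_closedBall 0
  have hfi : Integrable f := hf.integrable_of_hasCompactSupport hfc
  have hsupp : ∀ x, R < |x| → f x = 0 := fun x hx => by
    by_contra h
    have := hR (subset_tsupport f h)
    simp only [Metric.mem_closedBall, dist_zero_right, Real.norm_eq_abs] at this
    exact absurd this (not_le.2 hx)
  set C := (1 + 2 * (|R| + y) ^ 2) / y ^ 2 + 2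
  have hC : 0 ≤ C := by positivity
  have hprod : Integrable (Function.uncurry fun x s => f x * (y / ((s - x) ^ 2 + y ^ 2)))
      (volume.prod lam) := by
    have h1 : Integrable (fun p : ℝ × ℝ => (C * y * f p.1) * (1 + p.2 ^ 2)⁻¹) (volume.prod lam) :=
      (hfi.const_mul (C * y)).mul_prod (memMPlus_two_iff.1 hlam)
    refine h1.mono (Measurable.aestronglyMeasurable (by unfold Function.uncurry; fun_prop)) ?_
    refine Eventually.of_forall fun p => ?_
    rcases lt_or_ge R |p.1| with hx | hx
    · simp [Function.uncurry, hsupp _ hx]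
    · have hn : ‖(⟨p.1, y⟩ : ℂ)‖ ≤ |R| + y := by
        refine (Complex.norm_le_abs_re_add_abs_im _).trans ?_
        simp only [abs_of_pos hy]
        linarith [hx.trans (le_abs_self R)]
      have h2 := one_add_sq_le_normSq hy (im_le_norm_ofReal_sub ⟨p.1, y⟩ p.2) hn
      rw [← Complex.normSq_eq_norm_sq, Complex.normSq_apply] at h2
      simp only [Complex.sub_re, Complex.ofReal_re, Complex.sub_im, Complex.ofReal_im, zero_sub]
        at h2
      simp only [Function.uncurry, norm_mul, Real.norm_eq_abs]
      rw [abs_of_nonneg (by positivity : 0 ≤ y / ((p.2 - p.1) ^ 2 + y ^ 2)),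
        abs_of_nonneg (by positivity : 0 ≤ (1 + p.2 ^ 2)⁻¹), abs_of_nonneg hC, abs_of_pos hy]
      have h3 : y / ((p.2 - p.1) ^ 2 + y ^ 2) ≤ C * y * (1 + p.2 ^ 2)⁻¹ := by
        rw [← div_eq_mul_inv, div_le_div_iff₀ (by positivity) (by positivity)]
        have : 1 + p.2 ^ 2 ≤ C * ((p.2 - p.1) ^ 2 + y ^ 2) := by
          refine h2.trans (le_of_eq ?_)
          ring
        nlinarith
      calc |f p.1| * (y / ((p.2 - p.1) ^ 2 + y ^ 2))
          ≤ |f p.1| * (C * y * (1 + p.2 ^ 2)⁻¹) := by gcongr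
        _ = _ := by ring
  have hswap := integral_integral_swap hprod
  have e : ∀ x, f x * (pick lam c₀ c₁ ⟨x, y⟩).im
      = c₁ * y * f x + ∫ s, f x * (y / ((s - x) ^ 2 + y ^ 2)) ∂lam := fun x => by
    rw [pick_im hlam c₀ c₁ (z := ⟨x, y⟩) hy, integral_const_mul]
    ring
  simp only [e]
  have hi : Integrable fun x => ∫ s, f x * (y / ((s - x) ^ 2 + y ^ 2)) ∂lam :=
    hprod.integral_prod_left
  rw [integral_add (hfi.const_mul _) hi, integral_const_mul, hswap]
  rfl

/-- **Stieltjes inversion formula.** -/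
theorem tendsto_integral_mul_pick_im {lam : Measure ℝ} (hlam : MemMPlus 2 lam) (c₀ c₁ : ℝ)
    {f : ℝ → ℝ} (hf : Continuous f) (hfc : HasCompactSupport f) :
    Tendsto (fun y => ∫ x, f x * (pick lam c₀ c₁ ⟨x, y⟩).im) (𝓝[>] 0)
      (𝓝 (Real.pi * ∫ s, f s ∂lam)) := by
  obtain ⟨B, hB⟩ := hfc.exists_bound_of_continuous hf
  obtain ⟨C, hC⟩ := exists_poissonInt_le hf hfc
  have h1 : Tendsto (fun y => ∫ s, poissonInt f y s ∂lam) (𝓝[>] 0)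
      (𝓝 (∫ s, Real.pi * f s ∂lam)) := by
    refine tendsto_integral_filter_of_dominated_convergence (fun s => C * (1 + s ^ 2)⁻¹) ?_ ?_
      ((memMPlus_two_iff.1 hlam).const_mul C) ?_
    · refine Eventually.of_forall fun y => StronglyMeasurable.aestronglyMeasurable ?_
      refine StronglyMeasurable.integral_prod_right
        (f := fun s x => f x * (y / ((s - x) ^ 2 + y ^ 2))) ?_
      exact Measurable.stronglyMeasurable (by unfold Function.uncurry; fun_prop)
    · filter_upwards [self_mem_nhdsWithin, nhdsWithin_le_nhds (Iic_mem_nhds one_pos)] with y hy hy1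
      exact Eventually.of_forall fun s => hC y hy hy1 s
    · exact Eventually.of_forall fun s => tendsto_poissonInt hf hB s
  have h2 : Tendsto (fun y => c₁ * y * ∫ x, f x) (𝓝[>] 0) (𝓝 0) := by
    have : Continuous fun y : ℝ => c₁ * y * ∫ x, f x := by fun_prop
    simpa using (this.tendsto 0).mono_left nhdsWithin_le_nhds
  rw [integral_const_mul] at h1
  have h3 := h2.add h1
  rw [zero_add] at h3
  refine h3.congr' ?_
  filter_upwards [self_mem_nhdsWithin] with y hy using (integral_mul_pick_im hlam c₀ c₁ hf hfc hy).symm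

/-- The Nevanlinna representation is unique. -/
theorem pick_injective {mu nu : Measure ℝ} {ζ₀ ζ₁ η₀ η₁ : ℝ} (hmu : MemMPlus 2 mu)
    (hnu : MemMPlus 2 nu) (h : ∀ z : ℂ, 0 < z.im → pick mu ζ₀ ζ₁ z = pick nu η₀ η₁ z) :
    mu = nu ∧ ζ₀ = η₀ ∧ ζ₁ = η₁ := by
  have := hmu.isLocallyFiniteMeasure
  have := hnu.isLocallyFiniteMeasure
  have hm : mu = nu := by
    refine Measure.ext_of_integral_eq_on_compactlySupported fun f => ?_
    have h1 := tendsto_integral_mul_pick_im hmu ζ₀ ζ₁ f.continuous f.hasCompactSupport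
    have h2 := tendsto_integral_mul_pick_im hnu η₀ η₁ f.continuous f.hasCompactSupport
    have h3 : (fun y => ∫ x, f x * (pick mu ζ₀ ζ₁ ⟨x, y⟩).im) =ᶠ[𝓝[>] 0]
        fun y => ∫ x, f x * (pick nu η₀ η₁ ⟨x, y⟩).im := by
      filter_upwards [self_mem_nhdsWithin] with y hy
      congr 1 with x
      rw [h ⟨x, y⟩ hy]
    exact mul_left_cancel₀ Real.pi_ne_zero (tendsto_nhds_unique (h1.congr' h3) h2)
  subst hm
  -- With equal measures the integrals cancel, and the value at i separates ζ₀ (real part) from ζ₁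
  -- (imaginary part).
  have h1 := h Complex.I (by simp)
  simp only [pick, add_left_inj] at h1
  refine ⟨rfl, ?_, ?_⟩
  · simpa using congrArg Complex.re h1
  · simpa using congrArg Complex.im h1

lemma pick_ofReal_im (lam : Measure ℝ) (c₀ c₁ x : ℝ) : (pick lam c₀ c₁ x).im = 0 := by
  have h : ∀ s : ℝ, cauchyKer x s = ((1 / (s - x) - s / (1 + s ^ 2) : ℝ) : ℂ) := fun s => by
    simp [cauchyKer]
  simp only [pick, h]
  rw [integral_complex_ofReal]
  simp

/-- A Pick function with real boundary values on a half-line has no mass there. -/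
lemma support_subset_of_pick_eq {mu : Measure ℝ} (hmu : MemMPlus 2 mu) {ζ₀ ζ₁ b : ℝ} {F : ℂ → ℂ}
    (hFc : ∀ z : ℂ, z.re < b → 0 ≤ z.im → ContinuousAt F z) (hFr : ∀ x : ℝ, x < b → (F x).im = 0)
    (hF : ∀ z : ℂ, 0 < z.im → pick mu ζ₀ ζ₁ z = F z) : mu.support ⊆ Ici b := by
  intro x₀ hx₀
  by_contra hlt
  simp only [mem_Ici, not_le] at hlt
  have := hmu.isLocallyFiniteMeasure
  set ρ := (b - x₀) / 2
  have hρ : 0 < ρ := by simp only [ρ]; linarith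
  set f : ℝ → ℝ := fun x => max 0 (ρ - |x - x₀|)
  have hf : Continuous f := by fun_prop
  have hf0 : ∀ x, x ∉ Icc (x₀ - ρ) (x₀ + ρ) → f x = 0 := fun x hx => by
    refine max_eq_left ?_
    by_contra h
    push Not at h
    have := abs_lt.1 (by linarith : |x - x₀| < ρ)
    exact hx ⟨by linarith, by linarith⟩
  have hfc : HasCompactSupport f := HasCompactSupport.intro isCompact_Icc hf0
  have hlim := tendsto_integral_mul_pick_im hmu ζ₀ ζ₁ hf hfc
  -- F is controlled only for re < b and im ≥ 0. The clamps change nothing on the support of f with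
  -- y > 0, and make the integrand continuous on the whole plane.
  set g : ℝ → ℝ → ℝ := fun y x => f x * (F ⟨min x (x₀ + ρ), max y 0⟩).im
  have hg : Continuous (Function.uncurry g) := by
    have h1 : Continuous fun p : ℝ × ℝ => (⟨min p.2 (x₀ + ρ), max p.1 0⟩ : ℂ) := by
      have : (fun p : ℝ × ℝ => (⟨min p.2 (x₀ + ρ), max p.1 0⟩ : ℂ))
          = fun p => ((min p.2 (x₀ + ρ) : ℝ) : ℂ) + ((max p.1 0 : ℝ) : ℂ) * Complex.I := by
        ext p
        exact Complex.mk_eq_add_mul_I _ _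
      rw [this]
      fun_prop
    have h2 : Continuous fun p : ℝ × ℝ => F ⟨min p.2 (x₀ + ρ), max p.1 0⟩ := by
      rw [continuous_iff_continuousAt]
      intro p
      refine ContinuousAt.comp (f := fun p : ℝ × ℝ => (⟨min p.2 (x₀ + ρ), max p.1 0⟩ : ℂ)) ?_
        h1.continuousAt
      refine hFc _ ?_ (le_max_right _ _)
      refine (min_le_right _ _).trans_lt ?_
      simp only [ρ]; linarith
    exact (hf.comp continuous_snd).mul (Complex.continuous_im.comp h2)
  have hc : Continuous fun y => ∫ x in Icc (x₀ - ρ) (x₀ + ρ), g y x :=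
    continuous_parametric_integral_of_continuous hg isCompact_Icc
  have hc0 : ∫ x in Icc (x₀ - ρ) (x₀ + ρ), g 0 x = 0 := by
    refine integral_eq_zero_of_ae (Eventually.of_forall fun x => ?_)
    have h1 : (⟨min x (x₀ + ρ), max 0 0⟩ : ℂ) = ((min x (x₀ + ρ) : ℝ) : ℂ) := by
      apply Complex.ext <;> simp
    simp only [g, h1]
    rw [hFr _ ((min_le_right _ _).trans_lt (by simp only [ρ]; linarith))]
    simp
  have hlim2 : Tendsto (fun y => ∫ x in Icc (x₀ - ρ) (x₀ + ρ), g y x) (𝓝[>] 0) (𝓝 0) := by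
    have := (hc.tendsto 0).mono_left (nhdsWithin_le_nhds (s := Ioi 0))
    rwa [hc0] at this
  have heq : (fun y => ∫ x in Icc (x₀ - ρ) (x₀ + ρ), g y x) =ᶠ[𝓝[>] 0]
      fun y => ∫ x, f x * (pick mu ζ₀ ζ₁ ⟨x, y⟩).im := by
    filter_upwards [self_mem_nhdsWithin] with y hy
    rw [← setIntegral_eq_integral_of_forall_compl_eq_zero (s := Icc (x₀ - ρ) (x₀ + ρ))
      (f := fun x => f x * (pick mu ζ₀ ζ₁ ⟨x, y⟩).im) (fun x hx => by rw [hf0 x hx, zero_mul])]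
    refine setIntegral_congr_fun measurableSet_Icc fun x hx => ?_
    simp only [g]
    rw [min_eq_left hx.2, max_eq_left (le_of_lt hy), hF ⟨x, y⟩ hy]
  have hzero : ∫ s, f s ∂mu = 0 := by
    have := tendsto_nhds_unique (hlim2.congr' heq) hlim
    exact (mul_eq_zero.1 this.symm).resolve_left Real.pi_ne_zero
  rw [integral_eq_zero_iff_of_nonneg (f := f) (fun x => le_max_left _ _)
    (hf.integrable_of_hasCompactSupport hfc)] at hzero
  have hnull : mu (Ioo (x₀ - ρ) (x₀ + ρ)) = 0 := by
    refine measure_mono_null (fun x hx => ?_) (ae_iff.1 hzero)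
    have : |x - x₀| < ρ := abs_lt.2 ⟨by linarith [hx.1], by linarith [hx.2]⟩
    have h2 : 0 < f x := lt_max_of_lt_right (by linarith)
    exact h2.ne'
  exact Measure.notMem_support_iff_exists.2
    ⟨_, Ioo_mem_nhds (by linarith) (by linarith), hnull⟩ hx₀

/-- To the left of a, each 1/(s - x) is strictly increasing in x and c₁ x is non-decreasing. Only
injectivity is needed. -/
lemma pick_strictMono {lam : Measure ℝ} (hlam : MemMPlus 2 lam) {c₀ c₁ a : ℝ} (hc₁ : 0 ≤ c₁)
    (ha : ∀ᵐ s ∂lam, a ≤ s) (hne : ¬ (lam = 0 ∧ c₁ = 0)) {x y : ℝ} (hxy : x < y) (hy : y < a) :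
    pick lam c₀ c₁ x ≠ pick lam c₀ c₁ y := by
  intro h
  have hiy := integrable_cauchyKer hlam (z := (y : ℂ)) (sub_pos.2 hy)
    (by simpa using ae_sub_re_le ha (y : ℂ))
  have hix := integrable_cauchyKer hlam (z := (x : ℂ)) (sub_pos.2 (hxy.trans hy))
    (by simpa using ae_sub_re_le ha (x : ℂ))
  set k : ℝ → ℝ := fun s => 1 / (s - y) - 1 / (s - x)
  have hk : ∀ s : ℝ, cauchyKer y s - cauchyKer x s = (k s : ℂ) := fun s => by
    simp [cauchyKer, k]
  have hki : Integrable k lam := by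
    have := (hiy.sub hix).re
    refine this.congr (Eventually.of_forall fun s => ?_)
    simp [hk]
  have hkpos : ∀ᵐ s ∂lam, 0 < k s := by
    filter_upwards [ha] with s hs
    have h1 : 0 < s - y := by linarith
    have : 1 / (s - x) < 1 / (s - y) := one_div_lt_one_div_of_lt h1 (by linarith)
    simp only [k]; linarith
  have hsub : pick lam c₀ c₁ y - pick lam c₀ c₁ x = ((c₁ * (y - x) + ∫ s, k s ∂lam : ℝ) : ℂ) := by
    have : pick lam c₀ c₁ y - pick lam c₀ c₁ x
        = c₁ * (y - x) + (∫ s, cauchyKer y s ∂lam - ∫ s, cauchyKer x s ∂lam) := by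
      simp only [pick]; ring
    rw [this, ← integral_sub hiy hix]
    simp only [hk]
    rw [integral_complex_ofReal]
    push_cast
    ring
  rw [h, sub_self] at hsub
  have h0 : c₁ * (y - x) + ∫ s, k s ∂lam = 0 := by exact_mod_cast hsub.symm
  have h1 : 0 ≤ ∫ s, k s ∂lam := integral_nonneg_of_ae (hkpos.mono fun s hs => hs.le)
  have h2 : 0 ≤ c₁ * (y - x) := mul_nonneg hc₁ (by linarith)
  have h3 : c₁ = 0 := by
    have : c₁ * (y - x) = 0 := by linarith
    exact (mul_eq_zero.1 this).resolve_right (by linarith)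
  have h4 : ∫ s, k s ∂lam = 0 := by linarith
  rw [integral_eq_zero_iff_of_nonneg_ae (hkpos.mono fun s hs => hs.le) hki] at h4
  refine hne ⟨?_, h3⟩
  rw [← ae_eq_bot, ← eventually_false_iff_eq_bot]
  filter_upwards [h4, hkpos] with s hs hs' using hs'.ne' hs

/-- A non-constant Pick function has at most one zero to the left of a; if there is one, it serves
as b. The constant case is c₀ ≠ 0. -/
lemma exists_forall_pick_ne_zero {lam : Measure ℝ} (hlam : MemMPlus 2 lam) {c₀ c₁ a : ℝ}
    (hc₁ : 0 ≤ c₁) (ha : ∀ᵐ s ∂lam, a ≤ s) (hne : ¬ (lam = 0 ∧ c₀ = 0 ∧ c₁ = 0)) :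
    ∃ b ≤ a, ∀ x : ℝ, x < b → pick lam c₀ c₁ x ≠ 0 := by
  by_cases h : lam = 0 ∧ c₁ = 0
  · refine ⟨a, le_rfl, fun x _ => ?_⟩
    have : c₀ ≠ 0 := fun h0 => hne ⟨h.1, h0, h.2⟩
    simp [pick, h.1, h.2, this]
  · by_cases h0 : ∃ x < a, pick lam c₀ c₁ (x : ℝ) = 0
    · obtain ⟨b, hb, hb0⟩ := h0
      refine ⟨b, hb.le, fun x hx hx0 => ?_⟩
      exact pick_strictMono hlam hc₁ ha h hx hb (hx0.trans hb0.symm)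
    · push Not at h0
      exact ⟨a, le_rfl, h0⟩

/-- **Existence and uniqueness of the reciprocal Pick function**, together with the location of the
spectrum. -/
theorem exists_pick_mul_eq {lam : Measure ℝ} (hlam : MemMPlus 2 lam) {c₀ c₁ a : ℝ}
    (hc₁ : 0 ≤ c₁) (ha : ∀ᵐ s ∂lam, a ≤ s) (hne : ¬ (lam = 0 ∧ c₀ = 0 ∧ c₁ = 0)) :
    ∃ (mu : Measure ℝ) (ζ₀ ζ₁ : ℝ), MemMPlus 2 mu ∧ 0 ≤ ζ₁ ∧ BddBelow mu.support ∧
      ∀ z : ℂ, 0 < z.im → pick lam c₀ c₁ z * pick mu ζ₀ ζ₁ z = -(Real.pi : ℂ) ^ 2 := by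
  set F : ℂ → ℂ := fun z => -(Real.pi : ℂ) ^ 2 / pick lam c₀ c₁ z
  have hF : DifferentiableOn ℂ F {z | 0 < z.im} :=
    (differentiableOn_const _).div (differentiableOn_pick hlam c₀ c₁)
      fun z hz => pick_ne_zero hlam hc₁ hne hz
  have hdiv : ∀ w : ℂ, (-(Real.pi : ℂ) ^ 2 / w).im = Real.pi ^ 2 * w.im / Complex.normSq w := by
    intro w
    have : -(Real.pi : ℂ) ^ 2 = ((-(Real.pi ^ 2) : ℝ) : ℂ) := by push_cast; ring
    rw [this, Complex.div_im, Complex.ofReal_im, Complex.ofReal_re]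
    ring
  have hFim : ∀ z : ℂ, 0 < z.im → 0 ≤ (F z).im := fun z hz => by
    have h1 := mul_im_le_pick_im hlam c₀ c₁ hz
    have h2 : 0 ≤ (pick lam c₀ c₁ z).im := (mul_nonneg hc₁ hz.le).trans h1
    simp only [F, hdiv]
    exact div_nonneg (by positivity) (Complex.normSq_nonneg _)
  obtain ⟨mu, ζ₀, ζ₁, hmu, hζ₁, heq⟩ := exists_eq_pick hF hFim
  obtain ⟨b, hba, hb⟩ := exists_forall_pick_ne_zero hlam hc₁ ha hne
  refine ⟨mu, ζ₀, ζ₁, hmu, hζ₁, ⟨b, fun s hs => ?_⟩, fun z hz => ?_⟩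
  · refine support_subset_of_pick_eq hmu (F := F) ?_ ?_ (fun z hz => (heq z hz).symm) hs
    · intro z hz hz0
      refine continuousAt_const.div (continuousAt_pick hlam c₀ c₁ ha (hz.trans_le hba)) ?_
      rcases hz0.eq_or_lt with h | h
      · have : z = ((z.re : ℝ) : ℂ) := Complex.ext (by simp) (by simp [← h])
        rw [this]
        exact hb _ hz
      · exact pick_ne_zero hlam hc₁ hne h
    · intro x _
      simp only [F, hdiv, pick_ofReal_im, mul_zero, zero_div]
  · rw [← heq z hz]
    exact mul_div_cancel₀ _ (pick_ne_zero hlam hc₁ hne hz)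

end Stieltjes

section Volterra

open Filter Topology

/-! ### The convolution algebra of the half-line -/

lemma locallyIntegrableOn_Ici_iff {f : ℝ → ℝ} :
    LocallyIntegrableOn f (Ici 0) ↔ ∀ T, IntegrableOn f (Ioc 0 T) := by
  rw [locallyIntegrableOn_iff isClosed_Ici.isLocallyClosed]
  refine ⟨fun h T => (h (Icc 0 T) Icc_subset_Ici_self isCompact_Icc).mono_set Ioc_subset_Icc_self,
    fun h k hk hc => ?_⟩
  obtain ⟨T, hT⟩ := hc.bddAbove
  refine IntegrableOn.mono_set (t := Icc 0 T) ?_ fun x hx => ⟨hk hx, hT hx⟩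
  rw [integrableOn_Icc_iff_integrableOn_Ioc]
  exact h T

lemma ae_Ici_iff {p : ℝ → Prop} :
    (∀ᵐ t ∂(volume.restrict (Ici (0 : ℝ))), p t) ↔
      ∀ T, ∀ᵐ t ∂(volume.restrict (Ioc (0 : ℝ) T)), p t := by
  refine ⟨fun h T => ae_restrict_of_ae_restrict_of_subset
    (Ioc_subset_Ioi_self.trans Ioi_subset_Ici_self) h, fun h => ?_⟩
  have e : Ioi (0 : ℝ) = ⋃ n : ℕ, Ioc (0 : ℝ) n := by
    ext x
    simp only [mem_Ioi, mem_iUnion, mem_Ioc, exists_and_left, iff_self_and]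
    exact fun _ => exists_nat_ge x
  rw [← restrict_Ioi_eq_restrict_Ici, e, ae_restrict_iUnion_iff]
  exact fun n => h n

/-- Truncation of a function to `(0, T]`. -/
noncomputable def trunc (T : ℝ) (f : ℝ → ℝ) : ℝ → ℝ := (Ioc 0 T).indicator f

lemma integrable_trunc {f : ℝ → ℝ} (hf : LocallyIntegrableOn f (Ici 0)) (T : ℝ) :
    Integrable (trunc T f) :=
  (integrable_indicator_iff measurableSet_Ioc).2 (locallyIntegrableOn_Ici_iff.1 hf T)

open scoped Convolution

/-- Up to time T only values on (0, T] matter (the endpoints are null), so integrability, additivity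
and associativity can be imported from convolution on L¹(ℝ). -/
lemma vconv_eq_convolution (f g : ℝ → ℝ) {t T : ℝ} (h0 : 0 ≤ t) (hT : t ≤ T) :
    vconv f g t = (trunc T g ⋆[ContinuousLinearMap.mul ℝ ℝ] trunc T f) t := by
  rw [convolution_mul, vconv, intervalIntegral.integral_of_le h0, integral_Ioc_eq_integral_Ioo,
    ← integral_indicator measurableSet_Ioo]
  congr 1 with τ
  by_cases hτ : τ ∈ Ioo 0 t
  · have h1 : τ ∈ Ioc 0 T := ⟨hτ.1, hτ.2.le.trans hT⟩
    have h2 : t - τ ∈ Ioc 0 T := ⟨by linarith [hτ.2], by linarith [hτ.1]⟩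
    rw [indicator_of_mem hτ, trunc, trunc, indicator_of_mem h1, indicator_of_mem h2, mul_comm]
  · rw [indicator_of_notMem hτ]
    by_cases h1 : τ ∈ Ioc 0 T
    · have h2 : t - τ ∉ Ioc 0 T := fun h => hτ ⟨h1.1, by linarith [h.1]⟩
      rw [trunc, trunc, indicator_of_notMem h2, mul_zero]
    · rw [trunc, indicator_of_notMem h1, zero_mul]

lemma vconv_comm (f g : ℝ → ℝ) (t : ℝ) : vconv f g t = vconv g f t := by
  have := intervalIntegral.integral_comp_sub_left (a := 0) (b := t)
    (fun τ => f (t - τ) * g τ) t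
  simp only [sub_sub_cancel, sub_zero, sub_self] at this
  rw [vconv, ← this, vconv]
  congr 1 with τ
  ring

lemma vconv_congr_right (f : ℝ → ℝ) {g g' : ℝ → ℝ} (h : g =ᵐ[volume.restrict (Ici 0)] g') {t : ℝ}
    (ht : 0 ≤ t) : vconv f g t = vconv f g' t := by
  rw [vconv, vconv, intervalIntegral.integral_of_le ht, intervalIntegral.integral_of_le ht]
  refine integral_congr_ae ?_
  filter_upwards [ae_Ici_iff.1 h t] with τ hτ
  rw [hτ]

lemma vconv_congr {f f' g g' : ℝ → ℝ} (hf : f =ᵐ[volume.restrict (Ici 0)] f')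
    (hg : g =ᵐ[volume.restrict (Ici 0)] g') {t : ℝ} (ht : 0 ≤ t) :
    vconv f g t = vconv f' g' t := by
  rw [vconv_congr_right f hg ht, vconv_comm, vconv_congr_right g' hf ht, vconv_comm]

lemma ae_nonneg_Ici : ∀ᵐ t ∂(volume.restrict (Ici (0 : ℝ))), 0 ≤ t :=
  ae_restrict_mem measurableSet_Ici

lemma LocallyIntegrableOn.vconv {f g : ℝ → ℝ} (hf : LocallyIntegrableOn f (Ici 0))
    (hg : LocallyIntegrableOn g (Ici 0)) : LocallyIntegrableOn (vconv f g) (Ici 0) := by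
  refine locallyIntegrableOn_Ici_iff.2 fun T => ?_
  have := ((integrable_trunc hg T).integrable_convolution (ContinuousLinearMap.mul ℝ ℝ)
    (integrable_trunc hf T)).integrableOn (s := Ioc 0 T)
  refine this.congr_fun (fun t ht => ?_) measurableSet_Ioc
  exact (vconv_eq_convolution f g ht.1.le ht.2).symm

lemma vconv_add_ae {f g h : ℝ → ℝ} (hf : LocallyIntegrableOn f (Ici 0))
    (hg : LocallyIntegrableOn g (Ici 0)) (hh : LocallyIntegrableOn h (Ici 0)) :
    vconv f (g + h) =ᵐ[volume.restrict (Ici 0)] vconv f g + vconv f h := by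
  refine ae_Ici_iff.2 fun T => ?_
  have h1 := (integrable_trunc hg T).ae_convolution_exists (ContinuousLinearMap.mul ℝ ℝ)
    (integrable_trunc hf T)
  have h2 := (integrable_trunc hh T).ae_convolution_exists (ContinuousLinearMap.mul ℝ ℝ)
    (integrable_trunc hf T)
  filter_upwards [ae_restrict_mem measurableSet_Ioc, ae_restrict_of_ae h1, ae_restrict_of_ae h2]
    with t ht h1 h2
  rw [Pi.add_apply, vconv_eq_convolution f g ht.1.le ht.2, vconv_eq_convolution f h ht.1.le ht.2,
    vconv_eq_convolution f (g + h) ht.1.le ht.2, ← h1.add_distrib h2]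
  congr 1
  simp only [trunc, indicator_add']

lemma vconv_smul (c : ℝ) (f g : ℝ → ℝ) : vconv f (c • g) = c • vconv f g := by
  ext t
  simp only [vconv, Pi.smul_apply, smul_eq_mul]
  rw [← intervalIntegral.integral_const_mul]
  congr 1 with τ
  ring

lemma convolution_trunc_eq_zero (T : ℝ) (f g : ℝ → ℝ) {t : ℝ} (ht : t ≤ 0) :
    (trunc T f ⋆[ContinuousLinearMap.mul ℝ ℝ] trunc T g) t = 0 := by
  rw [convolution_mul]
  refine integral_eq_zero_of_ae (Eventually.of_forall fun τ => ?_)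
  change trunc T f τ * trunc T g (t - τ) = 0
  by_cases h1 : τ ∈ Ioc 0 T
  · have h2 : t - τ ∉ Ioc 0 T := fun h => by linarith [h.1, h1.1]
    rw [trunc, trunc, indicator_of_notMem h2, mul_zero]
  · rw [trunc, indicator_of_notMem h1, zero_mul]

lemma trunc_vconv (T : ℝ) (f g : ℝ → ℝ) {t : ℝ} (ht : t ≤ T) :
    trunc T (vconv f g) t = (trunc T g ⋆[ContinuousLinearMap.mul ℝ ℝ] trunc T f) t := by
  rcases le_or_gt t 0 with h | h
  · rw [convolution_trunc_eq_zero T g f h, trunc, indicator_of_notMem]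
    exact fun h' => absurd h'.1 (not_lt.2 h)
  · have hm : t ∈ Ioc 0 T := ⟨h, ht⟩
    rw [trunc, indicator_of_mem hm, vconv_eq_convolution f g h.le ht]

lemma vconv_assoc_ae {f g h : ℝ → ℝ} (hf : LocallyIntegrableOn f (Ici 0))
    (hg : LocallyIntegrableOn g (Ici 0)) (hh : LocallyIntegrableOn h (Ici 0)) :
    vconv (vconv f g) h =ᵐ[volume.restrict (Ici 0)] vconv f (vconv g h) := by
  refine ae_Ici_iff.2 fun T => ?_
  set L := ContinuousLinearMap.mul ℝ ℝ
  have hfT := integrable_trunc hf T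
  have hgT := integrable_trunc hg T
  have hhT := integrable_trunc hh T
  have h1 := hhT.ae_convolution_exists L hgT
  have h2 := hgT.norm.ae_convolution_exists L hfT.norm
  have h3 := hhT.norm.ae_convolution_exists L (hgT.norm.integrable_convolution L hfT.norm)
  filter_upwards [ae_restrict_mem measurableSet_Ioc, ae_restrict_of_ae h3] with t ht h3
  have key := convolution_assoc L L L L (by intro x y z; exact mul_assoc x y z)
    hhT.aestronglyMeasurable hgT.aestronglyMeasurable hfT.aestronglyMeasurable h1 h2 h3
  rw [vconv_eq_convolution _ _ ht.1.le ht.2, vconv_eq_convolution _ _ ht.1.le ht.2]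
  have e1 : (trunc T h ⋆[L] trunc T (vconv f g)) t
      = (trunc T h ⋆[L] (trunc T g ⋆[L] trunc T f)) t := by
    rw [convolution_mul, convolution_mul]
    congr 1 with τ
    by_cases hτ : τ ∈ Ioc 0 T
    · rw [trunc_vconv T f g (by linarith [hτ.1, ht.2])]
    · simp [trunc, indicator_of_notMem hτ]
  have e2 : (trunc T (vconv g h) ⋆[L] trunc T f) t
      = ((trunc T h ⋆[L] trunc T g) ⋆[L] trunc T f) t := by
    rw [convolution_mul, convolution_mul]
    congr 1 with τ
    rcases le_or_gt τ T with hτ | hτ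
    · rw [trunc_vconv T g h hτ]
    · have : t - τ ∉ Ioc 0 T := fun h' => by linarith [h'.1, ht.2]
      simp [trunc, indicator_of_notMem this]
  rw [e1, e2, key]

lemma vconv_one (f : ℝ → ℝ) (t : ℝ) : vconv (fun _ => 1) f t = ∫ τ in (0 : ℝ)..t, f τ := by
  simp [vconv]

/-! ### The quotient algebra and its unitization -/

/-- Locally integrable functions on the half-line. -/
def locIntSub : Submodule ℝ (ℝ → ℝ) where
  carrier := {f | LocallyIntegrableOn f (Ici 0) volume}
  add_mem' {f g} (hf : LocallyIntegrableOn f (Ici 0) volume)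
    (hg : LocallyIntegrableOn g (Ici 0) volume) := hf.add hg
  zero_mem' := locallyIntegrableOn_zero
  smul_mem' c f (hf : LocallyIntegrableOn f (Ici 0) volume) := hf.smul c

/-- Functions that vanish almost everywhere on the half-line. -/
def nullSub : Submodule ℝ locIntSub where
  carrier := {f | f.1 =ᵐ[volume.restrict (Ici 0)] 0}
  add_mem' {f g} (hf : f.1 =ᵐ[volume.restrict (Ici 0)] 0)
      (hg : g.1 =ᵐ[volume.restrict (Ici 0)] 0) := by
    change f.1 + g.1 =ᵐ[volume.restrict (Ici 0)] 0
    simpa using hf.add hg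
  zero_mem' := (EventuallyEq.rfl : (0 : ℝ → ℝ) =ᵐ[volume.restrict (Ici 0)] 0)
  smul_mem' c f (hf : f.1 =ᵐ[volume.restrict (Ici 0)] 0) := by
    change c • f.1 =ᵐ[volume.restrict (Ici 0)] 0
    simpa using hf.const_smul c

/-- The convolution algebra of locally integrable functions on the half-line. -/
def ConvAlg : Type := locIntSub ⧸ nullSub

namespace ConvAlg

noncomputable instance : AddCommGroup ConvAlg := inferInstanceAs (AddCommGroup (locIntSub ⧸ nullSub))

noncomputable instance : Module ℝ ConvAlg := inferInstanceAs (Module ℝ (locIntSub ⧸ nullSub))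

/-- The class of a locally integrable function. -/
noncomputable def mk : locIntSub →ₗ[ℝ] ConvAlg := nullSub.mkQ

lemma mk_surjective : Function.Surjective mk := nullSub.mkQ_surjective

lemma mk_eq_iff {f g : locIntSub} : mk f = mk g ↔ f.1 =ᵐ[volume.restrict (Ici 0)] g.1 := by
  have : mk f = mk g ↔ f - g ∈ nullSub := Submodule.Quotient.eq nullSub
  rw [this]
  change f.1 - g.1 =ᵐ[volume.restrict (Ici 0)] 0 ↔ _
  refine ⟨fun h => ?_, fun h => ?_⟩
  · filter_upwards [h] with t ht using sub_eq_zero.1 ht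
  · filter_upwards [h] with t ht using sub_eq_zero.2 ht

/-- Convolution of locally integrable functions. -/
noncomputable def conv (f g : locIntSub) : locIntSub := ⟨vconv f.1 g.1, LocallyIntegrableOn.vconv f.2 g.2⟩

/-- The product uses chosen representatives; `mk_mul_mk` shows that the choice does not matter. -/
noncomputable instance : Mul ConvAlg :=
  ⟨fun x y => mk (conv (Function.surjInv mk_surjective x) (Function.surjInv mk_surjective y))⟩

lemma mk_mul_mk (f g : locIntSub) : mk f * mk g = mk (conv f g) := by
  refine mk_eq_iff.2 ?_
  filter_upwards [ae_nonneg_Ici] with t ht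
  exact vconv_congr (mk_eq_iff.1 (Function.surjInv_eq mk_surjective (mk f)))
    (mk_eq_iff.1 (Function.surjInv_eq mk_surjective (mk g))) ht

protected lemma mul_comm (x y : ConvAlg) : x * y = y * x := by
  obtain ⟨f, rfl⟩ := mk_surjective x
  obtain ⟨g, rfl⟩ := mk_surjective y
  rw [mk_mul_mk, mk_mul_mk]
  exact mk_eq_iff.2 (Eventually.of_forall fun t => vconv_comm _ _ t)

protected lemma mul_add (x y z : ConvAlg) : x * (y + z) = x * y + x * z := by
  obtain ⟨f, rfl⟩ := mk_surjective x
  obtain ⟨g, rfl⟩ := mk_surjective y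
  obtain ⟨h, rfl⟩ := mk_surjective z
  rw [← map_add, mk_mul_mk, mk_mul_mk, mk_mul_mk, ← map_add]
  exact mk_eq_iff.2 (vconv_add_ae f.2 g.2 h.2)

protected lemma mul_smul (c : ℝ) (x y : ConvAlg) : x * (c • y) = c • (x * y) := by
  obtain ⟨f, rfl⟩ := mk_surjective x
  obtain ⟨g, rfl⟩ := mk_surjective y
  rw [← map_smul, mk_mul_mk, mk_mul_mk, ← map_smul]
  congr 1
  exact Subtype.ext (vconv_smul c f.1 g.1)

protected lemma mul_zero (x : ConvAlg) : x * 0 = 0 := by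
  simpa using ConvAlg.mul_smul 0 x 0

noncomputable instance : NonUnitalCommRing ConvAlg where
  left_distrib := ConvAlg.mul_add
  right_distrib x y z := by
    rw [ConvAlg.mul_comm, ConvAlg.mul_add, ConvAlg.mul_comm z, ConvAlg.mul_comm z]
  zero_mul x := by rw [ConvAlg.mul_comm, ConvAlg.mul_zero]
  mul_zero := ConvAlg.mul_zero
  mul_comm := ConvAlg.mul_comm
  mul_assoc x y z := by
    obtain ⟨f, rfl⟩ := mk_surjective x
    obtain ⟨g, rfl⟩ := mk_surjective y
    obtain ⟨h, rfl⟩ := mk_surjective z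
    simp only [mk_mul_mk]
    exact mk_eq_iff.2 (vconv_assoc_ae f.2 g.2 h.2)

instance : SMulCommClass ℝ ConvAlg ConvAlg := ⟨fun c x y => (ConvAlg.mul_smul c x y).symm⟩

instance : IsScalarTower ℝ ConvAlg ConvAlg := ⟨fun c x y => by
  change c • x * y = c • (x * y)
  rw [ConvAlg.mul_comm, ConvAlg.mul_smul, ConvAlg.mul_comm]⟩

end ConvAlg

/-- The convolution algebra with a unit (the Dirac mass at `0`) adjoined. -/
abbrev VolterraAlg : Type := Unitization ℝ ConvAlg

open Classical in
/-- The element of the Volterra algebra given by a locally integrable function. -/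
noncomputable def vol (f : ℝ → ℝ) : VolterraAlg :=
  if h : LocallyIntegrableOn f (Ici 0) volume then ((ConvAlg.mk ⟨f, h⟩ : ConvAlg) : VolterraAlg) else 0

lemma vol_of {f : ℝ → ℝ} (h : LocallyIntegrableOn f (Ici 0) volume) :
    vol f = ((ConvAlg.mk ⟨f, h⟩ : ConvAlg) : VolterraAlg) := dif_pos h

lemma vol_eq_iff {f g : ℝ → ℝ} (hf : LocallyIntegrableOn f (Ici 0))
    (hg : LocallyIntegrableOn g (Ici 0)) :
    vol f = vol g ↔ f =ᵐ[volume.restrict (Ici 0)] g := by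
  rw [vol_of hf, vol_of hg, Unitization.inr_inj, ConvAlg.mk_eq_iff]

lemma vol_add {f g : ℝ → ℝ} (hf : LocallyIntegrableOn f (Ici 0))
    (hg : LocallyIntegrableOn g (Ici 0)) : vol (f + g) = vol f + vol g := by
  rw [vol_of hf, vol_of hg, vol_of (hf.add hg), ← Unitization.inr_add, ← map_add]
  rfl

lemma vol_smul (c : ℝ) {f : ℝ → ℝ} (hf : LocallyIntegrableOn f (Ici 0)) :
    vol (c • f) = algebraMap ℝ VolterraAlg c * vol f := by
  rw [vol_of hf, vol_of (hf.smul c), ← Algebra.smul_def, ← Unitization.inr_smul, ← map_smul]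
  rfl

lemma vol_vconv {f g : ℝ → ℝ} (hf : LocallyIntegrableOn f (Ici 0))
    (hg : LocallyIntegrableOn g (Ici 0)) : vol (vconv f g) = vol f * vol g := by
  rw [vol_of hf, vol_of hg, vol_of (LocallyIntegrableOn.vconv hf hg), ← Unitization.inr_mul,
    ConvAlg.mk_mul_mk]
  rfl

lemma fst_vol (f : ℝ → ℝ) : (vol f).fst = 0 := by
  unfold vol
  split_ifs <;> simp

lemma locallyIntegrableOn_one : LocallyIntegrableOn (fun _ : ℝ => (1 : ℝ)) (Ici 0) :=
  locallyIntegrableOn_const 1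

/-- The unit step function. -/
noncomputable def step : VolterraAlg := vol fun _ => 1

lemma exists_vol (x : VolterraAlg) : ∃ f : ℝ → ℝ, LocallyIntegrableOn f (Ici 0) ∧
    x = algebraMap ℝ VolterraAlg x.fst + vol f := by
  obtain ⟨f, hf⟩ := ConvAlg.mk_surjective x.snd
  refine ⟨f.1, f.2, ?_⟩
  rw [vol_of f.2]
  change x = Unitization.inl x.fst + ((ConvAlg.mk f : ConvAlg) : VolterraAlg)
  rw [hf, Unitization.inl_fst_add_inr_snd_eq]

lemma ae_eq_zero_of_primitive_eq_zero {f : ℝ → ℝ} (hf : LocallyIntegrableOn f (Ici 0))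
    (h : ∀ t, 0 ≤ t → ∫ τ in (0 : ℝ)..t, f τ = 0) : f =ᵐ[volume.restrict (Ici 0)] 0 := by
  refine ae_Ici_iff.2 fun T => ?_
  rcases le_or_gt T 0 with hT | hT
  · simp [Ioc_eq_empty_of_le hT]
  have hi : IntervalIntegrable f volume 0 T :=
    (intervalIntegrable_iff_integrableOn_Ioc_of_le hT.le).2 (locallyIntegrableOn_Ici_iff.1 hf T)
  have hd := hi.ae_hasDerivAt_integral
  have hT' : ∀ᵐ t ∂(volume : Measure ℝ), t ≠ T := by simp [ae_iff]
  filter_upwards [ae_restrict_of_ae hd, ae_restrict_of_ae hT', ae_restrict_mem measurableSet_Ioc]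
    with t ht htT hmem
  have h1 := ht (by rw [uIcc_of_le hT.le]; exact ⟨hmem.1.le, hmem.2⟩) 0 (by simp)
  have h2 : (fun x => ∫ τ in (0 : ℝ)..x, f τ) =ᶠ[𝓝 t] fun _ => 0 := by
    filter_upwards [lt_mem_nhds hmem.1] with x hx using h x hx.le
  exact (h1.congr_of_eventuallyEq h2.symm).unique (hasDerivAt_const t (0 : ℝ))

lemma continuousOn_primitive_Ici {f : ℝ → ℝ} (hf : LocallyIntegrableOn f (Ici 0)) :
    ContinuousOn (fun t => ∫ τ in (0 : ℝ)..t, f τ) (Ici 0) := by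
  intro t ht
  have ht' : (0 : ℝ) ≤ t := ht
  have h1 : ContinuousOn (fun t => ∫ τ in (0 : ℝ)..t, f τ) (uIcc 0 (t + 1)) := by
    refine intervalIntegral.continuousOn_primitive_interval ?_
    rw [uIcc_of_le (by linarith), integrableOn_Icc_iff_integrableOn_Ioc]
    exact locallyIntegrableOn_Ici_iff.1 hf (t + 1)
  rw [uIcc_of_le (by linarith)] at h1
  refine (h1 t ⟨ht, by linarith⟩).mono_of_mem_nhdsWithin ?_
  exact inter_mem_nhdsWithin _ (Iic_mem_nhds (by linarith))

/-- For x = cδ + f the product is the continuous function c + ∫₀ᵗ f. Vanishing almost everywhere, it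
vanishes everywhere on [0, ∞): t = 0 gives c = 0, and differentiation gives f = 0. Cancelling `step`
plays the role of differentiation below. -/
lemma step_mul_eq_zero {x : VolterraAlg} (h : step * x = 0) : x = 0 := by
  obtain ⟨f, hf, hx⟩ := exists_vol x
  set c := x.fst
  have h1 : vol (c • (fun _ => (1 : ℝ)) + vconv (fun _ => 1) f) = 0 := by
    rw [vol_add (locallyIntegrableOn_one.smul c) (LocallyIntegrableOn.vconv locallyIntegrableOn_one hf),
      vol_smul c locallyIntegrableOn_one, vol_vconv locallyIntegrableOn_one hf, ← h, hx, step]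
    ring
  have hz : LocallyIntegrableOn (0 : ℝ → ℝ) (Ici 0) volume := locallyIntegrableOn_zero
  have h0 : vol 0 = 0 := by
    rw [vol_of hz]
    exact congrArg _ (map_zero ConvAlg.mk)
  rw [← h0, vol_eq_iff ((locallyIntegrableOn_one.smul c).add
    (LocallyIntegrableOn.vconv locallyIntegrableOn_one hf)) hz] at h1
  have h2 : EqOn (fun t => c + ∫ τ in (0 : ℝ)..t, f τ) (fun _ => 0) (Ici 0) := by
    refine Measure.eqOn_of_ae_eq (μ := volume) ?_
      (continuousOn_const.add (continuousOn_primitive_Ici hf)) continuousOn_const ?_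
    · filter_upwards [h1] with t ht
      simpa [vconv_one] using ht
    · rw [interior_Ici, closure_Ioi]
  have hc : c = 0 := by simpa using h2 (mem_Ici.2 le_rfl)
  have h3 : f =ᵐ[volume.restrict (Ici 0)] 0 :=
    ae_eq_zero_of_primitive_eq_zero hf fun t ht => by simpa [hc] using h2 (mem_Ici.2 ht)
  rw [hx, hc, (vol_eq_iff hf hz).2 h3, h0]
  simp

lemma step_mul_cancel {x y : VolterraAlg} (h : step * x = step * y) : x = y :=
  sub_eq_zero.1 (step_mul_eq_zero (by rw [mul_sub, h, sub_self]))

end Volterra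

section Laplace

open Filter Topology

/-! ### Laplace transforms -/

/-- The Laplace integral of `f` converges absolutely at `p`. -/
def LapInt (p : ℝ) (f : ℝ → ℝ) : Prop := IntegrableOn (fun t => Real.exp (-(p * t)) * f t) (Ioi 0)

/-- The Laplace transform of a function on the half-line. -/
noncomputable def lap (p : ℝ) (f : ℝ → ℝ) : ℝ := ∫ t in Ioi 0, Real.exp (-(p * t)) * f t

lemma LapInt.mono {p q : ℝ} (hpq : p ≤ q) {f : ℝ → ℝ} (hf : LapInt p f) : LapInt q f := by
  have h : (fun t => Real.exp (-(q * t)) * f t)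
      = fun t => Real.exp (-((q - p) * t)) * (Real.exp (-(p * t)) * f t) := by
    ext t
    rw [← mul_assoc, ← Real.exp_add]
    congr 2
    ring
  unfold LapInt
  rw [h]
  refine Integrable.mono' hf.norm (Measurable.aestronglyMeasurable (by fun_prop) |>.mul
    hf.aestronglyMeasurable) ?_
  filter_upwards [ae_restrict_mem measurableSet_Ioi] with t ht
  have ht' : (0 : ℝ) < t := ht
  rw [norm_mul, Real.norm_of_nonneg (Real.exp_nonneg _)]
  refine mul_le_of_le_one_left (norm_nonneg _) (Real.exp_le_one_iff.2 ?_)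
  have := mul_nonneg (sub_nonneg.2 hpq) ht'.le
  linarith

lemma LapInt.locallyIntegrableOn {p : ℝ} {f : ℝ → ℝ} (hf : LapInt p f) :
    LocallyIntegrableOn f (Ici 0) := by
  refine locallyIntegrableOn_Ici_iff.2 fun T => ?_
  have h1 : IntegrableOn (fun t => Real.exp (-(p * t)) * f t) (Ioc 0 T) :=
    IntegrableOn.mono_set hf Ioc_subset_Ioi_self
  have h2 : IntegrableOn (fun t => Real.exp (-(p * t)) * f t) (Icc 0 T) := by
    rwa [integrableOn_Icc_iff_integrableOn_Ioc]
  have h3 := h2.continuousOn_mul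
    (by fun_prop : ContinuousOn (fun t => Real.exp (p * t)) (Icc 0 T)) isCompact_Icc
  refine (h3.mono_set Ioc_subset_Icc_self).congr_fun (fun t _ => ?_) measurableSet_Ioc
  change Real.exp (p * t) * (Real.exp (-(p * t)) * f t) = f t
  rw [← mul_assoc, ← Real.exp_add, add_neg_cancel, Real.exp_zero, one_mul]

lemma LapInt.add {p : ℝ} {f g : ℝ → ℝ} (hf : LapInt p f) (hg : LapInt p g) : LapInt p (f + g) := by
  have := Integrable.add hf hg
  refine this.congr (Eventually.of_forall fun t => ?_)
  simp [mul_add]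

lemma LapInt.smul {p : ℝ} (c : ℝ) {f : ℝ → ℝ} (hf : LapInt p f) : LapInt p (c • f) := by
  refine (Integrable.const_mul hf c).congr (Eventually.of_forall fun t => ?_)
  simp only [Pi.smul_apply, smul_eq_mul]
  ring

lemma lap_add {p : ℝ} {f g : ℝ → ℝ} (hf : LapInt p f) (hg : LapInt p g) :
    lap p (f + g) = lap p f + lap p g := by
  rw [lap, lap, lap, ← integral_add hf hg]
  simp [mul_add]

lemma lap_smul (p c : ℝ) (f : ℝ → ℝ) : lap p (c • f) = c * lap p f := by
  rw [lap, lap, ← integral_const_mul]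
  congr 1 with t
  simp only [Pi.smul_apply, smul_eq_mul]
  ring

lemma exp_mul_vconv (p : ℝ) (f g : ℝ → ℝ) (t : ℝ) :
    Real.exp (-(p * t)) * vconv f g t = ∫ τ in (0 : ℝ)..t, ContinuousLinearMap.mul ℝ ℝ
      (Real.exp (-(p * τ)) * g τ) (Real.exp (-(p * (t - τ))) * f (t - τ)) := by
  rw [vconv, ← intervalIntegral.integral_const_mul]
  congr 1 with τ
  have : Real.exp (-(p * t)) = Real.exp (-(p * τ)) * Real.exp (-(p * (t - τ))) := by
    rw [← Real.exp_add]
    congr 1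
    ring
  rw [this, ContinuousLinearMap.mul_apply']
  ring

lemma LapInt.vconv {p : ℝ} {f g : ℝ → ℝ} (hf : LapInt p f) (hg : LapInt p g) :
    LapInt p (vconv f g) := by
  have h := (integrable_posConvolution hg hf (ContinuousLinearMap.mul ℝ ℝ)).integrableOn
    (s := Ioi 0)
  refine h.congr_fun (fun t ht => ?_) measurableSet_Ioi
  rw [posConvolution, indicator_of_mem ht]
  exact (exp_mul_vconv p f g t).symm

lemma lap_vconv {p : ℝ} {f g : ℝ → ℝ} (hf : LapInt p f) (hg : LapInt p g) :
    lap p (vconv f g) = lap p f * lap p g := by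
  have h := integral_posConvolution hg hf (ContinuousLinearMap.mul ℝ ℝ)
  rw [lap]
  simp only [exp_mul_vconv]
  rw [h, ContinuousLinearMap.mul_apply', mul_comm]
  rfl

lemma lapInt_one {p : ℝ} (hp : 0 < p) : LapInt p (fun _ => 1) := by
  have := integrableOn_exp_mul_Ioi (a := -p) (by linarith) 0
  refine this.congr_fun (fun t _ => ?_) measurableSet_Ioi
  simp

lemma lap_one {p : ℝ} (hp : 0 < p) : lap p (fun _ => 1) = 1 / p := by
  have := integral_exp_mul_Ioi (a := -p) (by linarith) 0
  simp only [mul_zero, Real.exp_zero, neg_mul] at this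
  simp only [lap, mul_one, this]
  rw [neg_div_neg_eq]

/-- Weierstrass approximation in u = e⁻ᵗ on [0, 1]: the moment conditions say that h annihilates all
polynomials in u. -/
lemma integral_mul_comp_exp_neg_eq_zero {h : ℝ → ℝ} (hh : IntegrableOn h (Ioi 0))
    (h0 : ∀ n : ℕ, ∫ t in Ioi 0, Real.exp (-t) ^ n * h t = 0) {φ : ℝ → ℝ}
    (hφ : ContinuousOn φ (Icc 0 1)) (hi : IntegrableOn (fun t => φ (Real.exp (-t)) * h t) (Ioi 0)) :
    ∫ t in Ioi 0, φ (Real.exp (-t)) * h t = 0 := by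
  have hmem : ∀ t ∈ Ioi (0 : ℝ), Real.exp (-t) ∈ Icc (0 : ℝ) 1 := fun t ht =>
    ⟨Real.exp_nonneg _, Real.exp_le_one_iff.2 (by linarith [mem_Ioi.1 ht])⟩
  have hpow : ∀ n : ℕ, IntegrableOn (fun t => Real.exp (-t) ^ n * h t) (Ioi 0) := fun n => by
    refine Integrable.mono' hh.norm (Measurable.aestronglyMeasurable (by fun_prop) |>.mul
      hh.aestronglyMeasurable) ?_
    filter_upwards [ae_restrict_mem measurableSet_Ioi] with t ht
    rw [norm_mul, norm_pow, Real.norm_of_nonneg (Real.exp_nonneg _)]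
    exact mul_le_of_le_one_left (norm_nonneg _) (pow_le_one₀ (hmem t ht).1 (hmem t ht).2)
  have hpoly : ∀ P : Polynomial ℝ,
      IntegrableOn (fun t => P.eval (Real.exp (-t)) * h t) (Ioi 0) ∧
      ∫ t in Ioi 0, P.eval (Real.exp (-t)) * h t = 0 := fun P => by
    have e : (fun t => P.eval (Real.exp (-t)) * h t) = fun t =>
        ∑ i ∈ Finset.range (P.natDegree + 1), P.coeff i * (Real.exp (-t) ^ i * h t) := by
      ext t
      rw [Polynomial.eval_eq_sum_range, Finset.sum_mul]
      exact Finset.sum_congr rfl fun i _ => by ring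
    rw [e]
    have hi : ∀ i ∈ Finset.range (P.natDegree + 1),
        Integrable (fun t => P.coeff i * (Real.exp (-t) ^ i * h t)) (volume.restrict (Ioi 0)) :=
      fun i _ => (hpow i).const_mul _
    refine ⟨integrable_finsetSum _ hi, ?_⟩
    rw [integral_finsetSum _ hi]
    refine Finset.sum_eq_zero fun i _ => ?_
    rw [integral_const_mul, h0, mul_zero]
  set I := ∫ t in Ioi 0, ‖h t‖
  have hI : 0 ≤ I := integral_nonneg fun _ => norm_nonneg _
  refine abs_eq_zero.1 (le_antisymm (le_of_forall_pos_le_add fun ε hε => ?_) (abs_nonneg _))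
  obtain ⟨P, hP⟩ := exists_polynomial_near_of_continuousOn 0 1 φ hφ (ε / (I + 1)) (by positivity)
  have h1 : ∫ t in Ioi 0, φ (Real.exp (-t)) * h t
      = ∫ t in Ioi 0, (φ (Real.exp (-t)) * h t - P.eval (Real.exp (-t)) * h t) := by
    rw [integral_sub hi (hpoly P).1, (hpoly P).2, sub_zero]
  rw [h1]
  have h2 : ‖∫ t in Ioi 0, (φ (Real.exp (-t)) * h t - P.eval (Real.exp (-t)) * h t)‖
      ≤ ∫ t in Ioi 0, ε / (I + 1) * ‖h t‖ := by
    refine norm_integral_le_of_norm_le (hh.norm.const_mul _) ?_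
    filter_upwards [ae_restrict_mem measurableSet_Ioi] with t ht
    rw [← sub_mul, norm_mul, ← norm_neg, neg_sub]
    gcongr
    exact (hP _ (hmem t ht)).le
  refine h2.trans ?_
  rw [integral_const_mul, zero_add, div_mul_eq_mul_div, div_le_iff₀ (by positivity)]
  nlinarith

lemma ae_eq_zero_of_exp_moments {h : ℝ → ℝ} (hh : IntegrableOn h (Ioi 0))
    (h0 : ∀ n : ℕ, ∫ t in Ioi 0, Real.exp (-t) ^ n * h t = 0) :
    ∀ᵐ t ∂(volume.restrict (Ioi (0 : ℝ))), h t = 0 := by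
  rw [ae_restrict_iff' measurableSet_Ioi]
  refine isOpen_Ioi.ae_eq_zero_of_integral_contDiff_smul_eq_zero hh.locallyIntegrableOn
    fun g hg hgc hgs => ?_
  have hgcont : Continuous g := hg.continuous
  have hg0 : ∀ x ≤ 0, g x = 0 := fun x hx => by
    by_contra hne
    exact absurd (hgs (subset_tsupport g hne)) (not_lt.2 hx)
  obtain ⟨R, hR⟩ := hgc.isCompact.bddAbove
  have hgR : ∀ x, R < x → g x = 0 := fun x hx => by
    by_contra hne
    exact absurd (hR (subset_tsupport g hne)) (not_le.2 hx)
  obtain ⟨B, hB⟩ := hgc.exists_bound_of_continuous hgcont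
  -- Since g vanishes for large t, φ vanishes near u = 0, so the logarithm does no harm to
  -- continuity there.
  set φ : ℝ → ℝ := fun u => g (-Real.log u)
  have hφe : ∀ t, φ (Real.exp (-t)) = g t := fun t => by simp [φ]
  have hφ : ContinuousOn φ (Icc 0 1) := by
    intro u hu
    rcases hu.1.eq_or_lt with h | h
    · subst h
      have : φ =ᶠ[𝓝[Icc 0 1] 0] fun _ => 0 := by
        have h1 : ∀ᶠ u in 𝓝 (0 : ℝ), u < Real.exp (-R) := gt_mem_nhds (Real.exp_pos _)
        filter_upwards [nhdsWithin_le_nhds h1, self_mem_nhdsWithin] with u hu hu'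
        rcases hu'.1.eq_or_lt with h | h
        · simp [φ, ← h, hg0 0 le_rfl]
        · refine hgR _ ?_
          have := (Real.log_lt_iff_lt_exp h).2 hu
          linarith
      refine ContinuousWithinAt.congr_of_eventuallyEq continuousWithinAt_const this ?_
      simp [φ, hg0 0 le_rfl]
    · exact (hgcont.continuousAt.comp (Real.continuousAt_log h.ne').neg).continuousWithinAt
  have hi : IntegrableOn (fun t => φ (Real.exp (-t)) * h t) (Ioi 0) := by
    simp only [hφe]
    exact Integrable.bdd_mul hh hgcont.aestronglyMeasurable (Eventually.of_forall hB)
  have key := integral_mul_comp_exp_neg_eq_zero hh h0 hφ hi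
  simp only [hφe] at key
  rw [← key]
  simp only [smul_eq_mul]
  exact (setIntegral_eq_integral_of_forall_compl_eq_zero fun x hx => by
    rw [hg0 x (not_lt.1 hx), zero_mul]).symm

/-- **Lerch's theorem**: the Laplace transform is injective. -/
theorem ae_eq_zero_of_lap_eq_zero {p₀ : ℝ} {f : ℝ → ℝ} (hf : LapInt p₀ f)
    (h : ∀ p, p₀ ≤ p → lap p f = 0) : f =ᵐ[volume.restrict (Ici 0)] 0 := by
  -- The values of the transform at p₀ + n are the moments of e^(-p₀ t) f(t) in the variable e⁻ᵗ.
  have h1 := ae_eq_zero_of_exp_moments hf fun n => by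
    refine Eq.trans ?_ (h (p₀ + n) (by simp))
    refine integral_congr_ae (Eventually.of_forall fun t => ?_)
    simp only
    rw [← Real.exp_nat_mul, ← mul_assoc, ← Real.exp_add]
    congr 2
    ring
  rw [← restrict_Ioi_eq_restrict_Ici]
  filter_upwards [h1] with t ht
  exact (mul_eq_zero.1 ht).resolve_left (Real.exp_pos _).ne'

theorem vol_eq_of_lap_eq {p₀ : ℝ} {f g : ℝ → ℝ} (hf : LapInt p₀ f) (hg : LapInt p₀ g)
    (h : ∀ p, p₀ ≤ p → lap p f = lap p g) : vol f = vol g := by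
  rw [vol_eq_iff hf.locallyIntegrableOn hg.locallyIntegrableOn]
  have := ae_eq_zero_of_lap_eq_zero (hf.add (hg.smul (-1))) fun p hp => by
    rw [lap_add (hf.mono hp) ((hg.smul _).mono hp), lap_smul, h p hp]
    ring
  filter_upwards [this] with t ht
  simp only [Pi.add_apply, Pi.smul_apply, smul_eq_mul, Pi.zero_apply] at ht
  linarith

/-! ### Measures of exponential and fractional type -/

/-- `kap` integrates `(1 + |s|)⁻¹` and is carried by `[a, ∞)`. -/
structure ExpClass (a : ℝ) (kap : Measure ℝ) : Prop where
  integrable : Integrable (fun s : ℝ => (1 + |s|)⁻¹) kap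
  ae_le : ∀ᵐ s ∂kap, a ≤ s

lemma MemMPlus.integrable_one_add_abs_inv {kap : Measure ℝ} (h : MemMPlus 1 kap) :
    Integrable (fun s : ℝ => (1 + |s|)⁻¹) kap := by
  have h1 : Integrable (fun s : ℝ => (1 + s ^ 2) ^ (-(1 : ℝ) / 2)) kap := by
    rw [← lintegral_ofReal_ne_top_iff_integrable]
    · exact h.ne
    · exact (by fun_prop : Measurable fun s : ℝ => (1 + s ^ 2) ^ (-(1 : ℝ) / 2)).aestronglyMeasurable
    · exact Eventually.of_forall fun s => by positivity
  refine h1.mono (by fun_prop : Measurable fun s : ℝ => (1 + |s|)⁻¹).aestronglyMeasurable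
    (Eventually.of_forall fun s => ?_)
  rw [Real.norm_of_nonneg (by positivity), Real.norm_of_nonneg (by positivity),
    show (-(1 : ℝ) / 2) = -(1 / 2) by norm_num, Real.rpow_neg (by positivity), ← Real.sqrt_eq_rpow]
  gcongr
  rw [Real.sqrt_le_left (by positivity)]
  nlinarith [abs_nonneg s, sq_abs s]

lemma ExpClass.memMPlus_two {a : ℝ} {kap : Measure ℝ} (h : ExpClass a kap) : MemMPlus 2 kap := by
  rw [memMPlus_two_iff]
  refine (h.integrable.const_mul 2).mono
    (by fun_prop : Measurable fun s : ℝ => (1 + s ^ 2)⁻¹).aestronglyMeasurable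
    (Eventually.of_forall fun s => ?_)
  rw [Real.norm_of_nonneg (by positivity), Real.norm_of_nonneg (by positivity),
    ← div_eq_mul_inv, inv_eq_one_div, div_le_div_iff₀ (by positivity) (by positivity)]
  nlinarith [sq_nonneg (|s| - 1), sq_abs s]

lemma MemMExp.exists_ae_le {n : ℝ} {kap : Measure ℝ} (h : MemMExp n kap) :
    ∃ a, ∀ᵐ s ∂kap, a ≤ s := by
  obtain ⟨a, ha⟩ := h.2
  exact ⟨a, by filter_upwards [Measure.support_mem_ae] with s hs using ha hs⟩

lemma MemMExp.exists_expClass {kap : Measure ℝ} (h : MemMExp 1 kap) : ∃ a, ExpClass a kap := by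
  obtain ⟨a, ha⟩ := h.exists_ae_le
  exact ⟨a, h.1.integrable_one_add_abs_inv, ha⟩

lemma ExpClass.one_add_abs_le {a p s : ℝ} (hp : |a| + 1 ≤ p) (hs : a ≤ s) :
    0 < p + s ∧ (p + s)⁻¹ ≤ (1 + |a|) * (1 + |s|)⁻¹ := by
  have h1 := neg_abs_le a
  have h2 := abs_nonneg a
  have h0 : 0 < p + s := by linarith
  refine ⟨h0, ?_⟩
  rw [← div_eq_mul_inv, inv_eq_one_div, div_le_div_iff₀ h0 (by positivity)]
  rcases abs_cases s with ⟨h, h'⟩ | ⟨h, h'⟩ <;> rw [h] <;> nlinarith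

lemma ExpClass.integrable_inv_add {a : ℝ} {kap : Measure ℝ} (h : ExpClass a kap) {p : ℝ}
    (hp : |a| + 1 ≤ p) : Integrable (fun s => (p + s)⁻¹) kap := by
  refine (h.integrable.const_mul (1 + |a|)).mono'
    (by fun_prop : Measurable fun s : ℝ => (p + s)⁻¹).aestronglyMeasurable ?_
  filter_upwards [h.ae_le] with s hs
  obtain ⟨h1, h2⟩ := ExpClass.one_add_abs_le hp hs
  rwa [Real.norm_of_nonneg (inv_nonneg.2 h1.le)]

/-- Integrating in t first gives 1/(p + s), which the weight (1 + |s|)⁻¹ controls for p ≥ |a| + 1.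
This is the Fubini input for `ExpClass.lapInt` and `ExpClass.lap_eq`. -/
lemma ExpClass.integrable_prod {a : ℝ} {kap : Measure ℝ} (h : ExpClass a kap) {p : ℝ}
    (hp : |a| + 1 ≤ p) :
    Integrable (Function.uncurry fun t s : ℝ => Real.exp (-(p * t)) * Real.exp (-(t * s)))
      ((volume.restrict (Ioi 0)).prod kap) := by
  have := h.memMPlus_two.isLocallyFiniteMeasure
  have e : ∀ t s : ℝ, Real.exp (-(p * t)) * Real.exp (-(t * s)) = Real.exp (-(p + s) * t) := by
    intro t s
    rw [← Real.exp_add]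
    congr 1
    ring
  have hm : AEStronglyMeasurable
      (Function.uncurry fun t s : ℝ => Real.exp (-(p * t)) * Real.exp (-(t * s)))
      ((volume.restrict (Ioi 0)).prod kap) :=
    Measurable.aestronglyMeasurable (by unfold Function.uncurry; fun_prop)
  rw [integrable_prod_iff' hm]
  simp only [Function.uncurry, e, Real.norm_of_nonneg (Real.exp_nonneg _)]
  refine ⟨?_, ?_⟩
  · filter_upwards [h.ae_le] with s hs
    have := (ExpClass.one_add_abs_le hp hs).1
    exact integrableOn_exp_mul_Ioi (by linarith) 0
  · refine (h.integrable_inv_add hp).congr ?_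
    filter_upwards [h.ae_le] with s hs
    have := (ExpClass.one_add_abs_le hp hs).1
    rw [integral_exp_mul_Ioi (by linarith) 0]
    rw [mul_zero, Real.exp_zero, neg_div_neg_eq, one_div]

lemma ExpClass.lapInt {a : ℝ} {kap : Measure ℝ} (h : ExpClass a kap) {p : ℝ}
    (hp : |a| + 1 ≤ p) : LapInt p (laplaceB kap) := by
  have := h.memMPlus_two.isLocallyFiniteMeasure
  refine (h.integrable_prod hp).integral_prod_left.congr (Eventually.of_forall fun t => ?_)
  simp only [Function.uncurry, laplaceB, integral_const_mul]

lemma ExpClass.lap_eq {a : ℝ} {kap : Measure ℝ} (h : ExpClass a kap) {p : ℝ}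
    (hp : |a| + 1 ≤ p) : lap p (laplaceB kap) = ∫ s, (p + s)⁻¹ ∂kap := by
  have := h.memMPlus_two.isLocallyFiniteMeasure
  have h1 := integral_integral_swap (h.integrable_prod hp)
  have h2 : lap p (laplaceB kap)
      = ∫ t in Ioi 0, ∫ s, Real.exp (-(p * t)) * Real.exp (-(t * s)) ∂kap := by
    simp only [lap, laplaceB, integral_const_mul]
  rw [h2, h1]
  refine integral_congr_ae ?_
  filter_upwards [h.ae_le] with s hs
  have h0 := (ExpClass.one_add_abs_le hp hs).1
  have h3 := integral_exp_mul_Ioi (a := -(p + s)) (by linarith) 0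
  simp only [mul_zero, Real.exp_zero, neg_div_neg_eq, one_div] at h3
  rw [← h3]
  congr 1 with t
  rw [← Real.exp_add]
  congr 1
  ring

lemma ExpClass.locallyIntegrableOn {a : ℝ} {kap : Measure ℝ} (h : ExpClass a kap) :
    LocallyIntegrableOn (laplaceB kap) (Ici 0) :=
  (h.lapInt le_rfl).locallyIntegrableOn

/-- The density of `invMeasure` at 0 is ∞, so an atom of `lam` there would contradict local
finiteness. -/
lemma MemMFrac.ae_pos {lam : Measure ℝ} (h : MemMFrac lam) : ∀ᵐ s ∂lam, 0 < s := by
  have hlf := h.2.2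
  have h1 : ∀ᵐ s ∂lam, 0 ≤ s := by
    filter_upwards [Measure.support_mem_ae] with s hs using h.2.1 hs
  have h2 : invMeasure lam {0} < ⊤ := isCompact_singleton.measure_lt_top
  have h3 : lam {0} = 0 := by
    by_contra hne
    rw [invMeasure, withDensity_apply _ (measurableSet_singleton 0), Measure.restrict_singleton,
      lintegral_smul_measure, lintegral_dirac] at h2
    simp only [ENNReal.ofReal_zero, ENNReal.inv_zero, smul_eq_mul] at h2
    rw [ENNReal.mul_top hne] at h2
    exact lt_irrefl _ h2
  have h4 : ∀ᵐ s ∂lam, s ≠ 0 := by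
    rw [ae_iff]
    simpa using h3
  filter_upwards [h1, h4] with s hs hs' using lt_of_le_of_ne hs (Ne.symm hs')

lemma integrable_invMeasure_iff {lam : Measure ℝ} (h : ∀ᵐ s ∂lam, 0 < s) {g : ℝ → ℝ} :
    Integrable g (invMeasure lam) ↔ Integrable (fun s => s⁻¹ * g s) lam := by
  rw [invMeasure, integrable_withDensity_iff_integrable_smul' (by fun_prop)]
  · refine integrable_congr ?_
    filter_upwards [h] with s hs
    rw [ENNReal.toReal_inv, ENNReal.toReal_ofReal hs.le, smul_eq_mul]
  · filter_upwards [h] with s hs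
    simpa using hs

lemma integral_invMeasure {lam : Measure ℝ} (h : ∀ᵐ s ∂lam, 0 < s) (g : ℝ → ℝ) :
    ∫ s, g s ∂(invMeasure lam) = ∫ s, s⁻¹ * g s ∂lam := by
  rw [invMeasure, integral_withDensity_eq_integral_toReal_smul (by fun_prop)]
  · refine integral_congr_ae ?_
    filter_upwards [h] with s hs
    rw [ENNReal.toReal_inv, ENNReal.toReal_ofReal hs.le, smul_eq_mul]
  · filter_upwards [h] with s hs
    simpa using hs

lemma ae_invMeasure {lam : Measure ℝ} {p : ℝ → Prop} (h : ∀ᵐ s ∂lam, p s) :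
    ∀ᵐ s ∂(invMeasure lam), p s :=
  (withDensity_absolutelyContinuous _ _).ae_le h

/-- On [0, 1] local finiteness suffices; beyond 1 the factor s⁻¹ improves order two to order one. So
K₂ and J₂ can be treated like K₁ and J₁. -/
lemma MemMFrac.expClass {lam : Measure ℝ} (h : MemMFrac lam) : ExpClass 0 (invMeasure lam) := by
  have hlf := h.2.2
  have hpos := h.ae_pos
  refine ⟨?_, ae_invMeasure (hpos.mono fun s hs => hs.le)⟩
  have hm : Measurable fun s : ℝ => (1 + |s|)⁻¹ := by fun_prop
  have h1 : IntegrableOn (fun s : ℝ => (1 + |s|)⁻¹) (Icc 0 1) (invMeasure lam) := by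
    have hf : invMeasure lam (Icc 0 1) < ⊤ := isCompact_Icc.measure_lt_top
    have : IsFiniteMeasure ((invMeasure lam).restrict (Icc 0 1)) := ⟨by simpa using hf⟩
    refine Integrable.of_bound hm.aestronglyMeasurable 1 (Eventually.of_forall fun s => ?_)
    rw [Real.norm_of_nonneg (by positivity)]
    exact inv_le_one_of_one_le₀ (by linarith [abs_nonneg s])
  have h2 : IntegrableOn (fun s : ℝ => (1 + |s|)⁻¹) (Ioi 1) (invMeasure lam) := by
    have e : (invMeasure lam).restrict (Ioi 1) = invMeasure (lam.restrict (Ioi 1)) := by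
      rw [invMeasure, invMeasure, restrict_withDensity measurableSet_Ioi]
    rw [IntegrableOn, e, integrable_invMeasure_iff (ae_restrict_of_ae hpos)]
    refine ((memMPlus_two_iff.1 h.1.1).integrableOn (s := Ioi 1) |>.const_mul 2).mono'
      (by fun_prop : Measurable fun s : ℝ => s⁻¹ * (1 + |s|)⁻¹).aestronglyMeasurable ?_
    filter_upwards [ae_restrict_mem measurableSet_Ioi] with s hs
    have hs1 : (1 : ℝ) < s := hs
    rw [abs_of_pos (by linarith), Real.norm_of_nonneg (by positivity), ← mul_inv, ← div_eq_mul_inv,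
      inv_eq_one_div, div_le_div_iff₀ (by positivity) (by positivity)]
    nlinarith
  have h3 := h1.union h2
  rwa [IntegrableOn, Measure.restrict_eq_self_of_ae_mem] at h3
  refine ae_invMeasure (hpos.mono fun s hs => ?_)
  rcases le_or_gt s 1 with h | h
  · exact Or.inl ⟨hs.le, h⟩
  · exact Or.inr h

end Laplace

section Duality

open Filter Topology

/-! ### Dual pairs of Pick functions -/

/-- On the imaginary axis |N| ≥ Im N ≥ c₁ y, so the reciprocal decays at least like 1/y. -/
lemma norm_pick_le {lam mu : Measure ℝ} (hlam : MemMPlus 2 lam) {c₀ c₁ ζ₀ ζ₁ : ℝ} (hc₁ : 0 < c₁)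
    (hmul : ∀ z : ℂ, 0 < z.im → pick lam c₀ c₁ z * pick mu ζ₀ ζ₁ z = -(Real.pi : ℂ) ^ 2) {y : ℝ}
    (hy : 0 < y) : ‖pick mu ζ₀ ζ₁ ⟨0, y⟩‖ ≤ Real.pi ^ 2 / c₁ / y := by
  have h1 : c₁ * y ≤ ‖pick lam c₀ c₁ ⟨0, y⟩‖ :=
    (mul_im_le_pick_im hlam c₀ c₁ (z := ⟨0, y⟩) hy).trans
      ((le_abs_self _).trans (Complex.abs_im_le_norm _))
  have h2 := congrArg norm (hmul ⟨0, y⟩ hy)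
  rw [norm_mul, norm_neg, norm_pow, Complex.norm_real, Real.norm_of_nonneg Real.pi_pos.le] at h2
  rw [div_div, le_div_iff₀ (by positivity), ← h2, mul_comm]
  gcongr

lemma eq_zero_of_forall_abs_le_div {x C : ℝ} (h : ∀ y, 0 < y → |x| ≤ C / y) : x = 0 := by
  by_contra hx
  have h0 : 0 < |x| := abs_pos.2 hx
  have hC : 0 < C := by simpa using h0.trans_le (h 1 one_pos)
  have := h (2 * C / |x|) (by positivity)
  rw [div_div_eq_mul_div, mul_comm 2 C, mul_div_mul_left _ _ hC.ne'] at this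
  linarith

/-- If one of two reciprocal Pick functions has a linear term, then the other is the Stieltjes
transform of a finite measure. -/
lemma finite_of_pick_mul_eq {lam mu : Measure ℝ} (hlam : MemMPlus 2 lam) (hmu : MemMPlus 2 mu)
    {c₀ c₁ ζ₀ ζ₁ : ℝ} (hc₁ : 0 < c₁) (hζ₁ : 0 ≤ ζ₁)
    (hmul : ∀ z : ℂ, 0 < z.im → pick lam c₀ c₁ z * pick mu ζ₀ ζ₁ z = -(Real.pi : ℂ) ^ 2) :
    ζ₁ = 0 ∧ IsFiniteMeasure mu ∧ ζ₀ = ∫ s, s / (1 + s ^ 2) ∂mu := by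
  set C := Real.pi ^ 2 / c₁
  have hC : 0 < C := by positivity
  have hnorm : ∀ y : ℝ, 0 < y → ‖pick mu ζ₀ ζ₁ ⟨0, y⟩‖ ≤ C / y := fun y hy =>
    norm_pick_le hlam hc₁ hmul hy
  have him : ∀ y : ℝ, 0 < y → ζ₁ * y + ∫ s, y / (s ^ 2 + y ^ 2) ∂mu ≤ C / y := fun y hy => by
    have h1 := pick_im hmu ζ₀ ζ₁ (z := ⟨0, y⟩) hy
    simp only [sub_zero] at h1
    rw [← h1]
    exact (le_abs_self _).trans ((Complex.abs_im_le_norm _).trans (hnorm y hy))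
  have hpos : ∀ y : ℝ, 0 < y → 0 ≤ ∫ s, y / (s ^ 2 + y ^ 2) ∂mu := fun y hy =>
    integral_nonneg fun s => by positivity
  have hζ : ζ₁ = 0 := by
    refine eq_zero_of_forall_abs_le_div (C := 1 + C) fun y hy => ?_
    rw [abs_of_nonneg hζ₁, le_div_iff₀ hy]
    rcases le_or_gt 1 y with h | h
    · have h1 : ζ₁ * y ≤ C / y := by linarith [him y hy, hpos y hy]
      have h2 : C / y ≤ C := div_le_self hC.le h
      linarith
    · have h1 : ζ₁ * 1 ≤ C / 1 := by linarith [him 1 one_pos, hpos 1 one_pos]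
      have h2 : ζ₁ * y ≤ ζ₁ * 1 := by gcongr
      simp only [mul_one, div_one] at h1 h2
      linarith
  -- On [-y, y] the Poisson kernel at height y is at least 1/(2y), while its integral is at most
  -- C/y.
  have hball : ∀ n : ℕ, mu (Icc (-((n : ℝ) + 1)) (n + 1)) ≤ ENNReal.ofReal (2 * C) := fun n => by
    set y : ℝ := (n : ℝ) + 1
    have hy : 0 < y := by positivity
    have hlf := hmu.isLocallyFiniteMeasure
    have hfin : mu (Icc (-y) y) < ⊤ := isCompact_Icc.measure_lt_top
    have hint : Integrable (fun s => y / (s ^ 2 + y ^ 2)) mu := by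
      simpa using integrable_poisson hmu (z := ⟨0, y⟩) hy
    have h1 : mu.real (Icc (-y) y) * (1 / (2 * y)) ≤ ∫ s, y / (s ^ 2 + y ^ 2) ∂mu := by
      have : ∫ s in Icc (-y) y, 1 / (2 * y) ∂mu ≤ ∫ s in Icc (-y) y, y / (s ^ 2 + y ^ 2) ∂mu := by
        refine setIntegral_mono_on (integrableOn_const hfin.ne) hint.integrableOn measurableSet_Icc
          fun s hs => ?_
        have : s ^ 2 ≤ y ^ 2 := sq_le_sq' hs.1 hs.2
        rw [div_le_div_iff₀ (by positivity) (by positivity)]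
        nlinarith
      rw [setIntegral_const, smul_eq_mul] at this
      exact this.trans (setIntegral_le_integral hint (Eventually.of_forall fun s => by positivity))
    have h2 : mu.real (Icc (-y) y) * (1 / (2 * y)) ≤ C / y := by
      have := him y hy
      rw [hζ, zero_mul, zero_add] at this
      exact h1.trans this
    have h3 : mu.real (Icc (-y) y) ≤ 2 * C := by
      rw [mul_one_div, div_le_div_iff₀ (by positivity) hy] at h2
      nlinarith
    rw [measureReal_def] at h3
    exact (ENNReal.le_ofReal_iff_toReal_le hfin.ne (by positivity)).2 h3
  have hfin : IsFiniteMeasure mu := by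
    refine ⟨lt_of_le_of_lt ?_ (ENNReal.ofReal_lt_top (r := 2 * C))⟩
    have hU : (univ : Set ℝ) = ⋃ n : ℕ, Icc (-((n : ℝ) + 1)) (n + 1) := by
      symm
      rw [eq_univ_iff_forall]
      intro x
      obtain ⟨n, hn⟩ := exists_nat_ge |x|
      have := abs_le.1 hn
      exact mem_iUnion.2 ⟨n, by linarith, by linarith⟩
    have hmono : Monotone fun n : ℕ => Icc (-((n : ℝ) + 1)) (n + 1) := fun m n hmn => by
      have : (m : ℝ) ≤ n := by exact_mod_cast hmn
      exact Icc_subset_Icc (by linarith) (by linarith)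
    rw [hU, hmono.measure_iUnion]
    exact iSup_le hball
  refine ⟨hζ, hfin, sub_eq_zero.1 (eq_zero_of_forall_abs_le_div (C := C + mu.real univ)
    fun y hy => ?_)⟩
  have hi2 : Integrable (fun s : ℝ => (s : ℂ) / (1 + (s : ℂ) ^ 2)) mu := by
    refine Integrable.of_bound (by fun_prop : Measurable fun s : ℝ =>
      (s : ℂ) / (1 + (s : ℂ) ^ 2)).aestronglyMeasurable 1 (Eventually.of_forall fun s => ?_)
    have : (s : ℂ) / (1 + (s : ℂ) ^ 2) = ((s / (1 + s ^ 2) : ℝ) : ℂ) := by push_cast; rfl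
    rw [this, Complex.norm_real, Real.norm_eq_abs, abs_div, abs_of_pos (by positivity : 0 < 1 + s ^ 2),
      div_le_one (by positivity)]
    nlinarith [sq_nonneg (|s| - 1), sq_abs s]
  have hbd : ∀ s : ℝ, ‖1 / ((s : ℂ) - ⟨0, y⟩)‖ ≤ 1 / y := fun s => by
    rw [norm_div, norm_one]
    have := im_le_norm_ofReal_sub ⟨0, y⟩ s
    gcongr
  have hi1 : Integrable (fun s : ℝ => 1 / ((s : ℂ) - ⟨0, y⟩)) mu :=
    Integrable.of_bound (by fun_prop : Measurable fun s : ℝ =>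
      1 / ((s : ℂ) - ⟨0, y⟩)).aestronglyMeasurable (1 / y) (Eventually.of_forall hbd)
  -- The constant is a difference of two quantities of size O(1/y), hence zero.
  have e : ((ζ₀ - ∫ s, s / (1 + s ^ 2) ∂mu : ℝ) : ℂ)
      = pick mu ζ₀ ζ₁ ⟨0, y⟩ - ∫ s : ℝ, 1 / ((s : ℂ) - ⟨0, y⟩) ∂mu := by
    simp only [pick, cauchyKer]
    rw [integral_sub hi1 hi2, hζ]
    have : ∫ s : ℝ, (s : ℂ) / (1 + (s : ℂ) ^ 2) ∂mu = ((∫ s, s / (1 + s ^ 2) ∂mu : ℝ) : ℂ) := by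
      rw [← integral_complex_ofReal]
      push_cast
      rfl
    rw [this]
    push_cast
    ring
  have h1 : ‖∫ s : ℝ, 1 / ((s : ℂ) - ⟨0, y⟩) ∂mu‖ ≤ 1 / y * mu.real univ :=
    norm_integral_le_of_norm_le_const (Eventually.of_forall hbd)
  have h2 := congrArg norm e
  rw [Complex.norm_real, Real.norm_eq_abs] at h2
  rw [h2]
  refine (norm_sub_le _ _).trans ((add_le_add (hnorm y hy) h1).trans (le_of_eq ?_))
  ring

/-- Both functions are continuous at real points to the left of both supports, so the relation
passes to the limit from above. -/
lemma pick_mul_eq_of_real {lam mu : Measure ℝ} (hlam : MemMPlus 2 lam) (hmu : MemMPlus 2 mu)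
    {c₀ c₁ ζ₀ ζ₁ a b : ℝ} (ha : ∀ᵐ s ∂lam, a ≤ s) (hb : ∀ᵐ s ∂mu, b ≤ s)
    (hmul : ∀ z : ℂ, 0 < z.im → pick lam c₀ c₁ z * pick mu ζ₀ ζ₁ z = -(Real.pi : ℂ) ^ 2) {x : ℝ}
    (hxa : x < a) (hxb : x < b) :
    pick lam c₀ c₁ x * pick mu ζ₀ ζ₁ x = -(Real.pi : ℂ) ^ 2 := by
  have h1 : ContinuousAt (fun z => pick lam c₀ c₁ z * pick mu ζ₀ ζ₁ z) (x : ℂ) :=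
    (continuousAt_pick hlam c₀ c₁ ha (by simpa)).mul (continuousAt_pick hmu ζ₀ ζ₁ hb (by simpa))
  have h2 : Tendsto (fun y : ℝ => (x : ℂ) + y * Complex.I) (𝓝[>] 0) (𝓝 (x : ℂ)) := by
    have : Continuous fun y : ℝ => (x : ℂ) + y * Complex.I := by fun_prop
    simpa using (this.tendsto 0).mono_left (nhdsWithin_le_nhds (s := Ioi 0))
  have h3 := h1.tendsto.comp h2
  refine tendsto_nhds_unique (h3.congr' ?_) tendsto_const_nhds
  filter_upwards [self_mem_nhdsWithin] with y hy
  exact hmul _ (by simpa using hy)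

/-- The kernel of the Volterra operator in integrated form, without its Dirac part. -/
noncomputable def volterraKer (c₀ : ℝ) (lam₁ lam₂ : Measure ℝ) : ℝ → ℝ :=
  (-c₀) • (fun _ => 1) + ((-1 : ℝ) • vconv (fun _ => 1) (laplaceB lam₁)
    + laplaceB (invMeasure lam₂))

lemma lapInt_volterraKer {a : ℝ} {lam₁ lam₂ : Measure ℝ} (h₁ : ExpClass a lam₁)
    (h₂ : MemMFrac lam₂) (c₀ : ℝ) {p : ℝ} (hp : |a| + 1 ≤ p) :
    LapInt p (volterraKer c₀ lam₁ lam₂) := by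
  have hp0 : 0 < p := by linarith [abs_nonneg a]
  have hp1 : |(0 : ℝ)| + 1 ≤ p := by rw [abs_zero]; linarith [abs_nonneg a]
  exact ((lapInt_one hp0).smul _).add
    ((((lapInt_one hp0).vconv (h₁.lapInt hp)).smul _).add (h₂.expClass.lapInt hp1))

lemma lap_volterraKer {a : ℝ} {lam₁ lam₂ : Measure ℝ} (h₁ : ExpClass a lam₁)
    (h₂ : MemMFrac lam₂) (c₀ : ℝ) {p : ℝ} (hp : |a| + 1 ≤ p) :
    lap p (volterraKer c₀ lam₁ lam₂) = -c₀ / p - (1 / p) * (∫ s, (p + s)⁻¹ ∂lam₁)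
      + ∫ s, s⁻¹ * (p + s)⁻¹ ∂lam₂ := by
  have hp0 : 0 < p := by linarith [abs_nonneg a]
  have hp1 : |(0 : ℝ)| + 1 ≤ p := by rw [abs_zero]; linarith [abs_nonneg a]
  have i1 := (lapInt_one hp0).smul (-c₀)
  have i2 := ((lapInt_one hp0).vconv (h₁.lapInt hp)).smul (-1)
  have i3 := h₂.expClass.lapInt hp1
  rw [volterraKer, lap_add i1 (i2.add i3), lap_add i2 i3, lap_smul, lap_smul,
    lap_vconv (lapInt_one hp0) (h₁.lapInt hp), lap_one hp0, h₁.lap_eq hp, h₂.expClass.lap_eq hp1,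
    integral_invMeasure h₂.ae_pos]
  ring

lemma integrable_div_one_add_sq {a : ℝ} {lam : Measure ℝ} (h : ExpClass a lam) :
    Integrable (fun s => s / (1 + s ^ 2)) lam := by
  refine (h.integrable.const_mul 2).mono
    (by fun_prop : Measurable fun s : ℝ => s / (1 + s ^ 2)).aestronglyMeasurable
    (Eventually.of_forall fun s => ?_)
  rw [Real.norm_eq_abs, Real.norm_of_nonneg (by positivity), abs_div,
    abs_of_pos (by positivity : 0 < 1 + s ^ 2), ← div_eq_mul_inv,
    div_le_div_iff₀ (by positivity) (by positivity)]
  nlinarith [sq_nonneg (|s| - 1), sq_abs s, abs_nonneg s]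

lemma MemMFrac.memMPlus_two {lam : Measure ℝ} (h : MemMFrac lam) : MemMPlus 2 lam := h.1.1

lemma MemMPlus.add {n : ℝ} {lam mu : Measure ℝ} (h₁ : MemMPlus n lam) (h₂ : MemMPlus n mu) :
    MemMPlus n (lam + mu) := by
  unfold MemMPlus
  rw [lintegral_add_measure]
  exact ENNReal.add_lt_top.2 ⟨h₁, h₂⟩

lemma ae_add_measure {lam mu : Measure ℝ} {p : ℝ → Prop} (h₁ : ∀ᵐ s ∂lam, p s)
    (h₂ : ∀ᵐ s ∂mu, p s) : ∀ᵐ s ∂(lam + mu), p s :=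
  ae_add_measure_iff.2 ⟨h₁, h₂⟩

/-- The Pick function on the negative axis is the symbol of the Volterra operator. -/
lemma pick_neg_eq {a : ℝ} {lam₁ lam₂ : Measure ℝ} (h₁ : ExpClass a lam₁)
    (h₂ : MemMFrac lam₂) (c₀ c₁ : ℝ) {p : ℝ} (hp : |a| + 1 ≤ p) :
    pick (lam₁ + lam₂) (c₀ - Real.pi * sigmaR lam₁ - Real.pi * xiFrac lam₂) c₁ ((-p : ℝ) : ℂ)
      = ((-p * (c₁ + lap p (volterraKer c₀ lam₁ lam₂)) : ℝ) : ℂ) := by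
  have hp0 : 0 < p := by linarith [abs_nonneg a]
  have hp1 : |(0 : ℝ)| + 1 ≤ p := by rw [abs_zero]; linarith [abs_nonneg a]
  have hpos := h₂.ae_pos
  have hker : ∀ s : ℝ, cauchyKer ((-p : ℝ) : ℂ) s = (((p + s)⁻¹ - s / (1 + s ^ 2) : ℝ) : ℂ) := by
    intro s
    simp [cauchyKer, add_comm]
  have hσ : Real.pi * sigmaR lam₁ = -∫ s, s / (1 + s ^ 2) ∂lam₁ := by
    rw [sigmaR, mul_neg, ← integral_const_mul]
    congr 2 with s
    field_simp
  have hξ : Real.pi * xiFrac lam₂ = ∫ s, 1 / (s * (1 + s ^ 2)) ∂lam₂ := by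
    rw [xiFrac, ← mul_assoc, mul_one_div_cancel Real.pi_ne_zero, one_mul]
  have i1 : Integrable (fun s => (p + s)⁻¹ - s / (1 + s ^ 2)) lam₁ :=
    (h₁.integrable_inv_add hp).sub (integrable_div_one_add_sq h₁)
  have i3 : Integrable (fun s => s⁻¹ * (p + s)⁻¹) lam₂ :=
    (integrable_invMeasure_iff hpos).1 (h₂.expClass.integrable_inv_add hp1)
  have i4 : Integrable (fun s => 1 / (s * (1 + s ^ 2))) lam₂ := by
    have := (integrable_invMeasure_iff hpos).1 (memMPlus_two_iff.1 h₂.expClass.memMPlus_two)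
    refine this.congr (Eventually.of_forall fun s => ?_)
    simp only [one_div, mul_inv]
  -- This partial fraction explains the shift by `xiFrac`: for `lam₂` the regularized kernel is the
  -- integrand of ξ minus p times the Laplace kernel of `invMeasure lam₂`. For `lam₁` the two terms
  -- converge separately and give the shift by `sigmaR`.
  have hk2 : (fun s => (p + s)⁻¹ - s / (1 + s ^ 2))
      =ᵐ[lam₂] fun s => 1 / (s * (1 + s ^ 2)) - p * (s⁻¹ * (p + s)⁻¹) := by
    filter_upwards [hpos] with s hs
    have : p + s ≠ 0 := by positivity
    field_simp
    ring
  have i2 : Integrable (fun s => (p + s)⁻¹ - s / (1 + s ^ 2)) lam₂ :=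
    (i4.sub (i3.const_mul p)).congr hk2.symm
  have e1 : ∫ s, ((p + s)⁻¹ - s / (1 + s ^ 2)) ∂(lam₁ + lam₂)
      = (∫ s, (p + s)⁻¹ ∂lam₁ - ∫ s, s / (1 + s ^ 2) ∂lam₁)
        + (∫ s, 1 / (s * (1 + s ^ 2)) ∂lam₂ - p * ∫ s, s⁻¹ * (p + s)⁻¹ ∂lam₂) := by
    rw [integral_add_measure i1 i2, integral_congr_ae hk2, integral_sub i4 (i3.const_mul p),
      integral_const_mul, integral_sub (h₁.integrable_inv_add hp) (integrable_div_one_add_sq h₁)]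
  rw [pick]
  simp only [hker]
  rw [integral_complex_ofReal, e1, lap_volterraKer h₁ h₂ c₀ hp, hσ, hξ]
  norm_cast
  field_simp
  ring

/-- Two sets of data whose Pick functions are reciprocal. -/
structure DualPair (c₀ c₁ : ℝ) (lam₁ lam₂ : Measure ℝ) (ζ₀ ζ₁ : ℝ) (mu₁ mu₂ : Measure ℝ) :
    Prop where
  memMExp : MemMExp 1 lam₁
  memMFrac : MemMFrac lam₂
  memMExp' : MemMExp 1 mu₁
  memMFrac' : MemMFrac mu₂
  nonneg : 0 ≤ c₁
  nonneg' : 0 ≤ ζ₁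
  mul_eq : ∀ z : ℂ, 0 < z.im →
    pick (lam₁ + lam₂) (c₀ - Real.pi * sigmaR lam₁ - Real.pi * xiFrac lam₂) c₁ z *
      pick (mu₁ + mu₂) (ζ₀ - Real.pi * sigmaR mu₁ - Real.pi * xiFrac mu₂) ζ₁ z
        = -(Real.pi : ℂ) ^ 2

section

variable {c₀ c₁ ζ₀ ζ₁ : ℝ} {lam₁ lam₂ mu₁ mu₂ : Measure ℝ}

lemma DualPair.symm (h : DualPair c₀ c₁ lam₁ lam₂ ζ₀ ζ₁ mu₁ mu₂) :
    DualPair ζ₀ ζ₁ mu₁ mu₂ c₀ c₁ lam₁ lam₂ :=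
  ⟨h.memMExp', h.memMFrac', h.memMExp, h.memMFrac, h.nonneg', h.nonneg, fun z hz => by rw [mul_comm]; exact h.mul_eq z hz⟩

lemma DualPair.memMPlus_two (h : DualPair c₀ c₁ lam₁ lam₂ ζ₀ ζ₁ mu₁ mu₂) :
    MemMPlus 2 (lam₁ + lam₂) := by
  obtain ⟨a, ha⟩ := h.memMExp.exists_expClass
  exact ha.memMPlus_two.add h.memMFrac.memMPlus_two

lemma DualPair.finite (h : DualPair c₀ c₁ lam₁ lam₂ ζ₀ ζ₁ mu₁ mu₂) (hc : c₁ ≠ 0) :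
    ζ₁ = 0 ∧ IsFiniteMeasure (mu₁ + mu₂) ∧
      ζ₀ - Real.pi * sigmaR mu₁ - Real.pi * xiFrac mu₂ = ∫ s, s / (1 + s ^ 2) ∂(mu₁ + mu₂) :=
  finite_of_pick_mul_eq h.memMPlus_two h.symm.memMPlus_two (lt_of_le_of_ne h.nonneg hc.symm) h.nonneg'
    h.mul_eq

/-- The Pick relation is evaluated at -p, to the left of both supports, where each factor is -p
times a symbol; dividing by p² gives the claim. -/
lemma DualPair.exists_mul_lap_eq (h : DualPair c₀ c₁ lam₁ lam₂ ζ₀ ζ₁ mu₁ mu₂) :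
    ∃ p₀ > 0, LapInt p₀ (volterraKer c₀ lam₁ lam₂) ∧ LapInt p₀ (volterraKer ζ₀ mu₁ mu₂) ∧
      ∀ p, p₀ ≤ p → (c₁ + lap p (volterraKer c₀ lam₁ lam₂)) *
        (ζ₁ + lap p (volterraKer ζ₀ mu₁ mu₂)) = -Real.pi ^ 2 * ((1 / p) * (1 / p)) := by
  obtain ⟨a, ha⟩ := h.memMExp.exists_expClass
  obtain ⟨b, hb⟩ := h.memMExp'.exists_expClass
  have hpa : |a| + 1 ≤ |a| + |b| + 1 := by linarith [abs_nonneg b]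
  have hpb : |b| + 1 ≤ |a| + |b| + 1 := by linarith [abs_nonneg a]
  refine ⟨|a| + |b| + 1, by positivity, lapInt_volterraKer ha h.memMFrac c₀ hpa,
    lapInt_volterraKer hb h.memMFrac' ζ₀ hpb, fun p hp => ?_⟩
  have hp0 : 0 < p := by linarith [abs_nonneg a, abs_nonneg b]
  have haN : ∀ᵐ s ∂(lam₁ + lam₂), -|a| ≤ s :=
    ae_add_measure (ha.ae_le.mono fun s hs => (neg_abs_le a).trans hs)
      (h.memMFrac.ae_pos.mono fun s hs => by linarith [abs_nonneg a])
  have hbN : ∀ᵐ s ∂(mu₁ + mu₂), -|b| ≤ s :=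
    ae_add_measure (hb.ae_le.mono fun s hs => (neg_abs_le b).trans hs)
      (h.memMFrac'.ae_pos.mono fun s hs => by linarith [abs_nonneg b])
  have key := pick_mul_eq_of_real h.memMPlus_two h.symm.memMPlus_two haN hbN h.mul_eq (x := -p)
    (by linarith [abs_nonneg b]) (by linarith [abs_nonneg a])
  rw [pick_neg_eq ha h.memMFrac c₀ c₁ (hpa.trans hp), pick_neg_eq hb h.memMFrac' ζ₀ ζ₁ (hpb.trans hp)] at key
  have key2 : (-p * (c₁ + lap p (volterraKer c₀ lam₁ lam₂))) *
      (-p * (ζ₁ + lap p (volterraKer ζ₀ mu₁ mu₂))) = -Real.pi ^ 2 := by exact_mod_cast key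
  field_simp
  linarith

/-- This is the Dirac part of the product of the symbols. Once it is gone, only functions remain and
Lerch's theorem applies. -/
lemma DualPair.mul_coeff (h : DualPair c₀ c₁ lam₁ lam₂ ζ₀ ζ₁ mu₁ mu₂) : c₁ * ζ₁ = 0 := by
  by_cases hc : c₁ = 0
  · rw [hc, zero_mul]
  · rw [(h.finite hc).1, mul_zero]

/-- The Volterra operators of a dual pair are reciprocal, up to double integration. -/
theorem DualPair.vol_mul (h : DualPair c₀ c₁ lam₁ lam₂ ζ₀ ζ₁ mu₁ mu₂) :
    (algebraMap ℝ VolterraAlg c₁ + vol (volterraKer c₀ lam₁ lam₂)) *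
      (algebraMap ℝ VolterraAlg ζ₁ + vol (volterraKer ζ₀ mu₁ mu₂))
        = algebraMap ℝ VolterraAlg (-Real.pi ^ 2) * (step * step) := by
  obtain ⟨p₀, hp₀, ia, ib, hmul⟩ := h.exists_mul_lap_eq
  set A := volterraKer c₀ lam₁ lam₂
  set B := volterraKer ζ₀ mu₁ mu₂
  have hA := ia.locallyIntegrableOn
  have hB := ib.locallyIntegrableOn
  have i1 : LapInt p₀ (fun _ => 1) := lapInt_one hp₀
  have hcζ := h.mul_coeff
  have key : vol (c₁ • B + (ζ₁ • A + vconv A B))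
      = vol ((-Real.pi ^ 2) • vconv (fun _ => 1) (fun _ => 1)) := by
    refine vol_eq_of_lap_eq ((ib.smul c₁).add ((ia.smul ζ₁).add (ia.vconv ib)))
      ((i1.vconv i1).smul _) fun p hp => ?_
    have ja := ia.mono hp
    have jb := ib.mono hp
    have j1 := i1.mono hp
    rw [lap_add (jb.smul c₁) ((ja.smul ζ₁).add (ja.vconv jb)), lap_add (ja.smul ζ₁) (ja.vconv jb),
      lap_smul, lap_smul, lap_smul, lap_vconv ja jb, lap_vconv j1 j1, lap_one (hp₀.trans_le hp),
      ← hmul p hp]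
    linear_combination -hcζ
  have l1 := locallyIntegrableOn_one
  rw [vol_add (hB.smul c₁) ((hA.smul ζ₁).add (LocallyIntegrableOn.vconv hA hB)),
    vol_add (hA.smul ζ₁) (LocallyIntegrableOn.vconv hA hB), vol_smul _ hB, vol_smul _ hA,
    vol_vconv hA hB, vol_smul _ (LocallyIntegrableOn.vconv l1 l1), vol_vconv l1 l1] at key
  have hcζ' : algebraMap ℝ VolterraAlg c₁ * algebraMap ℝ VolterraAlg ζ₁ = 0 := by
    rw [← map_mul, hcζ, map_zero]
  unfold step
  linear_combination key + hcζ'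

lemma ExpClass.of_isFiniteMeasure {mu : Measure ℝ} [IsFiniteMeasure mu] {a : ℝ}
    (ha : ∀ᵐ s ∂mu, a ≤ s) : ExpClass a mu := by
  refine ⟨Integrable.of_bound (by fun_prop : Measurable fun s : ℝ =>
    (1 + |s|)⁻¹).aestronglyMeasurable 1 (Eventually.of_forall fun s => ?_), ha⟩
  rw [Real.norm_of_nonneg (by positivity)]
  exact inv_le_one_of_one_le₀ (by linarith [abs_nonneg s])

/-- The measure with density `g` for a function of at most linear growth. -/
lemma ExpClass.withDensity {mu : Measure ℝ} [IsFiniteMeasure mu] {a : ℝ} (ha : ∀ᵐ s ∂mu, a ≤ s)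
    {g : ℝ → ℝ} (hg : Measurable g) (hg0 : ∀ s, 0 ≤ g s) (hgs : ∀ s, g s ≤ |s|) :
    ExpClass a (mu.withDensity fun s => ENNReal.ofReal (g s)) := by
  refine ⟨?_, (withDensity_absolutelyContinuous _ _).ae_le ha⟩
  rw [integrable_withDensity_iff_integrable_smul' (by fun_prop)
    (Eventually.of_forall fun _ => ENNReal.ofReal_lt_top)]
  refine Integrable.of_bound (Measurable.aestronglyMeasurable (by fun_prop)) 1
    (Eventually.of_forall fun s => ?_)
  rw [ENNReal.toReal_ofReal (hg0 s), smul_eq_mul, Real.norm_of_nonneg (mul_nonneg (hg0 s)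
    (by positivity)), ← div_eq_mul_inv, div_le_one (by positivity)]
  linarith [hgs s]

/-- The Laplace transform of a finite measure has a locally absolutely continuous
representative. -/
lemma exists_vol_laplaceB_eq {mu : Measure ℝ} [IsFiniteMeasure mu] {a : ℝ}
    (ha : ∀ᵐ s ∂mu, a ≤ s) : ∃ m : ℝ → ℝ, LocallyIntegrableOn m (Ici 0) ∧
      vol (laplaceB mu) = algebraMap ℝ VolterraAlg (mu.real univ) * step + step * vol m := by
  -- The derivative of the Laplace transform is -∫ s e^(-ts) dμ. Since s may change sign, it is
  -- written as a difference of Laplace transforms of two non-negative measures.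
  set κp := mu.withDensity fun s => ENNReal.ofReal (max s 0)
  set κn := mu.withDensity fun s => ENNReal.ofReal (max (-s) 0)
  have hM := ExpClass.of_isFiniteMeasure ha
  have hp : ExpClass a κp := ExpClass.withDensity ha (by fun_prop) (fun s => le_max_right _ _)
    fun s => max_le (le_abs_self s) (abs_nonneg s)
  have hn : ExpClass a κn := ExpClass.withDensity ha (by fun_prop) (fun s => le_max_right _ _)
    fun s => max_le (neg_le_abs s) (abs_nonneg s)
  set p₀ := |a| + 1
  have hp₀ : 0 < p₀ := by positivity
  have im : LapInt p₀ (laplaceB κn + (-1 : ℝ) • laplaceB κp) :=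
    (hn.lapInt le_rfl).add ((hp.lapInt le_rfl).smul (-1))
  have i1 : LapInt p₀ (fun _ => 1) := lapInt_one hp₀
  refine ⟨_, im.locallyIntegrableOn, ?_⟩
  have hdens : ∀ g : ℝ → ℝ, Measurable g → (∀ s, 0 ≤ g s) → ∀ f : ℝ → ℝ,
      ∫ s, f s ∂(mu.withDensity fun s => ENNReal.ofReal (g s)) = ∫ s, g s * f s ∂mu := by
    intro g hg hg0 f
    rw [integral_withDensity_eq_integral_toReal_smul (by fun_prop)
      (Eventually.of_forall fun _ => ENNReal.ofReal_lt_top)]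
    simp only [ENNReal.toReal_ofReal (hg0 _), smul_eq_mul]
  have key : vol (laplaceB mu) = vol ((mu.real univ) • (fun _ => (1 : ℝ))
      + vconv (fun _ => 1) (laplaceB κn + (-1 : ℝ) • laplaceB κp)) := by
    refine vol_eq_of_lap_eq (hM.lapInt le_rfl) ((i1.smul _).add (i1.vconv im)) fun p hpp => ?_
    have hp0 : 0 < p := hp₀.trans_le hpp
    have j1 := i1.mono hpp
    have jm := im.mono hpp
    rw [lap_add (j1.smul _) (j1.vconv jm), lap_smul, lap_vconv j1 jm, lap_one hp0,
      lap_add (hn.lapInt hpp) ((hp.lapInt hpp).smul (-1)), lap_smul, hM.lap_eq hpp, hn.lap_eq hpp,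
      hp.lap_eq hpp, hdens _ (by fun_prop) (fun s => le_max_right _ _),
      hdens _ (by fun_prop) (fun s => le_max_right _ _)]
    have in' : Integrable (fun s => max (-s) 0 * (p + s)⁻¹) mu := by
      have := hn.integrable_inv_add hpp
      rw [integrable_withDensity_iff_integrable_smul' (by fun_prop)
        (Eventually.of_forall fun _ => ENNReal.ofReal_lt_top)] at this
      simpa only [ENNReal.toReal_ofReal (le_max_right _ _), smul_eq_mul] using this
    have ip' : Integrable (fun s => max s 0 * (p + s)⁻¹) mu := by
      have := hp.integrable_inv_add hpp
      rw [integrable_withDensity_iff_integrable_smul' (by fun_prop)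
        (Eventually.of_forall fun _ => ENNReal.ofReal_lt_top)] at this
      simpa only [ENNReal.toReal_ofReal (le_max_right _ _), smul_eq_mul] using this
    have hc : mu.real univ = ∫ _, (1 : ℝ) ∂mu := by simp
    -- In the transform the claim is 1/(p + s) = (1/p)(1 - s/(p + s)).
    have e : ∫ s, (p + s)⁻¹ ∂mu = ∫ s, (1 / p) * (1 + (max (-s) 0 * (p + s)⁻¹
        - max s 0 * (p + s)⁻¹)) ∂mu := by
      refine integral_congr_ae ?_
      filter_upwards [ha] with s hs
      have h0 := (ExpClass.one_add_abs_le hpp hs).1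
      have h1 : max (-s) 0 - max s 0 = -s := by
        rcases le_total s 0 with h | h
        · rw [max_eq_left (by linarith), max_eq_right h, sub_zero]
        · rw [max_eq_right (by linarith), max_eq_left h, zero_sub]
      rw [← sub_mul, h1]
      field_simp
      ring
    have id' : Integrable (fun s => max (-s) 0 * (p + s)⁻¹ - max s 0 * (p + s)⁻¹) mu := in'.sub ip'
    rw [e, integral_const_mul, integral_add (integrable_const _) id', integral_sub in' ip', ← hc]
    ring
  have l1 := locallyIntegrableOn_one
  have lm := im.locallyIntegrableOn
  rw [key, vol_add (l1.smul _) (LocallyIntegrableOn.vconv l1 lm), vol_smul _ l1, vol_vconv l1 lm]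
  rfl

/-- If `c₁ ≠ 0`, then the dual Volterra operator is integration after convolution with the Laplace
transform of the dual measure, which solves the resolvent equation. -/
theorem DualPair.exists_resolvent (h : DualPair c₀ c₁ lam₁ lam₂ ζ₀ ζ₁ mu₁ mu₂) (hc : c₁ ≠ 0) :
    LocallyIntegrableOn (laplaceB (mu₁ + mu₂)) (Ici 0) ∧
    vol (volterraKer ζ₀ mu₁ mu₂) = -(step * vol (laplaceB (mu₁ + mu₂))) ∧
    (algebraMap ℝ VolterraAlg c₁ + vol (volterraKer c₀ lam₁ lam₂)) * vol (laplaceB (mu₁ + mu₂))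
      = algebraMap ℝ VolterraAlg (Real.pi ^ 2) * step ∧
    ∃ m : ℝ → ℝ, LocallyIntegrableOn m (Ici 0) ∧ vol (laplaceB (mu₁ + mu₂))
      = algebraMap ℝ VolterraAlg (Real.pi ^ 2 / c₁) * step + step * vol m := by
  obtain ⟨hζ, hfin, hζ₀⟩ := h.finite hc
  obtain ⟨b, hb⟩ := h.memMExp'.exists_expClass
  set mu := mu₁ + mu₂
  have hbN : ∀ᵐ s ∂mu, -|b| ≤ s :=
    ae_add_measure (hb.ae_le.mono fun s hs => (neg_abs_le b).trans hs)
      (h.memMFrac'.ae_pos.mono fun s hs => by linarith [abs_nonneg b])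
  have hM := ExpClass.of_isFiniteMeasure hbN
  have hbb : |(-|b|)| = |b| := by rw [abs_neg, abs_abs]
  have hlM : LocallyIntegrableOn (laplaceB mu) (Ici 0) := hM.locallyIntegrableOn
  have l1 := locallyIntegrableOn_one
  set p₀ := |b| + 1
  have hp₀ : 0 < p₀ := by positivity
  have i1 : LapInt p₀ (fun _ => 1) := lapInt_one hp₀
  have iM : LapInt p₀ (laplaceB mu) := hM.lapInt (by rw [hbb])
  have hB : vol (volterraKer ζ₀ mu₁ mu₂) = -(step * vol (laplaceB mu)) := by
    have : vol (volterraKer ζ₀ mu₁ mu₂) = vol ((-1 : ℝ) • vconv (fun _ => 1) (laplaceB mu)) := by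
      refine vol_eq_of_lap_eq (lapInt_volterraKer hb h.memMFrac' ζ₀ le_rfl) ((i1.vconv iM).smul _)
        fun p hp => ?_
      have hp0 : 0 < p := hp₀.trans_le hp
      have hpM : |(-|b|)| + 1 ≤ p := by rw [hbb]; exact hp
      have e := pick_neg_eq hb h.memMFrac' ζ₀ ζ₁ hp
      have hker : ∀ s : ℝ, cauchyKer ((-p : ℝ) : ℂ) s
          = (((p + s)⁻¹ - s / (1 + s ^ 2) : ℝ) : ℂ) := by
        intro s
        simp [cauchyKer, add_comm]
      rw [pick] at e
      simp only [hker] at e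
      rw [integral_complex_ofReal, integral_sub (hM.integrable_inv_add hpM)
        (integrable_div_one_add_sq hM), hζ₀, hζ] at e
      -- The dual Pick function has no linear term, and its constant cancels the regularization,
      -- leaving the plain Stieltjes transform.
      have e2 : (∫ s, (p + s)⁻¹ ∂mu) = -p * lap p (volterraKer ζ₀ mu₁ mu₂) := by
        have := congrArg Complex.re e
        simp at this
        linarith
      rw [lap_smul, lap_vconv (i1.mono hp) (iM.mono hp), lap_one hp0, hM.lap_eq hpM, e2]
      field_simp
    rw [this, vol_smul _ (LocallyIntegrableOn.vconv l1 hlM), vol_vconv l1 hlM, map_neg, map_one]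
    rw [step]
    ring
  have hAM : (algebraMap ℝ VolterraAlg c₁ + vol (volterraKer c₀ lam₁ lam₂)) * vol (laplaceB mu)
      = algebraMap ℝ VolterraAlg (Real.pi ^ 2) * step := by
    have := h.vol_mul
    rw [hB, hζ, map_zero, map_neg] at this
    refine step_mul_cancel ?_
    linear_combination -this
  obtain ⟨m, hm, hMm⟩ := exists_vol_laplaceB_eq hbN
  refine ⟨hlM, hB, hAM, m, hm, ?_⟩
  -- Comparing Dirac parts yields c₁ μ(ℝ) = π², hence the initial value π²/c₁ of M.
  have hfst : (algebraMap ℝ VolterraAlg c₁ + vol (volterraKer c₀ lam₁ lam₂)) *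
      (algebraMap ℝ VolterraAlg (mu.real univ) + vol m)
        = algebraMap ℝ VolterraAlg (Real.pi ^ 2) := by
    refine step_mul_cancel ?_
    rw [hMm] at hAM
    linear_combination hAM
  have h2 := congrArg (fun x : VolterraAlg => x.fst) hfst
  rw [Unitization.fst_mul, Unitization.fst_add, Unitization.fst_add, fst_vol, fst_vol] at h2
  have h3 : c₁ * mu.real univ = Real.pi ^ 2 := by
    simpa [Unitization.algebraMap_eq_inl] using h2
  rw [hMm, (eq_div_iff hc).2 ((mul_comm _ _).trans h3)]

end

end Duality

section Equations

open Filter Topology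

/-! ### The equations -/

/-- Convolution with the unit step is integration from 0, so absolute continuity with a given
initial value becomes an identity in the algebra. -/
lemma hasACDeriv_iff {f f' : ℝ → ℝ} (hf : LocallyIntegrableOn f (Ici 0)) (f₀ : ℝ) :
    HasACDeriv f f₀ f' ↔ LocallyIntegrableOn f' (Ici 0) ∧
      vol f = algebraMap ℝ VolterraAlg f₀ * step + step * vol f' := by
  refine and_congr_right fun hf' => ?_
  have l1 := locallyIntegrableOn_one
  have l2 := LocallyIntegrableOn.vconv l1 hf'
  rw [step, ← vol_vconv l1 hf', ← vol_smul _ l1, ← vol_add (l1.smul f₀) l2,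
    vol_eq_iff hf ((l1.smul f₀).add l2)]
  refine eventually_congr (Eventually.of_forall fun t => ?_)
  simp [vconv_one]

lemma exists_vol_of_fst_eq_zero {x : VolterraAlg} (hx : x.fst = 0) :
    ∃ f : ℝ → ℝ, LocallyIntegrableOn f (Ici 0) ∧ vol f = x := by
  obtain ⟨f, hf, h⟩ := exists_vol x
  refine ⟨f, hf, ?_⟩
  rw [h, hx, map_zero, zero_add]

lemma ae_eq_iff_vol {c₀ c₁ : ℝ} {x x' y k w : ℝ → ℝ} (hx : LocallyIntegrableOn x (Ici 0))
    (hx' : LocallyIntegrableOn x' (Ici 0)) (hy : LocallyIntegrableOn y (Ici 0))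
    (hk : LocallyIntegrableOn k (Ici 0)) (hw : LocallyIntegrableOn w (Ici 0)) :
    (∀ᵐ t ∂(volume.restrict (Ici (0 : ℝ))), y t = c₁ * x' t - c₀ * x t - k t + w t) ↔
      vol y = algebraMap ℝ VolterraAlg c₁ * vol x' - algebraMap ℝ VolterraAlg c₀ * vol x
        - vol k + vol w := by
  have h : algebraMap ℝ VolterraAlg c₁ * vol x' - algebraMap ℝ VolterraAlg c₀ * vol x
      - vol k + vol w = vol (c₁ • x' + ((-c₀) • x + ((-1 : ℝ) • k + w))) := by
    rw [vol_add (hx'.smul c₁) ((hx.smul _).add ((hk.smul _).add hw)),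
      vol_add (hx.smul _) ((hk.smul _).add hw), vol_add (hk.smul _) hw, vol_smul _ hx',
      vol_smul _ hx, vol_smul _ hk, map_neg, map_neg, map_one]
    ring
  rw [h, vol_eq_iff hy ((hx'.smul c₁).add ((hx.smul _).add ((hk.smul _).add hw)))]
  refine eventually_congr (Eventually.of_forall fun t => ?_)
  simp only [Pi.add_apply, Pi.smul_apply, smul_eq_mul]
  constructor <;> intro h <;> linarith

/-- The equation in differentiated form is equivalent to the integrated equation. -/
lemma solvesRCM_iff {c₀ c₁ x₀ : ℝ} {K₁ K₂ x y : ℝ → ℝ} (hK₁ : LocallyIntegrableOn K₁ (Ici 0))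
    (hK₂ : LocallyIntegrableOn K₂ (Ici 0)) (hx : LocallyIntegrableOn x (Ici 0))
    (hy : LocallyIntegrableOn y (Ici 0)) {A : VolterraAlg}
    (hA : A = algebraMap ℝ VolterraAlg c₁ - algebraMap ℝ VolterraAlg c₀ * step - step * vol K₁
      + vol K₂)
    (hres : c₁ ≠ 0 → ∃ M m : ℝ → ℝ, A * vol M = algebraMap ℝ VolterraAlg (Real.pi ^ 2) * step ∧
      vol M = algebraMap ℝ VolterraAlg (Real.pi ^ 2 / c₁) * step + step * vol m) :
    SolvesRCM c₀ c₁ K₁ K₂ x₀ x y ↔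
      step * vol y = A * vol x - algebraMap ℝ VolterraAlg (c₁ * x₀) * step := by
  have hK₁x := LocallyIntegrableOn.vconv hK₁ hx
  have hK₂x := LocallyIntegrableOn.vconv hK₂ hx
  constructor
  · rintro ⟨x', v, hx', hv, heq⟩
    rw [hasACDeriv_iff hK₂x, vol_vconv hK₂ hx, map_zero, zero_mul, zero_add] at hv
    by_cases hc : c₁ = 0
    · subst hc
      have heq' : ∀ᵐ t ∂(volume.restrict (Ici (0 : ℝ))),
          y t = 0 * x t - c₀ * x t - vconv K₁ x t + v t := by
        filter_upwards [heq] with t ht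
        rw [ht, zero_mul, zero_mul]
      rw [ae_eq_iff_vol hx hx hy hK₁x hv.1, vol_vconv hK₁ hx] at heq'
      rw [heq', hA, zero_mul, map_zero]
      linear_combination -hv.2
    · have hx' := hx' hc
      rw [hasACDeriv_iff hx] at hx'
      rw [ae_eq_iff_vol hx hx'.1 hy hK₁x hv.1, vol_vconv hK₁ hx] at heq
      rw [heq, hA, map_mul]
      linear_combination -hv.2 - algebraMap ℝ VolterraAlg c₁ * hx'.2
  · intro h
    by_cases hc : c₁ = 0
    · subst hc
      obtain ⟨v, hv, hv'⟩ := exists_vol_of_fst_eq_zero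
        (x := vol y + algebraMap ℝ VolterraAlg c₀ * vol x + vol K₁ * vol x)
        (by simp [Unitization.fst_mul, fst_vol])
      refine ⟨x, v, fun h0 => absurd rfl h0, ?_, ?_⟩
      · rw [hasACDeriv_iff hK₂x, vol_vconv hK₂ hx, map_zero, hv']
        refine ⟨hv, ?_⟩
        rw [hA, zero_mul, map_zero] at h
        linear_combination -h
      · rw [ae_eq_iff_vol hx hx hy hK₁x hv, vol_vconv hK₁ hx, hv', map_zero]
        ring
    · obtain ⟨M, m, hM, hm⟩ := hres hc
      have hpi : Real.pi ^ 2 ≠ 0 := by positivity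
      set i := algebraMap ℝ VolterraAlg (1 / Real.pi ^ 2)
      have hi : i * algebraMap ℝ VolterraAlg (Real.pi ^ 2) = 1 := by
        rw [← map_mul, one_div_mul_cancel hpi, map_one]
      set k := algebraMap ℝ VolterraAlg c₁
      have hk : k * algebraMap ℝ VolterraAlg (Real.pi ^ 2 / c₁)
          = algebraMap ℝ VolterraAlg (Real.pi ^ 2) := by
        rw [← map_mul, mul_div_cancel₀ _ hc]
      rw [map_mul] at h
      -- Multiplying the integrated equation by M and cancelling `step` expresses x through M, so x
      -- inherits absolute continuity from M.
      have hxM : algebraMap ℝ VolterraAlg (Real.pi ^ 2) * vol x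
          = vol M * vol y + k * algebraMap ℝ VolterraAlg x₀ * vol M := by
        refine step_mul_cancel ?_
        linear_combination (-vol M) * h - vol x * hM
      -- This is the derivative of the previous formula, using that M has initial value π²/c₁ and
      -- derivative m.
      obtain ⟨x', hx', hxx'⟩ := exists_vol_of_fst_eq_zero
        (x := i * (algebraMap ℝ VolterraAlg (Real.pi ^ 2 / c₁) * vol y + vol m * vol y
          + k * algebraMap ℝ VolterraAlg x₀ * vol m)) (by simp [Unitization.fst_mul, fst_vol])
      have hxac : vol x = algebraMap ℝ VolterraAlg x₀ * step + step * vol x' := by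
        rw [hxx']
        linear_combination (-vol x + algebraMap ℝ VolterraAlg x₀ * step) * hi + i * hxM
          + i * (vol y + k * algebraMap ℝ VolterraAlg x₀) * hm
          + i * algebraMap ℝ VolterraAlg x₀ * step * hk
      -- Once x is absolutely continuous, the derivative of K₂ * x is x₀ K₂ + K₂ * x'.
      obtain ⟨v, hv, hv'⟩ := exists_vol_of_fst_eq_zero
        (x := algebraMap ℝ VolterraAlg x₀ * vol K₂ + vol K₂ * vol x')
        (by simp [Unitization.fst_mul, fst_vol])
      refine ⟨x', v, fun _ => (hasACDeriv_iff hx x₀).2 ⟨hx', hxac⟩, ?_, ?_⟩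
      · rw [hasACDeriv_iff hK₂x, vol_vconv hK₂ hx, map_zero, hv']
        refine ⟨hv, ?_⟩
        linear_combination vol K₂ * hxac
      · rw [ae_eq_iff_vol hx hx' hy hK₁x hv, vol_vconv hK₁ hx, hv']
        refine step_mul_cancel ?_
        rw [hA] at h
        linear_combination h + (k + vol K₂) * hxac

lemma vol_volterraKer {c₀ : ℝ} {lam₁ lam₂ : Measure ℝ}
    (hK₁ : LocallyIntegrableOn (laplaceB lam₁) (Ici 0))
    (hK₂ : LocallyIntegrableOn (laplaceB (invMeasure lam₂)) (Ici 0)) :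
    vol (volterraKer c₀ lam₁ lam₂) = -(algebraMap ℝ VolterraAlg c₀ * step)
      - step * vol (laplaceB lam₁) + vol (laplaceB (invMeasure lam₂)) := by
  have l1 := locallyIntegrableOn_one
  have l2 := LocallyIntegrableOn.vconv l1 hK₁
  rw [volterraKer, vol_add (l1.smul _) ((l2.smul _).add hK₂), vol_add (l2.smul _) hK₂,
    vol_smul _ l1, vol_smul _ l2, vol_vconv l1 hK₁, map_neg, map_neg, map_one, step]
  ring

lemma MemMExp.locallyIntegrableOn_laplaceB {lam : Measure ℝ} (h : MemMExp 1 lam) :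
    LocallyIntegrableOn (laplaceB lam) (Ici 0) := by
  obtain ⟨a, ha⟩ := h.exists_expClass
  exact ha.locallyIntegrableOn

lemma laplaceB_eq_mgf (kap : Measure ℝ) (t : ℝ) :
    laplaceB kap t = ProbabilityTheory.mgf id kap (-t) := by
  simp [laplaceB, ProbabilityTheory.mgf]

/-- The transform is a moment generating function at -t, finite at every negative argument.
Differentiating brings down a factor s, which cancels the density s⁻¹. -/
lemma MemMFrac.deriv_laplaceB {lam : Measure ℝ} (h : MemMFrac lam) {t : ℝ} (ht : 0 < t) :
    deriv (laplaceB (invMeasure lam)) t = -laplaceB lam t := by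
  have hpos := h.ae_pos
  have hset : ∀ u < 0, u ∈ ProbabilityTheory.integrableExpSet id (invMeasure lam) := fun u hu => by
    have hu' : 0 < -u := by linarith
    change Integrable (fun s => Real.exp (u * s)) (invMeasure lam)
    refine (h.expClass.integrable.const_mul (1 + 1 / (-u))).mono'
      (by fun_prop : Measurable fun s : ℝ => Real.exp (u * s)).aestronglyMeasurable ?_
    filter_upwards [h.expClass.ae_le] with s hs
    rw [Real.norm_of_nonneg (Real.exp_nonneg _), abs_of_nonneg hs, ← div_eq_mul_inv,
      le_div_iff₀ (by positivity)]
    have h1 := Real.add_one_le_exp (-(u * s))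
    have h2 : Real.exp (u * s) * Real.exp (-(u * s)) = 1 := by
      rw [← Real.exp_add, add_neg_cancel, Real.exp_zero]
    have h3 : 1 + s ≤ (1 + 1 / (-u)) * Real.exp (-(u * s)) := by
      have : (1 + 1 / (-u)) * (-(u * s) + 1) = 1 + s + 1 / (-u) + (-u) * s := by
        have := hu.ne
        field_simp
        ring
      have h4 : 0 ≤ 1 / (-u) := by positivity
      have h5 : 0 ≤ (-u) * s := by positivity
      have h6 : (1 + 1 / (-u)) * (-(u * s) + 1) ≤ (1 + 1 / (-u)) * Real.exp (-(u * s)) := by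
        gcongr
      linarith
    calc Real.exp (u * s) * (1 + s)
        ≤ Real.exp (u * s) * ((1 + 1 / (-u)) * Real.exp (-(u * s))) := by gcongr
      _ = 1 + 1 / (-u) := by linear_combination (1 + 1 / (-u)) * h2
  have hint : -t ∈ interior (ProbabilityTheory.integrableExpSet id (invMeasure lam)) :=
    mem_interior.2 ⟨Iio 0, fun u hu => hset u hu, isOpen_Iio, by simpa using ht⟩
  have hd := ProbabilityTheory.hasDerivAt_mgf hint
  have hd2 : HasDerivAt (fun t => ProbabilityTheory.mgf id (invMeasure lam) (-t))
      ((∫ s, id s * Real.exp (-t * id s) ∂(invMeasure lam)) * (-1)) t :=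
    hd.comp t (hasDerivAt_neg t)
  have e : laplaceB (invMeasure lam)
      = fun t => ProbabilityTheory.mgf id (invMeasure lam) (-t) :=
    funext fun t => laplaceB_eq_mgf _ t
  rw [e, hd2.deriv, integral_invMeasure hpos, laplaceB, mul_neg_one]
  congr 1
  refine integral_congr_ae ?_
  filter_upwards [hpos] with s hs
  simp only [id]
  rw [inv_mul_cancel_left₀ hs.ne', neg_mul]

lemma laplaceB_add {mu₁ mu₂ : Measure ℝ} [IsFiniteMeasure (mu₁ + mu₂)] {a : ℝ}
    (ha : ∀ᵐ s ∂(mu₁ + mu₂), a ≤ s) {t : ℝ} (ht : 0 ≤ t) :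
    laplaceB (mu₁ + mu₂) t = laplaceB mu₁ t + laplaceB mu₂ t := by
  have hi : Integrable (fun s => Real.exp (-(t * s))) (mu₁ + mu₂) := by
    refine Integrable.of_bound (by fun_prop : Measurable fun s : ℝ =>
      Real.exp (-(t * s))).aestronglyMeasurable (Real.exp (-(t * a))) ?_
    filter_upwards [ha] with s hs
    rw [Real.norm_of_nonneg (Real.exp_nonneg _)]
    gcongr
  rw [laplaceB, integral_add_measure hi.left_of_add_measure hi.right_of_add_measure]
  rfl

/-- The forcing term of the dual equation is M and so does not depend on the decomposition.
Finiteness of the measure permits the splitting; t = 0 is a null set. -/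
lemma DualPair.laplaceB_sub_deriv_ae {c₀ c₁ ζ₀ ζ₁ : ℝ} {lam₁ lam₂ mu₁ mu₂ : Measure ℝ}
    (h : DualPair c₀ c₁ lam₁ lam₂ ζ₀ ζ₁ mu₁ mu₂) (hc : c₁ ≠ 0) :
    ∀ᵐ t ∂(volume.restrict (Ici (0 : ℝ))), laplaceB mu₁ t - deriv (laplaceB (invMeasure mu₂)) t
      = laplaceB (mu₁ + mu₂) t := by
  obtain ⟨-, hfin, -⟩ := h.finite hc
  obtain ⟨b, hb⟩ := h.memMExp'.exists_ae_le
  have hbN : ∀ᵐ s ∂(mu₁ + mu₂), -|b| ≤ s :=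
    ae_add_measure (hb.mono fun s hs => (neg_abs_le b).trans hs)
      (h.memMFrac'.ae_pos.mono fun s hs => by linarith [abs_nonneg b])
  rw [← restrict_Ioi_eq_restrict_Ici]
  filter_upwards [ae_restrict_mem measurableSet_Ioi] with t ht
  rw [h.memMFrac'.deriv_laplaceB ht, laplaceB_add hbN (le_of_lt ht), sub_neg_eq_add]

lemma DualPair.solvesRCM_iff {c₀ c₁ ζ₀ ζ₁ : ℝ} {lam₁ lam₂ mu₁ mu₂ : Measure ℝ}
    (h : DualPair c₀ c₁ lam₁ lam₂ ζ₀ ζ₁ mu₁ mu₂) {x₀ : ℝ} {x y : ℝ → ℝ}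
    (hx : LocallyIntegrableOn x (Ici 0)) (hy : LocallyIntegrableOn y (Ici 0)) :
    SolvesRCM c₀ c₁ (laplaceB lam₁) (laplaceB (invMeasure lam₂)) x₀ x y ↔
      step * vol y = (algebraMap ℝ VolterraAlg c₁ + vol (volterraKer c₀ lam₁ lam₂)) * vol x
        - algebraMap ℝ VolterraAlg (c₁ * x₀) * step := by
  have h1 := h.memMExp.locallyIntegrableOn_laplaceB
  have h2 := h.memMFrac.expClass.locallyIntegrableOn
  refine _root_.solvesRCM_iff h1 h2 hx hy ?_ fun hc => ?_
  · rw [vol_volterraKer h1 h2]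
    ring
  · obtain ⟨-, -, hAM, m, -, hm⟩ := h.exists_resolvent hc
    exact ⟨_, m, hAM, hm⟩

/-- **The dual equation solves the equation.** -/
theorem DualPair.solvesRCM_iff_solvesRCM {c₀ c₁ ζ₀ ζ₁ : ℝ} {lam₁ lam₂ mu₁ mu₂ : Measure ℝ}
    (h : DualPair c₀ c₁ lam₁ lam₂ ζ₀ ζ₁ mu₁ mu₂) (x₀ : ℝ) {x y : ℝ → ℝ}
    (hx : LocallyIntegrableOn x (Ici 0)) (hy : LocallyIntegrableOn y (Ici 0)) :
    SolvesRCM c₀ c₁ (laplaceB lam₁) (laplaceB (invMeasure lam₂)) x₀ x y ↔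
      SolvesRCM ζ₀ ζ₁ (laplaceB mu₁) (laplaceB (invMeasure mu₂)) 0 y
        (fun t => -Real.pi ^ 2 * x t
          + c₁ * x₀ * (laplaceB mu₁ t - deriv (laplaceB (invMeasure mu₂)) t)) := by
  set f : ℝ → ℝ := fun t => -Real.pi ^ 2 * x t
    + c₁ * x₀ * (laplaceB mu₁ t - deriv (laplaceB (invMeasure mu₂)) t)
  have hAB := h.vol_mul
  set A := algebraMap ℝ VolterraAlg c₁ + vol (volterraKer c₀ lam₁ lam₂)
  set P := algebraMap ℝ VolterraAlg (-Real.pi ^ 2)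
  have hP : algebraMap ℝ VolterraAlg (1 / (-Real.pi ^ 2)) * P = 1 := by
    have hpi : -Real.pi ^ 2 ≠ 0 := by simp [Real.pi_ne_zero]
    rw [← map_mul, one_div_mul_cancel hpi, map_one]
  have hcancel : ∀ u v : VolterraAlg, P * u = P * v → u = v := fun u v huv => by
    linear_combination algebraMap ℝ VolterraAlg (1 / (-Real.pi ^ 2)) * huv - (u - v) * hP
  -- For c₁ = 0 the forcing term vanishes and both directions are multiplication by the other
  -- symbol. Otherwise ζ₁ = 0, the dual symbol is -(`step` M), and the initial-value term yields the
  -- forcing.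
  by_cases hc : c₁ = 0
  · have hfe : f = (-Real.pi ^ 2) • x := by
      ext t
      simp [f, hc]
    have hf : LocallyIntegrableOn f (Ici 0) := by rw [hfe]; exact hx.smul _
    have hz : algebraMap ℝ VolterraAlg (c₁ * x₀) = 0 := by rw [hc, zero_mul, map_zero]
    rw [h.solvesRCM_iff hx hy, h.symm.solvesRCM_iff hy hf, hfe, vol_smul _ hx, hz,
      mul_zero, map_zero, zero_mul, sub_zero, sub_zero]
    constructor
    · intro hX
      refine step_mul_cancel ?_
      linear_combination -(vol x) * hAB
        - (algebraMap ℝ VolterraAlg ζ₁ + vol (volterraKer ζ₀ mu₁ mu₂)) * hX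
    · intro hY
      refine step_mul_cancel (hcancel _ _ ?_)
      linear_combination -(vol y) * hAB - A * hY
  · obtain ⟨hM, hB, hAM, -⟩ := h.exists_resolvent hc
    have hζ := (h.finite hc).1
    have hfe : f =ᵐ[volume.restrict (Ici 0)]
        (-Real.pi ^ 2) • x + (c₁ * x₀) • laplaceB (mu₁ + mu₂) := by
      filter_upwards [h.laplaceB_sub_deriv_ae hc] with t ht
      simp only [f, ht]
      rfl
    have hg := (hx.smul (-Real.pi ^ 2)).add (hM.smul (c₁ * x₀))
    have hf : LocallyIntegrableOn f (Ici 0) := hg.congr hfe.symm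
    rw [h.solvesRCM_iff hx hy, h.symm.solvesRCM_iff hy hf, (vol_eq_iff hf hg).2 hfe,
      vol_add (hx.smul _) (hM.smul _), vol_smul _ hx, vol_smul _ hM, mul_zero, hB, hζ, map_zero]
    rw [hB, hζ, map_zero] at hAB
    set M := vol (laplaceB (mu₁ + mu₂))
    constructor
    · intro hX
      refine step_mul_cancel ?_
      linear_combination -(vol x) * hAB + step * M * hX
    · intro hY
      refine step_mul_cancel (hcancel _ _ ?_)
      linear_combination -(vol y) * hAB - A * hY - algebraMap ℝ VolterraAlg (c₁ * x₀) * hAB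

end Equations

section Abel

open Filter

/-! ### Abel's equation -/

lemma lapInt_rpow {α : ℝ} (hα : α < 1) {p : ℝ} (hp : 0 < p) : LapInt p (fun t => t ^ (-α)) := by
  have := integrableOn_rpow_mul_exp_neg_mul_rpow (s := -α) (p := 1) (by linarith) one_pos hp
  refine this.congr_fun (fun t _ => ?_) measurableSet_Ioi
  simp only [Real.rpow_one, neg_mul]
  ring

lemma lap_rpow {α : ℝ} (hα : α < 1) {p : ℝ} (hp : 0 < p) :
    lap p (fun t => t ^ (-α)) = (1 / p) ^ (1 - α) * Real.Gamma (1 - α) := by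
  rw [← Real.integral_rpow_mul_exp_neg_mul_Ioi (by linarith : 0 < 1 - α) hp, lap]
  congr 1 with t
  rw [show 1 - α - 1 = -α by ring, mul_comm]

/-- The transforms of t^(-α) and t^(-(1-α)) are Γ(1-α) p^(α-1) and Γ(α) p^(-α). The Gamma factors
cancel crosswise and the product is 1/p. -/
lemma vol_abel_mul {α : ℝ} (h0 : 0 < α) (h1 : α < 1) :
    vol ((1 / Real.Gamma α) • fun t : ℝ => t ^ (-α)) *
      vol ((1 / Real.Gamma (1 - α)) • fun t : ℝ => t ^ (-(1 - α))) = step := by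
  have hα' : 1 - α < 1 := by linarith
  have i1 := (lapInt_rpow h1 one_pos).smul (1 / Real.Gamma α)
  have i2 := (lapInt_rpow hα' one_pos).smul (1 / Real.Gamma (1 - α))
  rw [← vol_vconv i1.locallyIntegrableOn i2.locallyIntegrableOn, step]
  refine vol_eq_of_lap_eq (i1.vconv i2) (lapInt_one one_pos) fun p hp => ?_
  have hp0 : 0 < p := one_pos.trans_le hp
  rw [lap_vconv (i1.mono hp) (i2.mono hp), lap_smul, lap_smul, lap_rpow h1 hp0, lap_rpow hα' hp0,
    lap_one hp0, sub_sub_cancel]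
  have e : (1 / p) ^ (1 - α) * (1 / p) ^ α = 1 / p := by
    rw [← Real.rpow_add (by positivity), sub_add_cancel, Real.rpow_one]
  have g1 := (Real.Gamma_pos_of_pos h0).ne'
  have g2 := (Real.Gamma_pos_of_pos (by linarith : 0 < 1 - α)).ne'
  generalize (1 / p) ^ (1 - α) = u, (1 / p) ^ α = v at e ⊢
  rw [← e]
  field_simp

lemma vconv_abel (c α : ℝ) (x : ℝ → ℝ) {t : ℝ} (ht : 0 ≤ t) :
    vconv (c • fun t : ℝ => t ^ (-α)) x t = c * ∫ τ in (0 : ℝ)..t, x τ / (t - τ) ^ α := by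
  rw [vconv, ← intervalIntegral.integral_const_mul]
  refine intervalIntegral.integral_congr fun τ hτ => ?_
  rw [uIcc_of_le ht] at hτ
  simp only [Pi.smul_apply, smul_eq_mul]
  rw [Real.rpow_neg (by linarith [hτ.2])]
  ring

/-- **Abel's equation.** -/
theorem abel_iff {α : ℝ} (h0 : 0 < α) (h1 : α < 1) {x y : ℝ → ℝ}
    (hx : LocallyIntegrableOn x (Ici 0)) (hy : LocallyIntegrableOn y (Ici 0)) :
    (∀ᵐ t ∂(volume.restrict (Ici (0 : ℝ))),
      y t = (1 / Real.Gamma α) * ∫ τ in (0 : ℝ)..t, x τ / (t - τ) ^ α) ↔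
    HasACDeriv
      (fun t => (1 / Real.Gamma (1 - α)) * ∫ τ in (0 : ℝ)..t, y τ / (t - τ) ^ (1 - α)) 0 x := by
  have hk := vol_abel_mul h0 h1
  have l1 := ((lapInt_rpow h1 one_pos).smul (1 / Real.Gamma α)).locallyIntegrableOn
  have l2 := ((lapInt_rpow (by linarith : 1 - α < 1) one_pos).smul
    (1 / Real.Gamma (1 - α))).locallyIntegrableOn
  set k₁ := (1 / Real.Gamma α) • fun t : ℝ => t ^ (-α)
  set k₂ := (1 / Real.Gamma (1 - α)) • fun t : ℝ => t ^ (-(1 - α))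
  have e1 : (∀ᵐ t ∂(volume.restrict (Ici (0 : ℝ))),
      y t = (1 / Real.Gamma α) * ∫ τ in (0 : ℝ)..t, x τ / (t - τ) ^ α) ↔
      vol y = vol k₁ * vol x := by
    rw [← vol_vconv l1 hx, vol_eq_iff hy (LocallyIntegrableOn.vconv l1 hx)]
    refine eventually_congr ?_
    filter_upwards [ae_nonneg_Ici] with t ht
    rw [vconv_abel _ _ _ ht]
  have e3 : (fun t => (1 / Real.Gamma (1 - α)) * ∫ τ in (0 : ℝ)..t, y τ / (t - τ) ^ (1 - α))
      =ᵐ[volume.restrict (Ici 0)] vconv k₂ y := by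
    filter_upwards [ae_nonneg_Ici] with t ht
    rw [vconv_abel _ _ _ ht]
  have l3 := LocallyIntegrableOn.vconv l2 hy
  have l4 := l3.congr e3.symm
  rw [e1, hasACDeriv_iff l4, (vol_eq_iff l4 l3).2 e3, vol_vconv l2 hy, map_zero, zero_mul, zero_add]
  constructor
  · intro h
    refine ⟨hx, ?_⟩
    rw [h]
    linear_combination vol x * hk
  · rintro ⟨-, h⟩
    refine step_mul_cancel ?_
    linear_combination vol k₁ * h - vol y * hk

end Abel

/-! ### Splitting an order-two measure at 1 -/

section Decomposition

lemma MemMExp.restrict {n : ℝ} {mu : Measure ℝ} (h : MemMExp n mu) (s : Set ℝ) :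
    MemMExp n (mu.restrict s) :=
  ⟨lt_of_le_of_lt (lintegral_mono' Measure.restrict_le_self le_rfl) h.1,
    h.2.mono (Measure.support_mono Measure.restrict_le_self)⟩

/-- Below 1 the measure is carried by a compact interval, so it is finite. -/
lemma memMExp_one_restrict_Iio {mu : Measure ℝ} (h : MemMExp 2 mu) :
    MemMExp 1 (mu.restrict (Iio 1)) := by
  have hlf := h.1.isLocallyFiniteMeasure
  refine ⟨?_, (h.restrict _).2⟩
  obtain ⟨a, ha⟩ := h.exists_ae_le
  have hfin : mu (Iio 1) < ⊤ := by
    have : mu (Iio 1) ≤ mu (Icc a 1) := by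
      refine measure_mono_ae ?_
      filter_upwards [ha] with s hs h1
      exact ⟨hs, le_of_lt h1⟩
    exact this.trans_lt isCompact_Icc.measure_lt_top
  refine lt_of_le_of_lt (lintegral_mono (g := fun _ => 1) fun s => ?_) (by simpa using hfin)
  rw [← ENNReal.ofReal_one]
  refine ENNReal.ofReal_le_ofReal ?_
  exact Real.rpow_le_one_of_one_le_of_nonpos (by nlinarith [sq_nonneg s]) (by norm_num)

/-- On [1, ∞) the density s⁻¹ is at most 1, so local finiteness is inherited. -/
lemma memMFrac_restrict_Ici {mu : Measure ℝ} (h : MemMExp 2 mu) :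
    MemMFrac (mu.restrict (Ici 1)) := by
  have hlf := h.1.isLocallyFiniteMeasure
  refine ⟨h.restrict _, ?_, ?_⟩
  · refine (Measure.support_subset_of_isClosed isClosed_Ici
      (ae_restrict_mem measurableSet_Ici : Ici (1 : ℝ) ∈ ae (mu.restrict (Ici 1)))).trans ?_
    exact Ici_subset_Ici.2 zero_le_one
  · have hle : invMeasure (mu.restrict (Ici 1)) ≤ mu.restrict (Ici 1) := by
      calc invMeasure (mu.restrict (Ici 1)) ≤ (mu.restrict (Ici 1)).withDensity 1 := by
            refine withDensity_mono ?_
            filter_upwards [ae_restrict_mem measurableSet_Ici] with s hs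
            refine ENNReal.inv_le_one.2 ?_
            rw [← ENNReal.ofReal_one]
            exact ENNReal.ofReal_le_ofReal hs
        _ = _ := withDensity_one
    exact Measure.isLocallyFiniteMeasure_of_le hle

lemma exists_decomposition {mu : Measure ℝ} (h : MemMExp 2 mu) :
    ∃ mu₁ mu₂ : Measure ℝ, mu = mu₁ + mu₂ ∧ MemMExp 1 mu₁ ∧ MemMFrac mu₂ := by
  refine ⟨mu.restrict (Iio 1), mu.restrict (Ici 1), ?_, memMExp_one_restrict_Iio h,
    memMFrac_restrict_Ici h⟩
  rw [← compl_Iio, Measure.restrict_add_restrict_compl measurableSet_Iio]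

end Decomposition

/-! ### The solution theorem -/

theorem mainTheorem9 :
    -- solution of the general equation
    (∀ (lam₁ lam₂ : Measure ℝ) (c₀ c₁ : ℝ),
      MemMExp 1 lam₁ → MemMFrac lam₂ → 0 ≤ c₁ →
      -- the equation is not the trivial equation `y = 0`
      ¬ (lam₁ = 0 ∧ lam₂ = 0 ∧ c₀ = 0 ∧ c₁ = 0) →
      ∃ (mu : Measure ℝ) (ζ₀' ζ₁ : ℝ),
        -- `(mu, ζ₀', ζ₁)` is the value of `B_reg`
        IsBreg (lam₁ + lam₂)
          (c₀ - Real.pi * sigmaR lam₁ - Real.pi * xiFrac lam₂) c₁ mu ζ₀' ζ₁ ∧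
        (∀ (nu : Measure ℝ) (η₀ η₁ : ℝ),
          IsBreg (lam₁ + lam₂)
            (c₀ - Real.pi * sigmaR lam₁ - Real.pi * xiFrac lam₂) c₁ nu η₀ η₁ →
          nu = mu ∧ η₀ = ζ₀' ∧ η₁ = ζ₁) ∧
        -- support bounded below, and existence of a decomposition
        MemMExp 2 mu ∧
        (∃ mu₁ mu₂ : Measure ℝ, mu = mu₁ + mu₂ ∧ MemMExp 1 mu₁ ∧ MemMFrac mu₂) ∧
        -- every decomposition gives the solution formula
        (∀ mu₁ mu₂ : Measure ℝ, mu = mu₁ + mu₂ → MemMExp 1 mu₁ → MemMFrac mu₂ →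
          ∀ (x₀ : ℝ) (x y : ℝ → ℝ),
            LocallyIntegrableOn x (Ici 0) → LocallyIntegrableOn y (Ici 0) →
            (SolvesRCM c₀ c₁ (laplaceB lam₁) (laplaceB (invMeasure lam₂)) x₀ x y ↔
              SolvesRCM (ζ₀' + Real.pi * sigmaR mu₁ + Real.pi * xiFrac mu₂) ζ₁
                (laplaceB mu₁) (laplaceB (invMeasure mu₂)) 0 y
                (fun t => -Real.pi ^ 2 * x t
                  + c₁ * x₀ * (laplaceB mu₁ t - deriv (laplaceB (invMeasure mu₂)) t))))) ∧
    -- inversion of Abel's first-kind equation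
    (∀ (α : ℝ), 0 < α → α < 1 → ∀ (x y : ℝ → ℝ),
      LocallyIntegrableOn x (Ici 0) → LocallyIntegrableOn y (Ici 0) →
      ((∀ᵐ t ∂(volume.restrict (Ici (0 : ℝ))),
          y t = (1 / Real.Gamma α) * ∫ τ in (0 : ℝ)..t, x τ / (t - τ) ^ α) ↔
        HasACDeriv
          (fun t => (1 / Real.Gamma (1 - α)) * ∫ τ in (0 : ℝ)..t, y τ / (t - τ) ^ (1 - α))
          0 x)) := by
  refine ⟨fun lam₁ lam₂ c₀ c₁ h₁ h₂ hc₁ hne => ?_, fun α h0 h1 x y hx hy => abel_iff h0 h1 hx hy⟩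
  obtain ⟨a, ha⟩ := h₁.exists_expClass
  have hlam : MemMPlus 2 (lam₁ + lam₂) := ha.memMPlus_two.add h₂.memMPlus_two
  have haN : ∀ᵐ s ∂(lam₁ + lam₂), -|a| ≤ s :=
    ae_add_measure (ha.ae_le.mono fun s hs => (neg_abs_le a).trans hs)
      (h₂.ae_pos.mono fun s hs => by linarith [abs_nonneg a])
  set C₀ := c₀ - Real.pi * sigmaR lam₁ - Real.pi * xiFrac lam₂
  -- Non-negative measures with zero sum both vanish; then so do the σ and ξ shifts, and C₀ = c₀.
  have hne' : ¬ (lam₁ + lam₂ = 0 ∧ C₀ = 0 ∧ c₁ = 0) := by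
    rintro ⟨hl, h0, h1⟩
    have hl₁ : lam₁ = 0 := Measure.nonpos_iff_eq_zero'.1 (hl ▸ Measure.le_add_right le_rfl)
    have hl₂ : lam₂ = 0 := Measure.nonpos_iff_eq_zero'.1 (hl ▸ Measure.le_add_left le_rfl)
    refine hne ⟨hl₁, hl₂, ?_, h1⟩
    simpa [C₀, hl₁, hl₂, sigmaR, xiFrac] using h0
  obtain ⟨mu, ζ₀', ζ₁, hmu, hζ₁, hsupp, hmul⟩ := exists_pick_mul_eq hlam hc₁ haN hne'
  refine ⟨mu, ζ₀', ζ₁, isBreg_iff.2 ⟨hmu, hζ₁, hmul⟩, fun nu η₀ η₁ hnu => ?_, ⟨hmu, hsupp⟩,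
    exists_decomposition ⟨hmu, hsupp⟩, fun mu₁ mu₂ hdec hmu₁ hmu₂ x₀ x y hx hy => ?_⟩
  · obtain ⟨hnu2, -, hnumul⟩ := isBreg_iff.1 hnu
    refine pick_injective hnu2 hmu fun z hz => ?_
    exact mul_left_cancel₀ (pick_ne_zero hlam hc₁ hne' hz)
      ((hnumul z hz).trans (hmul z hz).symm)
  · subst hdec
    have hD : DualPair c₀ c₁ lam₁ lam₂ (ζ₀' + Real.pi * sigmaR mu₁ + Real.pi * xiFrac mu₂) ζ₁
        mu₁ mu₂ := by
      refine ⟨h₁, h₂, hmu₁, hmu₂, hc₁, hζ₁, fun z hz => ?_⟩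
      have e : ζ₀' + Real.pi * sigmaR mu₁ + Real.pi * xiFrac mu₂ - Real.pi * sigmaR mu₁
          - Real.pi * xiFrac mu₂ = ζ₀' := by ring
      rw [e]
      exact hmul z hz
    exact hD.solvesRCM_iff_solvesRCM x₀ hx hy
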